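/- Let $d$ be an integer with $1\le d\le 4$, let $0<a<1/2$ and $c(d)<\beta\le 0$, where $c(d)=\frac{d-5}{2}+\frac{2}{d+1}$ (so $c(1)=-1$, $c(2)=-5/6$, $c(3)=-1/2$, $c(4)=-1/10$). Identify $\mathbb{T}^d=\mathbb{R}^d/\mathbb{Z}^d$ with $(-1/2,1/2]^d\subset\mathbb{R}^d$, let $|\cdot|$ be the Euclidean norm, and put $$U_{\beta,a}(x)=\begin{cases}(a^2-|x|^2)^{\beta},&|x|<a,\\ 0,&|x|\ge a,\end{cases}\qquad u_{\beta,a}(x)=\sum_{m\in\mathbb{Z}^d}U_{\beta,a}(x+m).$$ For an integrable function $f$ on $\mathbb{T}^d$ and $\lambda>0$ let $$\hat f(m)=\int_{\mathbb{T}^d}f(x)e^{-2\pi i m\cdot x}\,dx,\qquad S_\lambda(f)(x)=\sum_{m\in\mathbb{Z}^d,\ |m|<\lambda}\hat f(m)e^{2\pi i m\cdot x},$$ and let $G_a=\{x\in\mathbb{T}^d: x\ne 0,\ |x-m|=a\text{ for some }m\in\mathbb{Z}^d\}$, which equals $\{x\in\mathbb{T}^d:|x|=a\}$ since $a<1/2$.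 Then the improper integrals in $$G^{\pm}_{\beta,a}=\mp\frac{\Gamma(\beta+1)\,a^{\beta}(2\pm\beta)^{\beta}}{\pi\,2^{\beta}}\int_{\pi}^{\infty}\frac{\sin s}{\left(s\pm\frac{\beta}{2}\pi\right)^{\beta+1}}\,ds$$ converge, $G^{+}_{\beta,a}>0>G^{-}_{\beta,a}$, and near $G_a$ the spherical partial sums $S_\lambda(u_{\beta,a})$ show a phenomenon of Gibbs–Wilbraham type in the following sense. For every $x_0\in G_a$ and every family of points $x_\lambda^{\pm}\in\mathbb{T}^d$, defined for all large real $\lambda$, with $\lim_{\lambda\to\infty}x_\lambda^{\pm}=x_0$ and $|x_\lambda^{\pm}|=a\mp\frac{2\pm\beta}{4\lambda}$, $$\lim_{\lambda\to\infty}\frac{S_\lambda(u_{\beta,a})(x_\lambda^{\pm})-u_{\beta,a}(x_\lambda^{\pm})}{\lambda^{-\beta}}=G^{\pm}_{\beta,a}.$$ The statement holds for the upper signs and for the lower signs separately. -/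

import Mathlib

open Filter Topology MeasureTheory

noncomputable section

namespace SphericalFourier

/-- The point of `ℝ^d` with integer coordinates `m`. -/
def latticePoint {d : ℕ} (m : Fin d → ℤ) : EuclideanSpace ℝ (Fin d) :=
  WithLp.toLp 2 (fun i => (m i : ℝ))

/-- The torus `ℝ^d / ℤ^d`, identified with the cube `(-1/2, 1/2]^d`. -/
def torus (d : ℕ) : Set (EuclideanSpace ℝ (Fin d)) :=
  {x | ∀ i, -(1 / 2 : ℝ) < x i ∧ x i ≤ 1 / 2}

/-- The radial function `(a² - |x|²)^β` for `|x| < a`, and `0` for `|x| ≥ a`. -/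
def bigU {d : ℕ} (β a : ℝ) (x : EuclideanSpace ℝ (Fin d)) : ℝ :=
  if ‖x‖ < a then (a ^ 2 - ‖x‖ ^ 2) ^ β else 0

/-- The periodization of `bigU` (at each `x` only finitely many terms are nonzero). -/
def smallU {d : ℕ} (β a : ℝ) (x : EuclideanSpace ℝ (Fin d)) : ℝ :=
  ∑' m : Fin d → ℤ, bigU β a (x + latticePoint m)

/-- The character `e^{2π i m x}`. -/
def character {d : ℕ} (m : Fin d → ℤ) (x : EuclideanSpace ℝ (Fin d)) : ℂ :=
  Complex.exp (2 * Real.pi * Complex.I * ((∑ k, (m k : ℝ) * x k : ℝ) : ℂ))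

/-- The Fourier coefficient `∫_{𝕋^d} f(x) e^{-2π i m x} dx`. -/
def torusCoeff {d : ℕ} (f : EuclideanSpace ℝ (Fin d) → ℝ) (m : Fin d → ℤ) : ℂ :=
  ∫ x in torus d, (f x : ℂ) * character (-m) x

theorem finite_lattice_ball (d : ℕ) (R : ℝ) :
    {m : Fin d → ℤ | ‖latticePoint m‖ < R}.Finite := by
  refine (Set.finite_Icc (fun _ : Fin d => -⌈R⌉) (fun _ => ⌈R⌉)).subset ?_
  intro m hm
  have key : ∀ i, |(m i : ℝ)| ≤ (⌈R⌉ : ℝ) := fun i => by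
    have h1 := PiLp.norm_apply_le (latticePoint m) i
    have h2 : ‖latticePoint m i‖ = |(m i : ℝ)| := rfl
    have h3 : ‖latticePoint m‖ < R := hm
    have h4 := Int.le_ceil R
    linarith
  constructor
  · intro i
    have := (abs_le.mp (key i)).1
    exact_mod_cast this
  · intro i
    have := (abs_le.mp (key i)).2
    exact_mod_cast this

/-- The spherical partial sum `S_R(f)(x) = ∑_{|m| < R} f̂(m) e^{2π i m x}`. -/
def sphericalSum {d : ℕ} (R : ℝ) (f : EuclideanSpace ℝ (Fin d) → ℝ)
    (x : EuclideanSpace ℝ (Fin d)) : ℂ :=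
  ∑ m ∈ (finite_lattice_ball d R).toFinset, torusCoeff f m * character m x

/-- The set `G_a` of nonzero points of the torus at distance `a` from some lattice point. -/
def sphereSet (d : ℕ) (a : ℝ) : Set (EuclideanSpace ℝ (Fin d)) :=
  {x | x ∈ torus d ∧ x ≠ 0 ∧ ∃ m : Fin d → ℤ, ‖x - latticePoint m‖ = a}

/-- The threshold `c(d)`. -/
def threshold (d : ℕ) : ℝ := (d : ℝ) - 2 * d / (d + 1) - (d + 1) / 2

/-- `I` is the value of the (possibly only conditionally convergent) improper integral
`∫_b^∞ f(s) ds`. -/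
def HasImproperIntegral (f : ℝ → ℝ) (b I : ℝ) : Prop :=
  Tendsto (fun R : ℝ => ∫ s in b..R, f s) atTop (𝓝 I)

/-- The integrand `sin s / (s + ε (β/2) π)^{β+1}`, with `ε = ± 1`. -/
def gibbsIntegrand (ε β s : ℝ) : ℝ :=
  Real.sin s / (s + ε * (β / 2) * Real.pi) ^ (β + 1)

/-- The constant `G^ε_{β,a}`, with `ε = ± 1`, in terms of the value `I` of the improper integral
of `gibbsIntegrand ε β` over `[π, ∞)`. -/
def gibbsConst (ε β a I : ℝ) : ℝ :=
  -ε * (Real.Gamma (β + 1) * a ^ β * (2 + ε * β) ^ β / (Real.pi * 2 ^ β)) * I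

end SphericalFourier

end

/-! Write $d=n+1$ and $U=U_{\beta,a}$, and let $l$ be the radius of the partial sum. The sharp
cutoff $|m|<l$ is compared with a smooth radial one that falls from 1 to 0 across $l\le|\xi|\le
l+\eta$. Poisson summation turns the smoothly truncated series into $\sum_m \mathrm{sm}(x+m)$, where
$\mathrm{sm}$ (`smoothed`) is the inverse Fourier transform of the truncated $\hat U$. For $m\ne0$
the point $x+m$ has norm at least $1/2>a$, where $U=0$ and $\mathrm{sm}$ is a pure high-frequency
remainder. The term $m=0$ carries the Gibbs phenomenon.

The remainder $U(w)-\mathrm{sm}(w)$ is an integral over radii $t>l$ of $\hat U(t)$ times the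
integral of a plane wave over the sphere of radius $t$. Moving a contour to vertical half-lines
splits each factor into an outgoing and an incoming wave with holomorphic amplitudes
(`besselInt_eq_hankelAmp`, `sphereWave_eq_waveAmp`). The product then has the four phases $e^{2\pi
i(\pm a\pm|w|)t}$ with amplitudes of order $t^{-1-\beta}$, whatever the dimension. Cauchy estimates
for the amplitudes and up to three integrations by parts (`IsCutoff.exists_norm_integral_le`)
control every phase that is not close to stationary. Since $\hat U$ need not be integrable,
inversion is done with a factor $e^{-c|\xi|^2}$, and all bounds are uniform in $c$.

Near $|w|=a$, with $a-|w|=\varepsilon q/l$ and $q=(2+\varepsilon\beta)/4$, the two opposite-sign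
phases do not oscillate before $t\sim l$. Their leading part is a constant times $\int_l^\infty
t^{-1-\beta}\sin(2\pi(a-|w|)t-\pi\beta/2)\,dt$, and $t=ls$ makes this $\varepsilon
l^{-\beta}\int_1^\infty s^{-1-\beta}\sin(ks-\varphi)\,ds$ with $k=2\pi q$,
$\varphi=\varepsilon\beta\pi/2$. The distance in the theorem is the one for which $k-\varphi=\pi$.
Integrating by parts with the primitive $-(1+\cos(ks-\varphi))/k$, which vanishes at $s=1$, gives
convergence and the sign at once (`oscValue_zero_neg`).

The choice of $\eta$ balances two errors. Shell points number at most about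
$l^n\eta+l^{n/2}\eta^{-8/5}$ (`exists_card_shell_le`) and carry coefficients of size
$l^{-\beta-n/2-1}$; the nonzero translates contribute $l^{-1-\beta}\eta^{-8/5}$
(`exists_norm_lattice_sum_sub_integral_le`). For $n\le3$ and $\eta=l^{-3/5}$ everything is
$O(l^{-\beta-1/25})$, smaller than the main term $l^{-\beta}$. -/

open Filter Topology MeasureTheory

noncomputable section

namespace SphericalFourier

/-! ### Phases and truncated powers -/

/-- The phase `e^{2π i t}`. -/
def ephase (t : ℝ) : ℂ := Complex.exp (2 * Real.pi * Complex.I * t)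

theorem norm_ephase (t : ℝ) : ‖ephase t‖ = 1 := by
  rw [ephase, Complex.norm_exp]; simp

theorem ephase_add (s t : ℝ) : ephase (s + t) = ephase s * ephase t := by
  rw [ephase, ephase, ephase, ← Complex.exp_add]; congr 1; push_cast; ring

theorem continuous_ephase : Continuous ephase := by unfold ephase; fun_prop

/-- The truncated power `A₊^γ`. -/
def posRpow (γ A : ℝ) : ℝ := if 0 < A then A ^ γ else 0

theorem posRpow_nonneg (γ A : ℝ) : 0 ≤ posRpow γ A := by
  unfold posRpow; split_ifs with h
  · positivity
  · exact le_rfl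

theorem posRpow_of_pos {γ A : ℝ} (h : 0 < A) : posRpow γ A = A ^ γ := if_pos h

theorem posRpow_of_nonpos {γ A : ℝ} (h : A ≤ 0) : posRpow γ A = 0 := if_neg h.not_gt

theorem measurable_posRpow (γ : ℝ) : Measurable (posRpow γ) :=
  Measurable.ite measurableSet_Ioi (measurable_id.pow_const γ) measurable_const

theorem posRpow_mul {γ A B : ℝ} (hA : 0 < A) : posRpow γ (A * B) = A ^ γ * posRpow γ B := by
  rcases lt_or_ge 0 B with hB | hB
  · rw [posRpow_of_pos hB, posRpow_of_pos (mul_pos hA hB), Real.mul_rpow hA.le hB.le]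
  · rw [posRpow_of_nonpos hB, posRpow_of_nonpos (mul_nonpos_of_nonneg_of_nonpos hA.le hB), mul_zero]

/-! ### Total mass of truncated radial powers -/

theorem lintegral_exp_neg_mul_posRpow {γ : ℝ} (hγ : -1 < γ) (B : ℝ) :
    ∫⁻ A, ENNReal.ofReal (Real.exp (-A) * posRpow γ (A - B)) =
      ENNReal.ofReal (Real.exp (-B) * Real.Gamma (γ + 1)) := by
  have h0 : ∫⁻ A, ENNReal.ofReal (Real.exp (-A) * posRpow γ A) =
      ENNReal.ofReal (Real.Gamma (γ + 1)) := by
    have h1 : (fun A => ENNReal.ofReal (Real.exp (-A) * posRpow γ A)) =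
        (Set.Ioi (0 : ℝ)).indicator
          (fun A => ENNReal.ofReal (Real.exp (-A) * A ^ (γ + 1 - 1))) := by
      funext A
      by_cases hA : 0 < A
      · rw [Set.indicator_of_mem (Set.mem_Ioi.2 hA), posRpow_of_pos hA, add_sub_cancel_right]
      · rw [Set.indicator_of_notMem (by simpa using hA), posRpow_of_nonpos (not_lt.1 hA)]; simp
    rw [h1, lintegral_indicator measurableSet_Ioi, Real.Gamma_eq_integral (by linarith),
      ofReal_integral_eq_lintegral_ofReal (Real.GammaIntegral_convergent (by linarith))]
    filter_upwards [ae_restrict_mem measurableSet_Ioi] with A hA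
    have : (0 : ℝ) < A := hA
    positivity
  have h2 := lintegral_sub_right_eq_self (μ := volume)
    (fun A => ENNReal.ofReal (Real.exp (-(A + B)) * posRpow γ A)) B
  simp only [sub_add_cancel] at h2
  rw [h2, ENNReal.ofReal_mul (Real.exp_pos _).le, ← h0, ← lintegral_const_mul]
  · congr 1
    funext A
    rw [← ENNReal.ofReal_mul (Real.exp_pos _).le, neg_add, Real.exp_add]
    congr 1; ring
  · exact ENNReal.measurable_ofReal.comp
      ((Real.measurable_exp.comp measurable_neg).mul (measurable_posRpow γ))

/-- The total mass of `(1 - |y|²)₊^γ` in dimension `n`. -/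
def ballMass (n : ℕ) (γ : ℝ) : ℝ :=
  Real.pi ^ ((n : ℝ) / 2) * Real.Gamma (γ + 1) / Real.Gamma (γ + (n : ℝ) / 2 + 1)

theorem ballMass_mul_Gamma (n : ℕ) {γ : ℝ} (hγ : -1 < γ) :
    ballMass n γ * Real.Gamma (γ + (n : ℝ) / 2 + 1) =
      Real.pi ^ ((n : ℝ) / 2) * Real.Gamma (γ + 1) := by
  unfold ballMass
  rw [div_mul_cancel₀]
  exact (Real.Gamma_pos_of_pos (by have : (0 : ℝ) ≤ n := n.cast_nonneg; linarith)).ne'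

theorem ballMass_pos (n : ℕ) {γ : ℝ} (hγ : -1 < γ) : 0 < ballMass n γ := by
  have h : (0 : ℝ) ≤ n := n.cast_nonneg
  have := Real.Gamma_pos_of_pos (show 0 < γ + 1 by linarith)
  have := Real.Gamma_pos_of_pos (show 0 < γ + (n : ℝ) / 2 + 1 by linarith)
  unfold ballMass
  positivity

section Mass

variable {V : Type*} [NormedAddCommGroup V] [InnerProductSpace ℝ V] [FiniteDimensional ℝ V]
  [MeasurableSpace V] [BorelSpace V]

theorem lintegral_posRpow_sub_sq_eq_smul {γ A : ℝ} (hA : 0 < A) :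
    ∫⁻ y : V, ENNReal.ofReal (posRpow γ (A - ‖y‖ ^ 2)) =
      ENNReal.ofReal (A ^ (γ + (Module.finrank ℝ V : ℝ) / 2)) *
        ∫⁻ y : V, ENNReal.ofReal (posRpow γ (1 - ‖y‖ ^ 2)) := by
  have hs : 0 < √A := Real.sqrt_pos.2 hA
  have h1 : Measure.map (fun y : V => √A • y) volume =
      ENNReal.ofReal |(√A ^ Module.finrank ℝ V)⁻¹| • volume :=
    Measure.map_addHaar_smul volume hs.ne'
  have hm : Measurable (fun y : V => ENNReal.ofReal (posRpow γ (A - ‖y‖ ^ 2))) :=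
    ENNReal.measurable_ofReal.comp ((measurable_posRpow γ).comp (by fun_prop))
  have h2 : ∫⁻ y : V, ENNReal.ofReal (posRpow γ (A - ‖√A • y‖ ^ 2)) =
      ENNReal.ofReal |(√A ^ Module.finrank ℝ V)⁻¹| *
        ∫⁻ y : V, ENNReal.ofReal (posRpow γ (A - ‖y‖ ^ 2)) := by
    rw [← smul_eq_mul, ← lintegral_smul_measure, ← h1, lintegral_map hm (by fun_prop)]
  have h3 : ∀ y : V, ENNReal.ofReal (posRpow γ (A - ‖√A • y‖ ^ 2)) =
      ENNReal.ofReal (A ^ γ) * ENNReal.ofReal (posRpow γ (1 - ‖y‖ ^ 2)) := by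
    intro y
    rw [← ENNReal.ofReal_mul (by positivity), ← posRpow_mul hA, norm_smul, Real.norm_eq_abs,
      abs_of_pos hs, mul_pow, Real.sq_sqrt hA.le]
    congr 2; ring
  simp_rw [h3] at h2
  rw [lintegral_const_mul' _ _ ENNReal.ofReal_ne_top] at h2
  have h4 : ENNReal.ofReal (√A ^ Module.finrank ℝ V) *
      ENNReal.ofReal |(√A ^ Module.finrank ℝ V)⁻¹| = 1 := by
    rw [← ENNReal.ofReal_mul (by positivity), abs_of_pos (by positivity),
      mul_inv_cancel₀ (by positivity), ENNReal.ofReal_one]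
  rw [Real.rpow_add hA, ENNReal.ofReal_mul (by positivity)]
  have h5 : A ^ ((Module.finrank ℝ V : ℝ) / 2) = √A ^ Module.finrank ℝ V := by
    rw [Real.sqrt_eq_rpow, ← Real.rpow_natCast, ← Real.rpow_mul hA.le]; congr 1; ring
  rw [h5, mul_comm (ENNReal.ofReal (A ^ γ)), mul_assoc, h2, ← mul_assoc, h4, one_mul]

/-- Integrate $e^{-A}(A-|y|^2)_+^\gamma$ over $(A,y)$ in both orders. Integrating $A$ first leaves
$\Gamma(\gamma+1)$ times a Gaussian integral; integrating $y$ first leaves, by scaling, the unknown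
mass times $\Gamma(\gamma+n/2+1)$. Dimension $0$ is included, which the case $d=1$ needs. -/
theorem lintegral_posRpow_one_sub_sq {γ : ℝ} (hγ : -1 < γ) :
    ∫⁻ y : V, ENNReal.ofReal (posRpow γ (1 - ‖y‖ ^ 2)) =
      ENNReal.ofReal (ballMass (Module.finrank ℝ V) γ) := by
  set n := Module.finrank ℝ V with hn
  have hn0 : (0 : ℝ) ≤ n := n.cast_nonneg
  have hG := Real.Gamma_pos_of_pos (show 0 < γ + (n : ℝ) / 2 + 1 by linarith)
  set M := ∫⁻ y : V, ENNReal.ofReal (posRpow γ (1 - ‖y‖ ^ 2)) with hM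
  have hmeas : Measurable (fun p : ℝ × V =>
      ENNReal.ofReal (Real.exp (-p.1) * posRpow γ (p.1 - ‖p.2‖ ^ 2))) :=
    ENNReal.measurable_ofReal.comp ((by fun_prop : Measurable fun p : ℝ × V =>
      Real.exp (-p.1)).mul ((measurable_posRpow γ).comp (by fun_prop)))
  have h1 : ∫⁻ A : ℝ, ∫⁻ y : V, ENNReal.ofReal (Real.exp (-A) * posRpow γ (A - ‖y‖ ^ 2)) =
      ENNReal.ofReal (Real.pi ^ ((n : ℝ) / 2) * Real.Gamma (γ + 1)) := by
    rw [lintegral_lintegral_swap hmeas.aemeasurable]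
    simp_rw [lintegral_exp_neg_mul_posRpow hγ]
    have hG1 := Real.Gamma_pos_of_pos (show 0 < γ + 1 by linarith)
    rw [← ofReal_integral_eq_lintegral_ofReal]
    · rw [integral_mul_const]
      have := GaussianFourier.integral_rexp_neg_mul_sq_norm (V := V) one_pos
      simp only [neg_mul, one_mul, div_one] at this
      rw [this]
    · apply Integrable.mul_const
      -- The value of the Gaussian integral proves integrability: a non-integrable function would
      -- have integral $0$ by convention, but $\pi^{n/2}>0$.
      by_contra hcon
      have := GaussianFourier.integral_rexp_neg_mul_sq_norm (V := V) one_pos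
      simp only [neg_mul, one_mul, div_one] at this
      rw [integral_undef hcon] at this
      have : (0 : ℝ) < Real.pi ^ ((Module.finrank ℝ V : ℝ) / 2) := by positivity
      linarith
    · exact Eventually.of_forall fun y => by positivity
  have h2 : ∀ A : ℝ, ∫⁻ y : V, ENNReal.ofReal (Real.exp (-A) * posRpow γ (A - ‖y‖ ^ 2)) =
      ENNReal.ofReal (Real.exp (-A) * posRpow (γ + (n : ℝ) / 2) (A - 0)) * M := by
    intro A
    rw [sub_zero]
    rcases lt_or_ge 0 A with hA | hA
    · simp_rw [ENNReal.ofReal_mul (Real.exp_pos (-A)).le]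
      rw [lintegral_const_mul' _ _ ENNReal.ofReal_ne_top, lintegral_posRpow_sub_sq_eq_smul hA,
        posRpow_of_pos hA, mul_assoc]
    · have : ∀ y : V, posRpow γ (A - ‖y‖ ^ 2) = 0 := fun y =>
        posRpow_of_nonpos (by nlinarith [sq_nonneg ‖y‖])
      simp [this, posRpow_of_nonpos hA]
  simp_rw [h2] at h1
  rw [lintegral_mul_const, lintegral_exp_neg_mul_posRpow (by linarith)] at h1
  · rw [neg_zero, Real.exp_zero, one_mul, ← ballMass_mul_Gamma n hγ,
      ENNReal.ofReal_mul (ballMass_pos n hγ).le, mul_comm] at h1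
    exact (ENNReal.mul_left_inj (by simpa using hG) ENNReal.ofReal_ne_top).1 h1
  · exact ENNReal.measurable_ofReal.comp ((by fun_prop : Measurable fun p : ℝ =>
      Real.exp (-p)).mul ((measurable_posRpow _).comp (by fun_prop)))

theorem lintegral_posRpow_sub_sq {γ : ℝ} (hγ : -1 < γ) (A : ℝ) :
    ∫⁻ y : V, ENNReal.ofReal (posRpow γ (A - ‖y‖ ^ 2)) =
      ENNReal.ofReal (ballMass (Module.finrank ℝ V) γ *
        posRpow (γ + (Module.finrank ℝ V : ℝ) / 2) A) := by
  rcases lt_or_ge 0 A with hA | hA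
  · rw [lintegral_posRpow_sub_sq_eq_smul hA, lintegral_posRpow_one_sub_sq hγ,
      posRpow_of_pos hA, mul_comm, ENNReal.ofReal_mul (ballMass_pos _ hγ).le]
  · have : ∀ y : V, posRpow γ (A - ‖y‖ ^ 2) = 0 := fun y =>
      posRpow_of_nonpos (by nlinarith [sq_nonneg ‖y‖])
    simp [this, posRpow_of_nonpos hA]

theorem measurable_posRpow_sub_sq {V : Type*} [NormedAddCommGroup V] [MeasurableSpace V] [BorelSpace V]
    (γ A : ℝ) : Measurable fun y : V => posRpow γ (A - ‖y‖ ^ 2) :=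
  (measurable_posRpow γ).comp (by fun_prop)

theorem integrable_posRpow_sub_sq {γ : ℝ} (hγ : -1 < γ) (A : ℝ) :
    Integrable fun y : V => posRpow γ (A - ‖y‖ ^ 2) := by
  refine ⟨(measurable_posRpow_sub_sq γ A).aestronglyMeasurable, ?_⟩
  rw [hasFiniteIntegral_iff_ofReal (Eventually.of_forall fun y => posRpow_nonneg _ _),
    lintegral_posRpow_sub_sq hγ]
  exact ENNReal.ofReal_lt_top

theorem integral_posRpow_sub_sq {γ : ℝ} (hγ : -1 < γ) (A : ℝ) :
    ∫ y : V, posRpow γ (A - ‖y‖ ^ 2) =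
      ballMass (Module.finrank ℝ V) γ * posRpow (γ + (Module.finrank ℝ V : ℝ) / 2) A := by
  rw [integral_eq_lintegral_of_nonneg_ae (Eventually.of_forall fun y => posRpow_nonneg _ _)
    (measurable_posRpow_sub_sq γ A).aestronglyMeasurable, lintegral_posRpow_sub_sq hγ,
    ENNReal.toReal_ofReal (mul_nonneg (ballMass_pos _ hγ).le (posRpow_nonneg _ _))]

end Mass

/-! ### The Fourier transform of the radial power as a Bessel integral -/

theorem bigU_eq_posRpow {d : ℕ} (β : ℝ) {a : ℝ} (ha : 0 < a) (x : EuclideanSpace ℝ (Fin d)) :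
    bigU β a x = posRpow β (a ^ 2 - ‖x‖ ^ 2) := by
  unfold bigU posRpow
  have : ‖x‖ < a ↔ 0 < a ^ 2 - ‖x‖ ^ 2 := by
    rw [sub_pos, sq_lt_sq₀ (norm_nonneg _) ha.le]
  simp only [this]

theorem integrable_bigU {d : ℕ} {β a : ℝ} (hβ : -1 < β) (ha : 0 < a) :
    Integrable (bigU β a : EuclideanSpace ℝ (Fin d) → ℝ) := by
  have : (bigU β a : EuclideanSpace ℝ (Fin d) → ℝ) = fun x => posRpow β (a ^ 2 - ‖x‖ ^ 2) :=
    funext (bigU_eq_posRpow β ha)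
  rw [this]
  exact integrable_posRpow_sub_sq hβ _

/-- The Poisson integral `∫_{-1}^1 (1 - s²)^μ e^{2π i r s} ds` of Bessel functions. -/
def besselInt (μ r : ℝ) : ℂ :=
  ∫ s in Set.Ioo (-1 : ℝ) 1, (((1 - s ^ 2) ^ μ : ℝ) : ℂ) * ephase (r * s)

theorem integral_posRpow_mul_exp (μ : ℝ) {a : ℝ} (ha : 0 < a) (r : ℝ) :
    ∫ s : ℝ, (posRpow μ (a ^ 2 - s ^ 2) : ℂ) * ephase (r * s) =
      ((a ^ (2 * μ + 1) : ℝ) : ℂ) * besselInt μ (a * r) := by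
  have h1 := Measure.integral_comp_mul_left (fun s : ℝ => (posRpow μ (a ^ 2 - s ^ 2) : ℂ) *
    ephase (r * s)) a
  have h2 : ∀ s : ℝ, (posRpow μ (a ^ 2 - (a * s) ^ 2) : ℂ) *
      ephase (r * (a * s)) =
      ((a ^ (2 * μ) : ℝ) : ℂ) * (Set.Ioo (-1 : ℝ) 1).indicator (fun s : ℝ =>
        (((1 - s ^ 2) ^ μ : ℝ) : ℂ) * ephase ((a * r) * s)) s := by
    intro s
    have h3 : a ^ 2 - (a * s) ^ 2 = a ^ 2 * (1 - s ^ 2) := by ring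
    have h4 : (a ^ 2) ^ μ = a ^ (2 * μ) := by
      rw [Real.rpow_mul ha.le]; norm_num
    rw [h3, posRpow_mul (by positivity), h4]
    by_cases hs : s ∈ Set.Ioo (-1 : ℝ) 1
    · rw [Set.indicator_of_mem hs, posRpow_of_pos (by nlinarith [hs.1, hs.2])]
      rw [show r * (a * s) = a * r * s by ring]; push_cast; ring
    · rw [Set.indicator_of_notMem hs, posRpow_of_nonpos]
      · simp
      · by_contra hcon
        push Not at hcon
        exact hs (abs_lt.1 (by
          rw [← sq_lt_one_iff_abs_lt_one]; linarith))
  simp_rw [h2] at h1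
  rw [integral_const_mul, integral_indicator measurableSet_Ioo] at h1
  have h5 : ((a ^ (2 * μ + 1) : ℝ) : ℂ) = a * ((a ^ (2 * μ) : ℝ) : ℂ) := by
    rw [Real.rpow_add ha, Real.rpow_one]; push_cast; ring
  rw [h5, mul_assoc]
  unfold besselInt
  rw [h1, abs_of_pos (inv_pos.2 ha), Complex.real_smul, ← mul_assoc, Complex.ofReal_inv]
  rw [mul_inv_cancel₀ (by exact_mod_cast ha.ne'), one_mul]

/-- Splitting off the first coordinate. -/
def splitFirst (n : ℕ) (x : EuclideanSpace ℝ (Fin (n + 1))) : ℝ × EuclideanSpace ℝ (Fin n) :=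
  (x 0, WithLp.toLp 2 fun i => x i.succ)

theorem measurePreserving_splitFirst (n : ℕ) : MeasurePreserving (splitFirst n) := by
  have h1 := PiLp.volume_preserving_ofLp (Fin (n + 1))
  have h2 := volume_preserving_piFinSuccAbove (fun _ : Fin (n + 1) => ℝ) 0
  have h3 : MeasurePreserving (Prod.map id (WithLp.toLp 2) : ℝ × (Fin n → ℝ) → _) :=
    (MeasurePreserving.id volume).prod (PiLp.volume_preserving_toLp (Fin n))
  have h := h3.comp (h2.comp h1)
  convert! h using 1

theorem norm_sq_eq_splitFirst (n : ℕ) (x : EuclideanSpace ℝ (Fin (n + 1))) :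
    ‖x‖ ^ 2 = (splitFirst n x).1 ^ 2 + ‖(splitFirst n x).2‖ ^ 2 := by
  simp [splitFirst, EuclideanSpace.norm_sq_eq, Fin.sum_univ_succ]

/-- Fubini: the slice at first coordinate $s$ is a truncated power of $(a^2-s^2)-|y|^2$ in $n$
variables, so its mass is a multiple of $(a^2-s^2)_+^{\beta+n/2}$. This is the source of the Bessel
order $\beta+n/2$. -/
theorem integral_bigU_mul_exp_first {n : ℕ} {β a : ℝ} (hβ : -1 < β) (ha : 0 < a) (r : ℝ) :
    ∫ x : EuclideanSpace ℝ (Fin (n + 1)),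
      (bigU β a x : ℂ) * ephase (r * x 0) =
      ((ballMass n β * a ^ (2 * (β + (n : ℝ) / 2) + 1) : ℝ) : ℂ) *
        besselInt (β + (n : ℝ) / 2) (a * r) := by
  set G : ℝ × EuclideanSpace ℝ (Fin n) → ℂ := fun p =>
    (posRpow β (a ^ 2 - (p.1 ^ 2 + ‖p.2‖ ^ 2)) : ℂ) *
      ephase (r * p.1) with hG
  have hGm : Measurable G := by
    refine Measurable.mul (Complex.measurable_ofReal.comp ((measurable_posRpow β).comp ?_)) ?_
    · fun_prop
    · exact continuous_ephase.measurable.comp (by fun_prop)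
  have h0 : ∀ x : EuclideanSpace ℝ (Fin (n + 1)), (bigU β a x : ℂ) *
      ephase (r * x 0) = G (splitFirst n x) := by
    intro x
    rw [bigU_eq_posRpow β ha, norm_sq_eq_splitFirst]; rfl
  have hmp := measurePreserving_splitFirst n
  have hGi : Integrable G (volume.prod volume) := by
    have hint : Integrable (G ∘ splitFirst n) volume := by
      have : G ∘ splitFirst n = fun x => (bigU β a x : ℂ) *
        ephase (r * x 0) := funext fun x => (h0 x).symm
      rw [this]
      refine (integrable_bigU (d := n + 1) hβ ha).ofReal.mul_bdd (c := 1) (continuous_ephase.comp (by fun_prop)).aestronglyMeasurable ?_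
      exact Eventually.of_forall fun x => (norm_ephase _).le
    exact (hmp.integrable_comp hGm.aestronglyMeasurable).1 hint
  simp_rw [h0]
  rw [← integral_map hmp.measurable.aemeasurable (by rw [hmp.map_eq]; exact hGm.aestronglyMeasurable), hmp.map_eq]
  change ∫ y, G y ∂(volume.prod volume) = _
  rw [integral_prod _ hGi]
  have h1 : ∀ s : ℝ, ∫ y : EuclideanSpace ℝ (Fin n), G (s, y) =
      (ballMass n β : ℂ) * ((posRpow (β + (n : ℝ) / 2) (a ^ 2 - s ^ 2) : ℂ) *
        ephase (r * s)) := by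
    intro s
    simp only [hG]
    rw [integral_mul_const]
    have h2 : ∀ y : EuclideanSpace ℝ (Fin n), ((posRpow β (a ^ 2 - (s ^ 2 + ‖y‖ ^ 2)) : ℝ) : ℂ) =
      ((posRpow β ((a ^ 2 - s ^ 2) - ‖y‖ ^ 2) : ℝ) : ℂ) := fun y => by rw [sub_add_eq_sub_sub]
    simp_rw [h2]
    rw [integral_complex_ofReal, integral_posRpow_sub_sq hβ, finrank_euclideanSpace_fin]
    push_cast; ring
  simp_rw [h1]
  rw [integral_const_mul, integral_posRpow_mul_exp _ ha]
  push_cast; ring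

open FourierTransform in
/-- The Fourier transform of `bigU`. -/
theorem fourier_bigU {n : ℕ} {β a : ℝ} (hβ : -1 < β) (ha : 0 < a)
    (ξ : EuclideanSpace ℝ (Fin (n + 1))) :
    𝓕 (fun x => (bigU β a x : ℂ)) ξ =
      ((ballMass n β * a ^ (2 * (β + (n : ℝ) / 2) + 1) : ℝ) : ℂ) *
        besselInt (β + (n : ℝ) / 2) (a * ‖ξ‖) := by
  -- By radial symmetry a reflection moves $\xi$ to the first axis. The sign in $-\|\xi\|$ cancels
  -- the one in the Fourier kernel, so that the phase becomes $e^{2\pi i\|\xi\|x_0}$.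
  set e : EuclideanSpace ℝ (Fin (n + 1)) := EuclideanSpace.single 0 (-‖ξ‖) with he
  have hne : ‖ξ‖ = ‖e‖ := by simp [he]
  set R := (ℝ ∙ (ξ - e))ᗮ.reflection
  have hR : R ξ = e := Submodule.reflection_sub hne
  have h1 := Real.fourier_comp_linearIsometry R (fun x => (bigU β a x : ℂ)) ξ
  rw [hR] at h1
  have h2 : (fun x => (bigU β a x : ℂ)) ∘ R = fun x => (bigU β a x : ℂ) := by
    funext x
    simp [bigU]
  rw [h2] at h1
  rw [h1, Real.fourier_eq', ← integral_bigU_mul_exp_first hβ ha]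
  congr 1
  funext x
  rw [smul_eq_mul, mul_comm, ephase]
  congr 2
  simp [he, EuclideanSpace.inner_single_right]
  ring

/-! ### Hankel amplitudes as Laplace integrals and their asymptotics -/

/-- One term of the exponential series at $\delta(1+v)$. It lets polynomial growth of a kernel be
paid for by part of the Laplace decay. -/
theorem exists_one_add_pow_le_exp (m : ℕ) {δ : ℝ} (hδ : 0 < δ) :
    ∃ C : ℝ, 0 < C ∧ ∀ v : ℝ, 0 ≤ v → (1 + v) ^ m ≤ C * Real.exp (δ * v) := by
  refine ⟨(δ ^ m)⁻¹ * m.factorial * Real.exp δ, by positivity, fun v hv => ?_⟩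
  have h1 := Real.pow_div_factorial_le_exp (x := δ + δ * v) (by positivity) m
  rw [div_le_iff₀ (by positivity), Real.exp_add] at h1
  have h2 : (δ + δ * v) ^ m = δ ^ m * (1 + v) ^ m := by rw [← mul_pow]; congr 1; ring
  rw [h2] at h1
  have h3 : (1 + v) ^ m = (δ ^ m)⁻¹ * (δ ^ m * (1 + v) ^ m) := by
    rw [← mul_assoc, inv_mul_cancel₀ (by positivity), one_mul]
  rw [h3]
  calc _ ≤ (δ ^ m)⁻¹ * (Real.exp δ * Real.exp (δ * v) * m.factorial) := by gcongr
    _ = _ := by ring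

theorem integrableOn_rpow_mul_exp_neg {p b : ℝ} (hp : -1 < p) (hb : 0 < b) :
    IntegrableOn (fun v : ℝ => v ^ p * Real.exp (-(b * v))) (Set.Ioi 0) := by
  have := integrableOn_rpow_mul_exp_neg_mul_rpow hp one_pos hb
  simpa using this

theorem integral_rpow_mul_exp_neg {p b : ℝ} (hp : -1 < p) (hb : 0 < b) :
    ∫ v in Set.Ioi (0 : ℝ), v ^ p * Real.exp (-(b * v)) = b ^ (-p - 1) * Real.Gamma (p + 1) := by
  have := Real.integral_rpow_mul_exp_neg_mul_Ioi (a := p + 1) (by linarith) hb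
  rw [add_sub_cancel_right] at this
  rw [this, one_div, Real.inv_rpow hb.le, ← Real.rpow_neg hb.le]
  congr 2; ring

/-- The density of the Laplace representation of the Hankel functions. -/
def hankelKernel (σ μ v : ℝ) : ℂ :=
  ((v ^ μ : ℝ) : ℂ) * ((v : ℂ) - 2 * σ * Complex.I) ^ (μ : ℂ)

/-- The amplitude of the outgoing (`σ = 1`) or incoming (`σ = -1`) part of `besselInt`. -/
def hankelAmp (σ μ : ℝ) (z : ℂ) : ℂ :=
  -σ * Complex.I * ∫ v in Set.Ioi (0 : ℝ), hankelKernel σ μ v * Complex.exp (-(2 * Real.pi * z * v))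

theorem sub_two_I_mem_slitPlane {σ : ℝ} (hσ : σ ≠ 0) (v : ℝ) :
    ((v : ℂ) - 2 * σ * Complex.I) ∈ Complex.slitPlane := by
  right; simpa using hσ

theorem norm_sub_two_I_bounds {σ : ℝ} (hσ : |σ| = 1) {v : ℝ} (hv : 0 ≤ v) :
    2 ≤ ‖(v : ℂ) - 2 * σ * Complex.I‖ ∧ ‖(v : ℂ) - 2 * σ * Complex.I‖ ≤ 2 * (1 + v) := by
  constructor
  · have := Complex.abs_im_le_norm ((v : ℂ) - 2 * σ * Complex.I)
    simpa [abs_mul, hσ] using this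
  · refine (norm_sub_le _ _).trans ?_
    simp [abs_of_nonneg hv, hσ]; linarith

theorem measurable_hankelKernel {σ : ℝ} (hσ : σ ≠ 0) (μ : ℝ) : Measurable (hankelKernel σ μ) := by
  unfold hankelKernel
  refine (Complex.measurable_ofReal.comp (measurable_id.pow_const μ)).mul ?_
  have : Continuous fun v : ℝ => ((v : ℂ) - 2 * σ * Complex.I) ^ (μ : ℂ) := by
    refine continuous_iff_continuousAt.2 fun v => ?_
    exact ContinuousAt.cpow (by fun_prop) continuousAt_const (sub_two_I_mem_slitPlane hσ v)
  exact this.measurable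

theorem norm_sub_two_I_cpow_le {σ : ℝ} (hσ : |σ| = 1) {p : ℝ} {m : ℕ} (hm : p ≤ m) {v : ℝ}
    (hv : 0 ≤ v) : ‖((v : ℂ) - 2 * σ * Complex.I) ^ (p : ℂ)‖ ≤ 2 ^ m * (1 + v) ^ m := by
  obtain ⟨h1, h2⟩ := norm_sub_two_I_bounds hσ hv
  rw [Complex.norm_cpow_real, ← mul_pow, ← Real.rpow_natCast]
  calc _ ≤ ‖(v : ℂ) - 2 * σ * Complex.I‖ ^ (m : ℝ) :=
        Real.rpow_le_rpow_of_exponent_le (by linarith) hm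
    _ ≤ _ := by gcongr

/-- A bound for `hankelKernel` against a slowly growing exponential. -/
theorem exists_norm_hankelKernel_le (μ : ℝ) {δ : ℝ} (hδ : 0 < δ) :
    ∃ C : ℝ, 0 < C ∧ ∀ σ : ℝ, |σ| = 1 → ∀ v : ℝ, 0 < v →
      ‖hankelKernel σ μ v‖ ≤ C * (v ^ μ * Real.exp (δ * v)) := by
  obtain ⟨C, hC, h⟩ := exists_one_add_pow_le_exp ⌈μ⌉₊ hδ
  refine ⟨2 ^ ⌈μ⌉₊ * C, by positivity, fun σ hσ v hv => ?_⟩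
  unfold hankelKernel
  rw [norm_mul, Complex.norm_real, Real.norm_of_nonneg (by positivity)]
  have h1 := norm_sub_two_I_cpow_le hσ (Nat.le_ceil μ) hv.le
  calc _ ≤ v ^ μ * (2 ^ ⌈μ⌉₊ * (C * Real.exp (δ * v))) := by
        gcongr; exact h1.trans (by gcongr; exact h v hv.le)
    _ = _ := by ring

theorem norm_exp_neg_two_pi (z : ℂ) (v : ℝ) :
    ‖Complex.exp (-(2 * Real.pi * z * v))‖ = Real.exp (-(2 * Real.pi * z.re * v)) := by
  rw [Complex.norm_exp]; simp

/-- Integrands bounded by `v^p e^{δ v}` times the Laplace kernel. -/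
theorem norm_laplace_le {p s s₀ K : ℝ} {f : ℝ → ℂ} (hp : -1 < p) (hs₀ : 0 < s₀) (hs : s₀ ≤ s)
    (hf : ∀ v : ℝ, 0 < v → ‖f v‖ ≤ K * (v ^ p * Real.exp (Real.pi * s₀ * v))) (hK : 0 ≤ K)
    {z : ℂ} (hz : s ≤ z.re) :
    ‖∫ v in Set.Ioi (0 : ℝ), f v * Complex.exp (-(2 * Real.pi * z * v))‖ ≤
      K * Real.pi ^ (-p - 1) * Real.Gamma (p + 1) * s ^ (-p - 1) := by
  have hspos : 0 < s := by linarith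
  have hps : 0 < Real.pi * s := by positivity
  refine (norm_integral_le_of_norm_le ((integrableOn_rpow_mul_exp_neg hp hps).const_mul K)
    ?_).trans (le_of_eq ?_)
  -- Since $s_0\le s\le\mathrm{Re}\,z$, half of $e^{-2\pi\mathrm{Re}(z)v}$ absorbs the growth
  -- $e^{\pi s_0v}$ and the other half leaves $e^{-\pi sv}$.
  · filter_upwards [ae_restrict_mem measurableSet_Ioi] with v hv
    have hv : 0 < v := hv
    rw [norm_mul, norm_exp_neg_two_pi]
    calc _ ≤ K * (v ^ p * Real.exp (Real.pi * s₀ * v)) * Real.exp (-(2 * Real.pi * z.re * v)) := by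
          gcongr; exact hf v hv
      _ = K * (v ^ p * Real.exp (Real.pi * s₀ * v + -(2 * Real.pi * z.re * v))) := by
          rw [Real.exp_add]; ring
      _ ≤ _ := by
          gcongr
          have : Real.pi * s₀ * v ≤ Real.pi * s * v := by gcongr
          have : Real.pi * s * v ≤ Real.pi * z.re * v := by gcongr
          linarith
  · rw [integral_const_mul, integral_rpow_mul_exp_neg hp hps,
      Real.mul_rpow Real.pi_pos.le hspos.le]
    ring

theorem exists_norm_hankelAmp_le {μ s₀ : ℝ} (hμ : -1 < μ) (hs₀ : 0 < s₀) :
    ∃ C : ℝ, 0 < C ∧ ∀ σ : ℝ, |σ| = 1 → ∀ (s : ℝ) (z : ℂ), s₀ ≤ s → s ≤ z.re →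
      ‖hankelAmp σ μ z‖ ≤ C * s ^ (-μ - 1) := by
  obtain ⟨C, hC, h⟩ := exists_norm_hankelKernel_le μ (show 0 < Real.pi * s₀ by positivity)
  have hG := Real.Gamma_pos_of_pos (show 0 < μ + 1 by linarith)
  refine ⟨C * Real.pi ^ (-μ - 1) * Real.Gamma (μ + 1), by positivity, fun σ hσ s z hs hz => ?_⟩
  unfold hankelAmp
  rw [norm_mul, norm_mul, norm_neg, Complex.norm_real, Complex.norm_I, Real.norm_eq_abs, hσ,
    one_mul, one_mul]
  exact norm_laplace_le hμ hs₀ hs (h σ hσ) hC.le hz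

/-- Differentiation under the integral on the half plane $\mathrm{Re}\,w>\mathrm{Re}(z)/2$, where
one integrable majorant serves for all $w$; the factor $v$ produced by the derivative is harmless.
-/
theorem differentiableAt_hankelAmp {σ μ : ℝ} (hσ : |σ| = 1) (hμ : -1 < μ) {z : ℂ} (hz : 0 < z.re) :
    DifferentiableAt ℂ (hankelAmp σ μ) z := by
  have hσ0 : σ ≠ 0 := by rintro rfl; simp at hσ
  set s := z.re / 2 with hs
  have hspos : 0 < s := by positivity
  obtain ⟨C, hC, h⟩ := exists_norm_hankelKernel_le μ (show 0 < Real.pi * s by positivity)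
  have hnhds : {w : ℂ | s < w.re} ∈ 𝓝 z :=
    (isOpen_lt continuous_const Complex.continuous_re).mem_nhds (by simp only [Set.mem_ofPred_eq]; linarith)
  have hps : 0 < Real.pi * s := by positivity
  have hmeas : ∀ w : ℂ, Measurable fun v : ℝ =>
      hankelKernel σ μ v * Complex.exp (-(2 * Real.pi * w * v)) := fun w =>
    (measurable_hankelKernel hσ0 μ).mul (by fun_prop)
  have hbase : ∀ w : ℂ, s < w.re → ∀ v : ℝ, 0 < v →
      ‖hankelKernel σ μ v * Complex.exp (-(2 * Real.pi * w * v))‖ ≤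
        C * (v ^ μ * Real.exp (-(Real.pi * s * v))) := by
    intro w hw v hv
    rw [norm_mul, norm_exp_neg_two_pi]
    calc _ ≤ C * (v ^ μ * Real.exp (Real.pi * s * v)) * Real.exp (-(2 * Real.pi * w.re * v)) := by
          gcongr; exact h σ hσ v hv
      _ = C * (v ^ μ * Real.exp (Real.pi * s * v + -(2 * Real.pi * w.re * v))) := by
          rw [Real.exp_add]; ring
      _ ≤ _ := by
          gcongr
          have : Real.pi * s * v ≤ Real.pi * w.re * v := by gcongr
          linarith
  have key := hasDerivAt_integral_of_dominated_loc_of_deriv_le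
    (μ := volume.restrict (Set.Ioi (0 : ℝ)))
    (F := fun (w : ℂ) (v : ℝ) => hankelKernel σ μ v * Complex.exp (-(2 * Real.pi * w * v)))
    (F' := fun (w : ℂ) (v : ℝ) => -(2 * Real.pi * v) *
      (hankelKernel σ μ v * Complex.exp (-(2 * Real.pi * w * v))))
    (x₀ := z) (bound := fun v => 2 * Real.pi * C * (v ^ (μ + 1) * Real.exp (-(Real.pi * s * v))))
    hnhds (Eventually.of_forall fun w => (hmeas w).aestronglyMeasurable) ?_ ?_ ?_
    ((integrableOn_rpow_mul_exp_neg (by linarith) hps).const_mul _) ?_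
  · exact (key.2.differentiableAt).const_mul _
  · refine Integrable.mono' ((integrableOn_rpow_mul_exp_neg hμ hps).const_mul C)
      (hmeas z).aestronglyMeasurable ?_
    filter_upwards [ae_restrict_mem measurableSet_Ioi] with v hv
    exact hbase z (by linarith) v hv
  · exact ((by fun_prop : Measurable fun v : ℝ => -(2 * (Real.pi : ℂ) * v)).mul
      (hmeas z)).aestronglyMeasurable
  · filter_upwards [ae_restrict_mem measurableSet_Ioi] with v hv w hw
    have hv : 0 < v := hv
    have h1 := hbase w hw v hv
    rw [norm_mul, Real.rpow_add_one hv.ne']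
    have h2 : ‖-(2 * (Real.pi : ℂ) * v)‖ = 2 * Real.pi * v := by
      rw [norm_neg]; simp [abs_of_pos Real.pi_pos, abs_of_pos hv]
    rw [h2]
    calc _ ≤ 2 * Real.pi * v * (C * (v ^ μ * Real.exp (-(Real.pi * s * v)))) := by gcongr
      _ = _ := by ring
  · filter_upwards with v w hw
    have : HasDerivAt (fun w : ℂ => -(2 * (Real.pi : ℂ) * w * v)) (-(2 * Real.pi * v)) w := by
      have := (((hasDerivAt_id' w).const_mul (2 * (Real.pi : ℂ))).mul_const (v : ℂ)).fun_neg
      simpa using this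
    convert! (this.cexp.const_mul (hankelKernel σ μ v)) using 1
    ring

/-- The leading coefficient of `hankelAmp` at infinity. -/
def hankelLead (σ μ : ℝ) : ℂ :=
  ((2 ^ μ * Real.Gamma (μ + 1) * (2 * Real.pi) ^ (-μ - 1) : ℝ) : ℂ) *
    Complex.exp (-(σ * (Real.pi * (μ + 1) / 2 : ℝ)) * Complex.I)

/-- The principal logarithm of $-2\sigma i$ is $\log2-\sigma\pi i/2$, and $-\sigma i=e^{-\sigma\pi
i/2}$ turns $\mu$ into $\mu+1$ in the phase. -/
theorem neg_two_I_cpow {σ : ℝ} (hσ : σ = 1 ∨ σ = -1) (μ : ℝ) :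
    -(σ : ℂ) * Complex.I * (-2 * σ * Complex.I) ^ (μ : ℂ) =
      ((2 ^ μ : ℝ) : ℂ) * Complex.exp (-(σ * (Real.pi * (μ + 1) / 2 : ℝ)) * Complex.I) := by
  have h2 : ((2 ^ μ : ℝ) : ℂ) = Complex.exp (Real.log 2 * μ) := by
    rw [Real.rpow_def_of_pos two_pos]; push_cast; rfl
  have key : ∀ τ : ℝ, τ ≠ 0 → (τ : ℂ) * Complex.I ≠ 0 := fun τ hτ => by simpa using hτ
  have hlog : Complex.log (-2 * σ * Complex.I) = Real.log 2 - σ * (Real.pi / 2) * Complex.I := by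
    rcases hσ with rfl | rfl
    · have : (-2 * ((1 : ℝ) : ℂ) * Complex.I) = (2 : ℝ) * (-Complex.I) := by push_cast; ring
      rw [this, Complex.log_ofReal_mul two_pos (by simp), Complex.log_neg_I]
      push_cast; ring
    · have : (-2 * ((-1 : ℝ) : ℂ) * Complex.I) = (2 : ℝ) * Complex.I := by push_cast; ring
      rw [this, Complex.log_ofReal_mul two_pos (by simp), Complex.log_I]
      push_cast; ring
  have hI : -(σ : ℂ) * Complex.I = Complex.exp (-(σ * (Real.pi / 2)) * Complex.I) := by
    rcases hσ with rfl | rfl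
    · have := Complex.exp_neg_pi_div_two_mul_I
      rw [show (-((1 : ℝ) * ((Real.pi : ℂ) / 2)) * Complex.I) = -Real.pi / 2 * Complex.I by push_cast; ring, this]
      simp
    · rw [show (-((-1 : ℝ) * ((Real.pi : ℂ) / 2)) * Complex.I) = Real.pi / 2 * Complex.I by push_cast; ring, Complex.exp_pi_div_two_mul_I]
      simp
  have hne : (-2 * (σ : ℂ) * Complex.I) ≠ 0 := by
    rcases hσ with rfl | rfl <;> simp
  rw [Complex.cpow_def_of_ne_zero hne, hlog, hI, h2, ← Complex.exp_add, ← Complex.exp_add]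
  congr 1
  push_cast; ring

theorem integral_rpow_mul_cexp_neg {p r : ℝ} (hp : -1 < p) (hr : 0 < r) :
    ∫ v in Set.Ioi (0 : ℝ), ((v ^ p : ℝ) : ℂ) * Complex.exp (-(2 * Real.pi * (r : ℂ) * v)) =
      (((2 * Real.pi * r) ^ (-p - 1) * Real.Gamma (p + 1) : ℝ) : ℂ) := by
  rw [← integral_rpow_mul_exp_neg hp (by positivity), ← integral_complex_ofReal]
  congr 1
  funext v
  push_cast
  rfl

/-- Mean value inequality on $[0,v]$; the segment shifted by $-2\sigma i$ keeps distance at least 2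
from the origin and never meets the branch cut. -/
theorem norm_sub_two_I_cpow_sub_le {σ : ℝ} (hσ : |σ| = 1) {μ : ℝ} {m : ℕ} (hm : μ - 1 ≤ m) {v : ℝ}
    (hv : 0 < v) :
    ‖((v : ℂ) - 2 * σ * Complex.I) ^ (μ : ℂ) - (-2 * σ * Complex.I) ^ (μ : ℂ)‖ ≤
      |μ| * 2 ^ m * (1 + v) ^ m * v := by
  have hσ0 : σ ≠ 0 := by rintro rfl; simp at hσ
  have hderiv : ∀ x ∈ Set.Icc 0 v, HasDerivWithinAt
      (fun x : ℝ => ((x : ℂ) - 2 * σ * Complex.I) ^ (μ : ℂ))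
      ((μ : ℂ) * ((x : ℂ) - 2 * σ * Complex.I) ^ ((μ : ℂ) - 1)) (Set.Icc 0 v) x := by
    intro x _
    have h1 : HasDerivAt (fun x : ℂ => x - 2 * σ * Complex.I) 1 (x : ℂ) :=
      (hasDerivAt_id' _).sub_const _
    have h2 := (h1.cpow_const (c := (μ : ℂ)) (sub_two_I_mem_slitPlane hσ0 x)).comp_ofReal
    rw [mul_one] at h2
    exact h2.hasDerivWithinAt
  have := Convex.norm_image_sub_le_of_norm_hasDerivWithin_le (C := |μ| * 2 ^ m * (1 + v) ^ m) hderiv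
    ?_ (convex_Icc 0 v) (Set.left_mem_Icc.2 hv.le) (Set.right_mem_Icc.2 hv.le)
  · simpa [abs_of_pos hv] using this
  · intro x hx
    rw [norm_mul, Complex.norm_real, Real.norm_eq_abs, mul_assoc |μ|]
    have h1 := norm_sub_two_I_cpow_le hσ hm hx.1
    push_cast at h1
    gcongr
    refine h1.trans ?_
    have := hx.2
    have := hx.1
    gcongr

/-- First-order Watson lemma: freezing $(v-2\sigma i)^\mu$ at $v=0$ gives the leading term exactly,
and the difference is $O(v)$ up to slow exponential growth, which gains one power of $r$ in the
Laplace integral. -/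
theorem exists_hankelAmp_sub_lead_le {μ s₀ : ℝ} (hμ : -1 < μ) (hs₀ : 0 < s₀) :
    ∃ C : ℝ, 0 < C ∧ ∀ σ : ℝ, (σ = 1 ∨ σ = -1) → ∀ r : ℝ, s₀ ≤ r →
      ‖hankelAmp σ μ r - hankelLead σ μ * ((r ^ (-μ - 1) : ℝ) : ℂ)‖ ≤ C * r ^ (-μ - 2) := by
  obtain ⟨C, hC, h⟩ := exists_one_add_pow_le_exp ⌈μ - 1⌉₊ (show 0 < Real.pi * s₀ by positivity)
  have hG := Real.Gamma_pos_of_pos (show 0 < μ + 1 + 1 by linarith)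
  obtain ⟨C1, hC1, h1⟩ := exists_norm_hankelKernel_le μ (show 0 < Real.pi * s₀ by positivity)
  set K := |μ| * 2 ^ ⌈μ - 1⌉₊ * C with hK
  refine ⟨(K * Real.pi ^ (-(μ + 1) - 1) * Real.Gamma (μ + 1 + 1)) + 1, by positivity,
    fun σ hσ' r hr => ?_⟩
  have hσ : |σ| = 1 := by rcases hσ' with rfl | rfl <;> simp
  have hσ0 : σ ≠ 0 := by rintro rfl; simp at hσ
  have hrpos : 0 < r := by linarith
  set f : ℝ → ℂ := fun v => ((v ^ μ : ℝ) : ℂ) *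
    (((v : ℂ) - 2 * σ * Complex.I) ^ (μ : ℂ) - (-2 * σ * Complex.I) ^ (μ : ℂ)) with hf
  have hfb : ∀ v : ℝ, 0 < v → ‖f v‖ ≤ K * (v ^ (μ + 1) * Real.exp (Real.pi * s₀ * v)) := by
    intro v hv
    rw [hf]
    simp only
    rw [norm_mul, Complex.norm_real, Real.norm_of_nonneg (by positivity), Real.rpow_add_one hv.ne']
    calc _ ≤ v ^ μ * (|μ| * 2 ^ ⌈μ - 1⌉₊ * (1 + v) ^ ⌈μ - 1⌉₊ * v) := by
          gcongr; exact norm_sub_two_I_cpow_sub_le hσ (Nat.le_ceil _) hv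
      _ ≤ v ^ μ * (|μ| * 2 ^ ⌈μ - 1⌉₊ * (C * Real.exp (Real.pi * s₀ * v)) * v) := by
          gcongr; exact h v hv.le
      _ = _ := by rw [hK]; ring
  have hI1 : IntegrableOn (fun v : ℝ => hankelKernel σ μ v *
      Complex.exp (-(2 * Real.pi * (r : ℂ) * v))) (Set.Ioi 0) := by
    refine Integrable.mono' ((integrableOn_rpow_mul_exp_neg hμ
      (show 0 < Real.pi * r by positivity)).const_mul C1) ?_ ?_
    · exact ((measurable_hankelKernel hσ0 μ).mul (by fun_prop)).aestronglyMeasurable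
    · filter_upwards [ae_restrict_mem measurableSet_Ioi] with v hv
      have hv : 0 < v := hv
      rw [norm_mul, norm_exp_neg_two_pi, Complex.ofReal_re]
      calc _ ≤ C1 * (v ^ μ * Real.exp (Real.pi * s₀ * v)) * Real.exp (-(2 * Real.pi * r * v)) := by
            gcongr; exact h1 σ hσ v hv
        _ = C1 * (v ^ μ * Real.exp (Real.pi * s₀ * v + -(2 * Real.pi * r * v))) := by
            rw [Real.exp_add]; ring
        _ ≤ _ := by
            gcongr
            have : Real.pi * s₀ * v ≤ Real.pi * r * v := by gcongr
            linarith
  have hI2 : IntegrableOn (fun v : ℝ => ((v ^ μ : ℝ) : ℂ) *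
      Complex.exp (-(2 * Real.pi * (r : ℂ) * v))) (Set.Ioi 0) := by
    have := (integrableOn_rpow_mul_exp_neg hμ (show 0 < 2 * Real.pi * r by positivity)).ofReal (𝕜 := ℂ)
    refine this.congr (Eventually.of_forall fun v => ?_)
    simp
  have hsplit : hankelAmp σ μ r - hankelLead σ μ * ((r ^ (-μ - 1) : ℝ) : ℂ) =
      -σ * Complex.I * ∫ v in Set.Ioi (0 : ℝ), f v * Complex.exp (-(2 * Real.pi * (r : ℂ) * v)) := by
    have e1 : ∀ v : ℝ, f v * Complex.exp (-(2 * Real.pi * (r : ℂ) * v)) =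
        hankelKernel σ μ v * Complex.exp (-(2 * Real.pi * (r : ℂ) * v)) -
        (-2 * σ * Complex.I) ^ (μ : ℂ) *
          (((v ^ μ : ℝ) : ℂ) * Complex.exp (-(2 * Real.pi * (r : ℂ) * v))) := by
      intro v; simp only [hf, hankelKernel]; ring
    simp_rw [e1]
    rw [integral_sub hI1 (hI2.const_mul _), integral_const_mul, integral_rpow_mul_cexp_neg hμ hrpos,
      mul_sub, ← mul_assoc (-(σ : ℂ) * Complex.I), neg_two_I_cpow hσ', hankelAmp, hankelLead,
      Real.mul_rpow (x := 2 * Real.pi) (by positivity) hrpos.le]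
    push_cast; ring
  rw [hsplit, norm_mul, norm_mul, norm_neg, Complex.norm_real, Complex.norm_I, Real.norm_eq_abs, hσ,
    one_mul, one_mul]
  refine (norm_laplace_le (p := μ + 1) (by linarith) hs₀ hr hfb (by positivity)
    (z := (r : ℂ)) (by simp)).trans ?_
  rw [show -(μ + 1) - 1 = -μ - 2 by ring]
  gcongr
  linarith

/-! ### Contour shift: the Bessel integral splits into two Hankel parts -/

/-- The integrand `(1 - z²)^μ e^{2π i r z}` of `besselInt` as a function of a complex variable. -/
def besselIntegrand (μ r : ℝ) (z : ℂ) : ℂ :=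
  (1 - z ^ 2) ^ (μ : ℂ) * Complex.exp (2 * Real.pi * Complex.I * (r * z))

theorem one_sub_sq_mem_slitPlane {z : ℂ} (hz : |z.re| < 1) : 1 - z ^ 2 ∈ Complex.slitPlane := by
  left
  have h1 : z.re ^ 2 < 1 := (sq_lt_one_iff_abs_lt_one _).2 hz
  simp only [pow_two, Complex.sub_re, Complex.one_re, Complex.mul_re]
  nlinarith [sq_nonneg z.im]

theorem differentiableAt_besselIntegrand (μ r : ℝ) {z : ℂ} (hz : |z.re| < 1) :
    DifferentiableAt ℂ (besselIntegrand μ r) z := by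
  unfold besselIntegrand
  refine DifferentiableAt.mul ?_ (by fun_prop)
  exact DifferentiableAt.cpow_const (by fun_prop) (one_sub_sq_mem_slitPlane hz)

theorem norm_besselIntegrand (μ r : ℝ) (z : ℂ) :
    ‖besselIntegrand μ r z‖ = ‖1 - z ^ 2‖ ^ μ * Real.exp (-(2 * Real.pi * r * z.im)) := by
  unfold besselIntegrand
  rw [norm_mul, Complex.norm_cpow_real, Complex.norm_exp]
  congr 2
  simp
  ring

theorem norm_one_sub_sq_le {z : ℂ} (hz : |z.re| ≤ 1) (hy : 0 ≤ z.im) :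
    ‖1 - z ^ 2‖ ≤ (2 * (1 + z.im)) ^ 2 := by
  have h1 : ‖z‖ ≤ 1 + z.im := by
    refine (Complex.norm_le_abs_re_add_abs_im z).trans ?_
    rw [abs_of_nonneg hy]; linarith
  calc _ ≤ ‖(1 : ℂ)‖ + ‖z ^ 2‖ := norm_sub_le _ _
    _ = 1 + ‖z‖ ^ 2 := by simp
    _ ≤ 1 + (1 + z.im) ^ 2 := by gcongr
    _ ≤ _ := by nlinarith

/-- A lower bound that survives as $\mathrm{Re}\,z\to\pm1$; for $\mu<0$ it is what dominates
$|1-z^2|^\mu$ by $(\mathrm{Im}\,z)^\mu$. -/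
theorem im_le_norm_one_sub_sq {z : ℂ} (hz : 1 / 2 ≤ |z.re|) (hy : 0 ≤ z.im) :
    z.im ≤ ‖1 - z ^ 2‖ := by
  have h1 := Complex.abs_im_le_norm (1 - z ^ 2)
  have h2 : |(1 - z ^ 2).im| = 2 * |z.re| * z.im := by
    have h3 : (1 - z ^ 2).im = -(2 * z.re * z.im) := by simp [pow_two]; ring
    rw [h3, abs_neg, abs_mul, abs_mul, abs_of_nonneg hy]; simp
  rw [h2] at h1
  nlinarith

theorem one_le_norm_one_sub_sq {z : ℂ} (hz : |z.re| ≤ 1) (hy : 1 ≤ z.im) :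
    1 ≤ ‖1 - z ^ 2‖ := by
  have h1 := Complex.abs_re_le_norm (1 - z ^ 2)
  refine le_trans ?_ ((le_abs_self _).trans h1)
  have : z.re ^ 2 ≤ 1 := (sq_le_one_iff_abs_le_one _).2 hz
  simp only [pow_two, Complex.sub_re, Complex.one_re, Complex.mul_re]
  nlinarith

/-- Treats both signs of the exponent at once: the upper bound $B$ serves for $\mu\ge0$, the lower
bound $y$ for $\mu<0$. -/
theorem rpow_le_rpow_add_pow {μ x y : ℝ} {m : ℕ} (hm : |μ| ≤ m) {B : ℝ} (hy : 0 < y) (hyx : y ≤ x)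
    (hxB : x ≤ B) (hB : 1 ≤ B) : x ^ μ ≤ y ^ μ + B ^ m := by
  rcases le_or_gt 0 μ with h | h
  · have h1 : x ^ μ ≤ B ^ μ := Real.rpow_le_rpow (by linarith) hxB h
    have h2 : B ^ μ ≤ B ^ (m : ℝ) := Real.rpow_le_rpow_of_exponent_le hB ((le_abs_self _).trans hm)
    rw [Real.rpow_natCast] at h2
    have : 0 ≤ y ^ μ := by positivity
    linarith
  · have h1 : x ^ μ ≤ y ^ μ := Real.rpow_le_rpow_of_nonpos hy hyx h.le
    have : 0 ≤ B ^ m := by positivity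
    linarith

/-- A common integrable majorant of `besselIntegrand` on vertical lines. -/
theorem exists_besselIntegrand_bound (μ : ℝ) {r : ℝ} (hr : 0 < r) :
    ∃ C : ℝ, 0 < C ∧ (∀ z : ℂ, |z.re| ≤ 1 → 1 / 2 ≤ |z.re| → 0 < z.im →
      ‖besselIntegrand μ r z‖ ≤ C * ((z.im ^ μ + 1) * Real.exp (-(Real.pi * r * z.im)))) ∧
      (∀ z : ℂ, |z.re| ≤ 1 → 1 ≤ z.im →
        ‖besselIntegrand μ r z‖ ≤ C * Real.exp (-(Real.pi * r * z.im))) := by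
  obtain ⟨C, hC, h⟩ := exists_one_add_pow_le_exp (2 * ⌈|μ|⌉₊) (show 0 < Real.pi * r by positivity)
  set m := ⌈|μ|⌉₊
  have hm : |μ| ≤ m := Nat.le_ceil _
  have hpow : ∀ y : ℝ, 0 ≤ y → ((2 * (1 + y)) ^ 2) ^ m ≤ 4 ^ m * C * Real.exp (Real.pi * r * y) := by
    intro y hy
    have : ((2 * (1 + y)) ^ 2) ^ m = 4 ^ m * (1 + y) ^ (2 * m) := by
      rw [pow_mul (1 + y), ← mul_pow]; congr 1; ring
    rw [this, mul_assoc]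
    gcongr
    exact h y hy
  have hexp : ∀ y : ℝ, Real.exp (Real.pi * r * y) * Real.exp (-(2 * Real.pi * r * y)) =
      Real.exp (-(Real.pi * r * y)) := by
    intro y; rw [← Real.exp_add]; congr 1; ring
  refine ⟨4 ^ m * C + 1, by positivity, fun z hz1 hz2 hz3 => ?_, fun z hz1 hz2 => ?_⟩
  · rw [norm_besselIntegrand]
    have h1 := rpow_le_rpow_add_pow hm hz3 (im_le_norm_one_sub_sq hz2 hz3.le)
      (norm_one_sub_sq_le hz1 hz3.le) (by nlinarith)
    have h3 : Real.exp (-(2 * Real.pi * r * z.im)) ≤ Real.exp (-(Real.pi * r * z.im)) := by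
      refine Real.exp_le_exp.2 ?_
      have : 0 ≤ Real.pi * r * z.im := by positivity
      linarith
    have h4 : 0 ≤ z.im ^ μ := by positivity
    calc _ ≤ (z.im ^ μ + 4 ^ m * C * Real.exp (Real.pi * r * z.im)) *
          Real.exp (-(2 * Real.pi * r * z.im)) := by
          gcongr; exact h1.trans (by gcongr; exact hpow _ hz3.le)
      _ = z.im ^ μ * Real.exp (-(2 * Real.pi * r * z.im)) +
          4 ^ m * C * Real.exp (-(Real.pi * r * z.im)) := by rw [← hexp]; ring
      _ ≤ z.im ^ μ * Real.exp (-(Real.pi * r * z.im)) +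
          4 ^ m * C * Real.exp (-(Real.pi * r * z.im)) := by gcongr
      _ ≤ _ := by
        have hE := Real.exp_pos (-(Real.pi * r * z.im))
        have : 0 ≤ 4 ^ m * C * z.im ^ μ := by positivity
        nlinarith
  · rw [norm_besselIntegrand]
    have h1 : ‖1 - z ^ 2‖ ^ μ ≤ ((2 * (1 + z.im)) ^ 2) ^ m := by
      have hge := one_le_norm_one_sub_sq hz1 hz2
      calc _ ≤ ‖1 - z ^ 2‖ ^ (m : ℝ) :=
            Real.rpow_le_rpow_of_exponent_le hge ((le_abs_self _).trans hm)
        _ = ‖1 - z ^ 2‖ ^ m := Real.rpow_natCast _ _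
        _ ≤ _ := by gcongr; exact norm_one_sub_sq_le hz1 (by linarith)
    calc _ ≤ 4 ^ m * C * Real.exp (Real.pi * r * z.im) * Real.exp (-(2 * Real.pi * r * z.im)) := by
          gcongr; exact h1.trans (hpow _ (by linarith))
      _ = 4 ^ m * C * Real.exp (-(Real.pi * r * z.im)) := by rw [mul_assoc, hexp]
      _ ≤ _ := by gcongr; linarith

theorem integrableOn_besselIntegrand_bound {μ r : ℝ} (hμ : -1 < μ) (hr : 0 < r) (C : ℝ) :
    IntegrableOn (fun y : ℝ => C * ((y ^ μ + 1) * Real.exp (-(Real.pi * r * y)))) (Set.Ioi 0) := by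
  have hpr : 0 < Real.pi * r := by positivity
  have h1 := integrableOn_rpow_mul_exp_neg hμ hpr
  have h2 := integrableOn_rpow_mul_exp_neg (p := 0) (by norm_num) hpr
  refine ((h1.add h2).const_mul C).congr (Eventually.of_forall fun y => ?_)
  simp only [Pi.add_apply, Real.rpow_zero]; ring

theorem integrableOn_besselIntegrand_vertical {μ r : ℝ} (hμ : -1 < μ) (hr : 0 < r) {x : ℝ}
    (hx : |x| < 1) (hx2 : 1 / 2 ≤ |x|) :
    IntegrableOn (fun y : ℝ => besselIntegrand μ r (x + y * Complex.I)) (Set.Ioi 0) := by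
  obtain ⟨C, hC, h, -⟩ := exists_besselIntegrand_bound μ hr
  refine Integrable.mono' (integrableOn_besselIntegrand_bound hμ hr C) ?_ ?_
  · refine Continuous.aestronglyMeasurable (continuous_iff_continuousAt.2 fun y => ?_)
    have : ContinuousAt (besselIntegrand μ r) (x + y * Complex.I) :=
      (differentiableAt_besselIntegrand μ r (by simpa using hx)).continuousAt
    exact ContinuousAt.comp (g := besselIntegrand μ r) (f := fun y : ℝ => (x : ℂ) + y * Complex.I)
      this (by fun_prop)
  · filter_upwards [ae_restrict_mem measurableSet_Ioi] with y hy
    have := h (x + y * Complex.I) (by simpa using hx.le) (by simpa using hx2) (by simpa using hy)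
    simpa using this

/-- Cauchy's theorem on the rectangle over $[-b,b]$ of height $T\to\infty$; the top side is
$O(e^{-\pi rT})$. Taking $b<1$ keeps the closed rectangle away from the branch points $\pm1$. -/
theorem integral_besselIntegrand_eq_vertical {μ r : ℝ} (hμ : -1 < μ) (hr : 0 < r) {b : ℝ}
    (hb : b < 1) (hb2 : 1 / 2 ≤ b) :
    ∫ x in (-b)..b, besselIntegrand μ r x =
      -Complex.I * (∫ y in Set.Ioi (0 : ℝ), besselIntegrand μ r (b + y * Complex.I)) +
      Complex.I * ∫ y in Set.Ioi (0 : ℝ), besselIntegrand μ r ((-b : ℝ) + y * Complex.I) := by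
  have hab : |b| < 1 := by rw [abs_of_pos (by linarith)]; exact hb
  have hrect : ∀ T : ℝ, ∫ x in (-b)..b, besselIntegrand μ r x =
      (∫ x in (-b)..b, besselIntegrand μ r (x + T * Complex.I)) +
      (-Complex.I * (∫ y in (0 : ℝ)..T, besselIntegrand μ r (b + y * Complex.I)) +
      Complex.I * ∫ y in (0 : ℝ)..T, besselIntegrand μ r ((-b : ℝ) + y * Complex.I)) := by
    intro T
    have := Complex.integral_boundary_rect_eq_zero_of_differentiableOn (besselIntegrand μ r)
      (((-b : ℝ) : ℂ)) ((b : ℂ) + T * Complex.I) ?_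
    · simp only [Complex.ofReal_re, Complex.ofReal_im, Complex.add_re, Complex.mul_re,
        Complex.I_re, Complex.I_im, Complex.add_im, Complex.mul_im, mul_zero, mul_one,
        zero_mul, sub_zero, add_zero, zero_add, Complex.ofReal_zero, smul_eq_mul] at this
      linear_combination this
    · intro z hz
      refine (differentiableAt_besselIntegrand μ r ?_).differentiableWithinAt
      have h1 := hz.1
      simp only [Set.mem_preimage, Complex.ofReal_re, Complex.add_re, Complex.mul_re,
        Complex.I_re, Complex.I_im, mul_zero, mul_one, Complex.ofReal_im, sub_zero, add_zero] at h1
      rw [Set.uIcc_of_le (by linarith)] at h1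
      exact (abs_le.2 h1).trans_lt hb
  obtain ⟨C, hC, -, htop⟩ := exists_besselIntegrand_bound μ hr
  have hT : Tendsto (fun T : ℝ => ∫ x in (-b)..b, besselIntegrand μ r (x + T * Complex.I)) atTop
      (𝓝 0) := by
    refine squeeze_zero_norm' (a := fun T => C * Real.exp (-(Real.pi * r * T)) * |b - -b|) ?_ ?_
    · filter_upwards [eventually_ge_atTop 1] with T hT
      refine intervalIntegral.norm_integral_le_of_norm_le_const fun x hx => ?_
      rw [Set.uIoc_of_le (by linarith)] at hx
      have := htop (x + T * Complex.I) (by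
        simpa using (abs_le.2 ⟨by linarith [hx.1], by linarith [hx.2]⟩ : |x| ≤ 1)) (by simpa using hT)
      simpa using this
    · have h1 : Tendsto (fun T : ℝ => Real.pi * r * T) atTop atTop :=
        tendsto_id.const_mul_atTop (by positivity)
      have := ((Real.tendsto_exp_neg_atTop_nhds_zero.comp h1).const_mul C).mul_const |b - -b|
      simpa using this
  have hlim := hT.add ((((intervalIntegral_tendsto_integral_Ioi 0
    (integrableOn_besselIntegrand_vertical hμ hr hab (hb2.trans (le_abs_self _)))
    tendsto_id).const_mul (-Complex.I))).add ((intervalIntegral_tendsto_integral_Ioi 0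
    (integrableOn_besselIntegrand_vertical hμ hr (x := -b) (by rwa [abs_neg])
      (by rw [abs_neg]; exact hb2.trans (le_abs_self _))) tendsto_id).const_mul Complex.I))
  rw [zero_add] at hlim
  exact tendsto_nhds_unique (tendsto_const_nhds.congr fun T => hrect T) hlim

/-- On the line $\mathrm{Re}\,z=\sigma=\pm1$ one has $1-z^2=y(y-2\sigma i)$; because $y>0$ the
complex power splits along this product. -/
theorem besselIntegrand_vertical_limit {μ r σ : ℝ} {y : ℝ} (hy : 0 < y) (hσ : σ = 1 ∨ σ = -1) :
    besselIntegrand μ r (σ + y * Complex.I) =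
      ephase (σ * r) * (hankelKernel σ μ y * Complex.exp (-(2 * Real.pi * (r : ℂ) * y))) := by
  have h1 : (1 : ℂ) - (σ + y * Complex.I) ^ 2 = y * (y - 2 * σ * Complex.I) := by
    have h2 : (σ : ℂ) ^ 2 = 1 := by rcases hσ with rfl | rfl <;> simp
    linear_combination (-1 : ℂ) * h2 - (y : ℂ) ^ 2 * Complex.I_sq
  have hσ0 : σ ≠ 0 := by rcases hσ with rfl | rfl <;> simp
  have hne := Complex.slitPlane_ne_zero (sub_two_I_mem_slitPlane hσ0 y)
  unfold besselIntegrand hankelKernel ephase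
  rw [h1, Complex.cpow_def_of_ne_zero (mul_ne_zero (by exact_mod_cast hy.ne') hne),
    Complex.log_ofReal_mul hy hne, add_mul, Complex.exp_add, ← Complex.cpow_def_of_ne_zero hne,
    Real.rpow_def_of_pos hy]
  have h3 : Complex.exp (2 * Real.pi * Complex.I * (r * (σ + y * Complex.I))) =
      Complex.exp (2 * Real.pi * Complex.I * ((σ * r : ℝ) : ℂ)) * Complex.exp (-(2 * Real.pi * (r : ℂ) * y)) := by
    rw [← Complex.exp_add]; congr 1; push_cast
    linear_combination (2 * Real.pi * r * y : ℂ) * Complex.I_sq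
  rw [h3]
  push_cast
  ring

theorem tendsto_integral_besselIntegrand_vertical {μ r σ : ℝ} (hμ : -1 < μ) (hr : 0 < r)
    (hσ : σ = 1 ∨ σ = -1) :
    Tendsto (fun b : ℝ => ∫ y in Set.Ioi (0 : ℝ), besselIntegrand μ r ((σ * b : ℝ) + y * Complex.I))
      (𝓝[<] 1) (𝓝 (ephase (σ * r) * ∫ y in Set.Ioi (0 : ℝ),
        hankelKernel σ μ y * Complex.exp (-(2 * Real.pi * (r : ℂ) * y)))) := by
  have hσ1 : |σ| = 1 := by rcases hσ with rfl | rfl <;> simp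
  have hσ0 : σ ≠ 0 := by rcases hσ with rfl | rfl <;> simp
  obtain ⟨C, hC, h, -⟩ := exists_besselIntegrand_bound μ hr
  have hev : ∀ᶠ b in 𝓝[<] (1 : ℝ), 1 / 2 ≤ b ∧ b < 1 :=
    (eventually_mem_nhdsWithin (a := (1 : ℝ)) (s := Set.Iio 1)).mp
      ((eventually_nhdsWithin_of_eventually_nhds (eventually_ge_nhds (by norm_num))).mono
        fun b h1 h2 => ⟨h1, h2⟩)
  have habs : ∀ b : ℝ, 1 / 2 ≤ b → |σ * b| = b := fun b hb => by
    rw [abs_mul, hσ1, one_mul, abs_of_pos (by linarith)]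
  rw [← integral_const_mul]
  refine tendsto_integral_filter_of_dominated_convergence _ ?_ ?_
    (integrableOn_besselIntegrand_bound hμ hr C) ?_
  · filter_upwards [hev] with b hb
    exact (integrableOn_besselIntegrand_vertical hμ hr (by rw [habs b hb.1]; exact hb.2)
      (by rw [habs b hb.1]; exact hb.1)).aestronglyMeasurable
  · filter_upwards [hev] with b hb
    filter_upwards [ae_restrict_mem measurableSet_Ioi] with y hy
    have := h ((σ * b : ℝ) + y * Complex.I)
      (by rw [Complex.add_re, Complex.ofReal_re]; simpa [habs b hb.1, -abs_mul] using hb.2.le)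
      (by rw [Complex.add_re, Complex.ofReal_re]; simpa [habs b hb.1, -abs_mul] using hb.1)
      (by simpa using hy)
    simpa using this
  · filter_upwards [ae_restrict_mem measurableSet_Ioi] with y hy
    have hy : 0 < y := hy
    rw [← besselIntegrand_vertical_limit hy hσ]
    refine Tendsto.mono_left ?_ nhdsWithin_le_nhds
    have hc : ContinuousAt (fun b : ℝ => besselIntegrand μ r ((σ * b : ℝ) + y * Complex.I)) 1 := by
      unfold besselIntegrand
      refine ContinuousAt.mul (ContinuousAt.cpow (by fun_prop) continuousAt_const ?_) (by fun_prop)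
      right
      have h1 : ((1 : ℂ) - ((σ * 1 : ℝ) + y * Complex.I) ^ 2).im = -(2 * σ * y) := by
        simp [pow_two]; ring
      rw [h1]
      simpa using ⟨hσ0, hy.ne'⟩
    have := hc.tendsto
    simpa using this

theorem integrableOn_one_sub_sq_rpow {μ : ℝ} (hμ : -1 < μ) :
    IntegrableOn (fun s : ℝ => (1 - s ^ 2) ^ μ) (Set.Ioo (-1) 1) := by
  have h := (integrable_posRpow_sub_sq (V := ℝ) hμ 1).integrableOn (s := Set.Ioo (-1 : ℝ) 1)
  refine h.congr_fun (fun s hs => ?_) measurableSet_Ioo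
  simp only [Real.norm_eq_abs, sq_abs]
  rw [posRpow_of_pos (by nlinarith [hs.1, hs.2])]

/-- The limit $b\to1^-$ of the contour identity: dominated convergence on the two vertical
half-lines, continuity of the primitive on the real segment. It is the decomposition of a Bessel
function into its two Hankel functions. -/
theorem besselInt_eq_hankelAmp {μ r : ℝ} (hμ : -1 < μ) (hr : 0 < r) :
    besselInt μ r = ephase r * hankelAmp 1 μ r + ephase (-r) * hankelAmp (-1) μ r := by
  have hleft : Tendsto (fun b : ℝ => ∫ x in (-b)..b, besselIntegrand μ r x) (𝓝[<] 1)
      (𝓝 (besselInt μ r)) := by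
    unfold besselInt
    have hI : IntegrableOn (fun s : ℝ => (((1 - s ^ 2) ^ μ : ℝ) : ℂ) * ephase (r * s))
        (Set.Ioo (-1) 1) :=
      (integrableOn_one_sub_sq_rpow hμ).ofReal.mul_bdd (c := 1)
        (continuous_ephase.comp (by fun_prop)).aestronglyMeasurable
        (Eventually.of_forall fun x => (norm_ephase _).le)
    have heq : ∀ s ∈ Set.Ioo (-1 : ℝ) 1, besselIntegrand μ r s =
        (((1 - s ^ 2) ^ μ : ℝ) : ℂ) * ephase (r * s) := by
      intro s hs
      unfold besselIntegrand ephase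
      rw [Complex.ofReal_cpow (by nlinarith [hs.1, hs.2])]
      push_cast; rfl
    have hIi : IntervalIntegrable (fun s : ℝ => besselIntegrand μ r s) volume (-1) 1 := by
      rw [intervalIntegrable_iff_integrableOn_Ioo_of_le (by norm_num)]
      exact hI.congr_fun (fun s hs => (heq s hs).symm) measurableSet_Ioo
    have hval : ∫ s in Set.Ioo (-1 : ℝ) 1, (((1 - s ^ 2) ^ μ : ℝ) : ℂ) * ephase (r * s) =
        ∫ s in (-1 : ℝ)..1, besselIntegrand μ r s := by
      rw [intervalIntegral.integral_of_le (by norm_num), integral_Ioc_eq_integral_Ioo]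
      exact setIntegral_congr_fun measurableSet_Ioo fun s hs => (heq s hs).symm
    rw [hval]
    have hsub : ∀ p ∈ Set.Icc (-1 : ℝ) 1, ∀ q ∈ Set.Icc (-1 : ℝ) 1,
        IntervalIntegrable (fun s : ℝ => besselIntegrand μ r s) volume p q := fun p hp q hq =>
      hIi.mono_set (by
        rw [Set.uIcc_of_le (show (-1 : ℝ) ≤ 1 by norm_num)]
        exact Set.uIcc_subset_Icc hp hq)
    have hprim : ContinuousOn (fun x => ∫ t in (0 : ℝ)..x, besselIntegrand μ r t)
        (Set.Icc (-1) 1) := by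
      have := intervalIntegral.continuousOn_primitive_interval' hIi
        (a := 0) (by rw [Set.uIcc_of_le (by norm_num)]; constructor <;> norm_num)
      rwa [Set.uIcc_of_le (by norm_num)] at this
    have hev : ∀ᶠ b in 𝓝[<] (1 : ℝ), b ∈ Set.Icc (-1 : ℝ) 1 :=
      (eventually_mem_nhdsWithin (a := (1 : ℝ)) (s := Set.Iio 1)).mp
        ((eventually_nhdsWithin_of_eventually_nhds (eventually_ge_nhds (show (-1 : ℝ) < 1 by norm_num))).mono
          fun b h1 h2 => ⟨h1, le_of_lt h2⟩)
    have h0 : (0 : ℝ) ∈ Set.Icc (-1 : ℝ) 1 := by constructor <;> norm_num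
    have hneg : ∀ b ∈ Set.Icc (-1 : ℝ) 1, -b ∈ Set.Icc (-1 : ℝ) 1 := fun b hb =>
      ⟨by linarith [hb.2], by linarith [hb.1]⟩
    have hdiff : ∀ b ∈ Set.Icc (-1 : ℝ) 1, (∫ t in (0 : ℝ)..b, besselIntegrand μ r t) -
        (∫ t in (0 : ℝ)..(-b), besselIntegrand μ r t) = ∫ t in (-b)..b, besselIntegrand μ r t :=
      fun b hb => intervalIntegral.integral_interval_sub_left (hsub _ h0 _ hb)
        (hsub _ h0 _ (hneg b hb))
    have h1m : (1 : ℝ) ∈ Set.Icc (-1 : ℝ) 1 := by constructor <;> norm_num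
    have hB : Tendsto (fun b : ℝ => b) (𝓝[<] 1) (𝓝[Set.Icc (-1 : ℝ) 1] 1) :=
      tendsto_nhdsWithin_iff.2 ⟨tendsto_id.mono_left nhdsWithin_le_nhds, hev⟩
    have hB' : Tendsto (fun b : ℝ => -b) (𝓝[<] 1) (𝓝[Set.Icc (-1 : ℝ) 1] (-1)) :=
      tendsto_nhdsWithin_iff.2 ⟨(continuous_neg.tendsto 1).mono_left nhdsWithin_le_nhds,
        hev.mono fun b hb => hneg b hb⟩
    have := ((hprim 1 h1m).tendsto.comp hB).sub ((hprim (-1) (hneg 1 h1m)).tendsto.comp hB')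
    rw [hdiff 1 h1m] at this
    exact this.congr' (hev.mono fun b hb => hdiff b hb)
  have h1 := tendsto_integral_besselIntegrand_vertical hμ hr (σ := 1) (Or.inl rfl)
  have h2 := tendsto_integral_besselIntegrand_vertical hμ hr (σ := -1) (Or.inr rfl)
  have hright := (h1.const_mul (-Complex.I)).add (h2.const_mul Complex.I)
  have hev : ∀ᶠ b in 𝓝[<] (1 : ℝ), 1 / 2 ≤ b ∧ b < 1 :=
    (eventually_mem_nhdsWithin (a := (1 : ℝ)) (s := Set.Iio 1)).mp
      ((eventually_nhdsWithin_of_eventually_nhds (eventually_ge_nhds (by norm_num))).mono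
        fun b h1 h2 => ⟨h1, h2⟩)
  have := tendsto_nhds_unique (hleft.congr' (hev.mono fun b hb =>
    integral_besselIntegrand_eq_vertical hμ hr hb.2 hb.1)) (by simpa only [one_mul, neg_one_mul] using hright)
  rw [this]
  unfold hankelAmp
  push_cast
  ring

/-! ### Plane waves integrated over spheres -/

open scoped RealInnerProductSpace

/-- Euclidean space of dimension `n + 1`. -/
abbrev EucSucc (n : ℕ) : Type := EuclideanSpace ℝ (Fin (n + 1))

/-- The integral of the plane wave `e^{2π i ⟨w, ξ⟩}` over the sphere `|ξ| = t`. -/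
def sphereWave {n : ℕ} (w : EucSucc n) (t : ℝ) : ℂ :=
  (t : ℂ) ^ n * ∫ ω : Metric.sphere (0 : EucSucc n) 1,
    ephase (t * ⟪w, (ω : EucSucc n)⟫) ∂(volume.toSphere)

theorem continuous_sphereWave {n : ℕ} (w : EucSucc n) :
    Continuous (sphereWave w) := by
  unfold sphereWave
  refine Continuous.mul (by fun_prop) ?_
  refine continuous_of_dominated (bound := fun _ => 1) (fun t => ?_) (fun t => ?_)
    (integrable_const _) ?_
  · exact (continuous_ephase.comp (by fun_prop)).aestronglyMeasurable
  · exact Eventually.of_forall fun ω => (norm_ephase _).le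
  · exact Eventually.of_forall fun ω => continuous_ephase.comp (by fun_prop)

theorem norm_sphereWave_le {n : ℕ} (w : EucSucc n) {t : ℝ} (ht : 0 ≤ t) :
    ‖sphereWave w t‖ ≤
      ((volume : Measure (EucSucc n)).toSphere.real Set.univ) * t ^ n := by
  unfold sphereWave
  rw [norm_mul, norm_pow, Complex.norm_real, Real.norm_of_nonneg ht, mul_comm]
  gcongr
  refine (norm_integral_le_of_norm_le_const (Eventually.of_forall fun ω => (norm_ephase _).le)).trans ?_
  rw [one_mul]

/-- Integration of a radial function against a plane wave, in polar coordinates. -/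
theorem integral_radial_mul_ephase {n : ℕ} (w : EucSucc n) {k : ℝ → ℂ}
    (hk : Integrable fun ξ : EucSucc n => k ‖ξ‖) :
    ∫ ξ : EucSucc n, k ‖ξ‖ * ephase ⟪w, ξ⟫ =
      ∫ t in Set.Ioi (0 : ℝ), k t * sphereWave w t := by
  set μ : Measure (EucSucc n) := volume
  have hdim : Module.finrank ℝ (EucSucc n) - 1 = n := by simp [EucSucc]
  set G : Metric.sphere (0 : EucSucc n) 1 × Set.Ioi (0 : ℝ) → ℂ := fun p =>
    k p.2 * ephase (p.2 * ⟪w, (p.1 : EucSucc n)⟫) with hG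
  have hinner : ∀ x : ({0}ᶜ : Set (EucSucc n)), G (homeomorphUnitSphereProd (EucSucc n) x) =
      k ‖(x : EucSucc n)‖ * ephase ⟪w, (x : EucSucc n)⟫ := by
    intro x
    have hx : ‖(x : EucSucc n)‖ ≠ 0 := norm_ne_zero_iff.2 x.2
    simp only [hG, homeomorphUnitSphereProd_apply_snd_coe, homeomorphUnitSphereProd_apply_fst_coe,
      inner_smul_right]
    rw [← mul_assoc, mul_inv_cancel₀ hx, one_mul]
  have hmp := μ.measurePreserving_homeomorphUnitSphereProd
  have hint : Integrable (fun ξ : EucSucc n => k ‖ξ‖ * ephase ⟪w, ξ⟫) μ :=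
    hk.mul_bdd (c := 1) (continuous_ephase.comp (by fun_prop)).aestronglyMeasurable
      (Eventually.of_forall fun x => (norm_ephase _).le)
  -- The origin is a null set, so integrability on the whole space transfers to the punctured space
  -- and through the polar homeomorphism to the product measure.
  have hGint : Integrable G (μ.toSphere.prod (.volumeIoiPow (Module.finrank ℝ (EucSucc n) - 1))) := by
    rw [← hmp.integrable_comp_emb (Homeomorph.measurableEmbedding _)]
    rw [← restrict_compl_singleton (μ := μ) 0, ← IntegrableOn,
      integrableOn_iff_comap_subtypeVal (measurableSet_singleton _).compl] at hint
    exact hint.congr (Eventually.of_forall fun x => (hinner x).symm)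
  calc ∫ ξ : EucSucc n, k ‖ξ‖ * ephase ⟪w, ξ⟫
      = ∫ x : ({0}ᶜ : Set (EucSucc n)), k ‖(x : EucSucc n)‖ * ephase ⟪w, (x : EucSucc n)⟫ ∂(μ.comap (↑)) := by
        rw [integral_subtype_comap (measurableSet_singleton _).compl
          fun x : EucSucc n => k ‖x‖ * ephase ⟪w, x⟫, restrict_compl_singleton]
    _ = ∫ p, G p ∂(μ.toSphere.prod (.volumeIoiPow (Module.finrank ℝ (EucSucc n) - 1))) := by
        rw [← hmp.integral_comp (Homeomorph.measurableEmbedding _)]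
        simp_rw [hinner]
    _ = ∫ t : Set.Ioi (0 : ℝ), ∫ ω : Metric.sphere (0 : EucSucc n) 1, G (ω, t) ∂μ.toSphere
          ∂(.volumeIoiPow (Module.finrank ℝ (EucSucc n) - 1)) := integral_prod_symm _ hGint
    _ = ∫ t in Set.Ioi (0 : ℝ), k t * sphereWave w t := by
        simp only [Measure.volumeIoiPow, ENNReal.ofReal]
        rw [integral_withDensity_eq_integral_smul]
        · simp only [hG, integral_const_mul]
          rw [integral_subtype_comap measurableSet_Ioi fun t : ℝ =>
            Real.toNNReal (t ^ (Module.finrank ℝ (EucSucc n) - 1)) • (k t *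
              ∫ ω : Metric.sphere (0 : EucSucc n) 1, ephase (t * ⟪w, (ω : EucSucc n)⟫) ∂μ.toSphere)]
          refine setIntegral_congr_fun measurableSet_Ioi fun t ht => ?_
          rw [hdim, NNReal.smul_def, Real.coe_toNNReal _ (pow_nonneg (le_of_lt ht) _),
            Complex.real_smul, sphereWave]
          push_cast; ring
        · exact (measurable_subtype_coe.pow_const _).real_toNNReal

open FourierTransform in
-- Integrating the spherical waves up to radius $t$ gives the Fourier transform of a ball, which is
-- the case $\beta=0$ of the transform already computed.
theorem integral_sphereWave {n : ℕ} (w : EucSucc n) {t : ℝ} (ht : 0 < t) :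
    ∫ s in (0 : ℝ)..t, sphereWave w s =
      (ballMass n 0 : ℂ) * (t : ℂ) ^ (n + 1) * besselInt ((n : ℝ) / 2) (t * ‖w‖) := by
  have hU : ∀ ξ : EucSucc n, (bigU 0 t ξ : ℂ) = (Set.Iio t).indicator (fun _ => (1 : ℂ)) ‖ξ‖ := by
    intro ξ
    by_cases h : ‖ξ‖ < t <;> simp [bigU, h]
  have h1 := fourier_bigU (n := n) (β := 0) (by norm_num) ht (-w)
  rw [Real.fourier_eq', norm_neg] at h1
  have h2 := integral_radial_mul_ephase w (k := (Set.Iio t).indicator (fun _ => (1 : ℂ)))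
    (((integrable_bigU (d := n + 1) (β := 0) (by norm_num) ht).ofReal (𝕜 := ℂ)).congr
      (Eventually.of_forall hU))
  have h3 : ∫ ξ : EucSucc n, (Set.Iio t).indicator (fun _ => (1 : ℂ)) ‖ξ‖ * ephase ⟪w, ξ⟫ =
      ∫ ξ : EucSucc n, Complex.exp (((-2 * Real.pi * ⟪ξ, -w⟫ : ℝ) : ℂ) * Complex.I) • (bigU 0 t ξ : ℂ) := by
    congr 1
    funext ξ
    rw [hU, smul_eq_mul, mul_comm, ephase]
    congr 2
    rw [inner_neg_right, real_inner_comm]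
    push_cast; ring
  rw [← h3, h2] at h1
  have h4 : ∀ s, (Set.Iio t).indicator (fun _ => (1 : ℂ)) s * sphereWave w s =
      (Set.Iio t).indicator (sphereWave w) s := by
    intro s
    by_cases h : s ∈ Set.Iio t <;> simp [h]
  simp_rw [h4] at h1
  rw [setIntegral_indicator measurableSet_Iio, Set.Ioi_inter_Iio] at h1
  rw [intervalIntegral.integral_of_le ht.le, integral_Ioc_eq_integral_Ioo, h1, zero_add]
  rw [show 2 * ((n : ℝ) / 2) + 1 = ((n + 1 : ℕ) : ℝ) by push_cast; ring, Real.rpow_natCast]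
  push_cast; ring

/-! ### Outgoing and incoming amplitudes of spherical waves -/

/-- The amplitude of the outgoing or incoming part of the Fourier transform of the ball `|ξ| < z`. -/
def ballAmp (n : ℕ) (σ ω : ℝ) (z : ℂ) : ℂ :=
  (ballMass n 0 : ℂ) * z ^ (n + 1) * hankelAmp σ ((n : ℝ) / 2) (ω * z)

/-- The amplitude of the outgoing or incoming part of `sphereWave`. -/
def waveAmp (n : ℕ) (σ ω : ℝ) (z : ℂ) : ℂ :=
  2 * Real.pi * Complex.I * (σ * ω) * ballAmp n σ ω z + deriv (ballAmp n σ ω) z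

theorem neg_one_lt_half (n : ℕ) : (-1 : ℝ) < (n : ℝ) / 2 := by
  have : (0 : ℝ) ≤ n := n.cast_nonneg
  linarith

theorem differentiableAt_ballAmp (n : ℕ) {σ ω : ℝ} (hσ : |σ| = 1) (hω : 0 < ω) {z : ℂ}
    (hz : 0 < z.re) : DifferentiableAt ℂ (ballAmp n σ ω) z := by
  unfold ballAmp
  refine DifferentiableAt.mul (by fun_prop) ?_
  have h : DifferentiableAt ℂ (hankelAmp σ ((n : ℝ) / 2)) (ω * z) :=
    differentiableAt_hankelAmp hσ (neg_one_lt_half n) (by simpa using mul_pos hω hz)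
  exact DifferentiableAt.comp (g := hankelAmp σ ((n : ℝ) / 2)) z h (by fun_prop)

theorem isOpen_re_pos : IsOpen {z : ℂ | 0 < z.re} := isOpen_lt continuous_const Complex.continuous_re

theorem differentiableAt_waveAmp (n : ℕ) {σ ω : ℝ} (hσ : |σ| = 1) (hω : 0 < ω) {z : ℂ}
    (hz : 0 < z.re) : DifferentiableAt ℂ (waveAmp n σ ω) z := by
  unfold waveAmp
  have h : DifferentiableOn ℂ (ballAmp n σ ω) {z : ℂ | 0 < z.re} := fun z hz =>
    (differentiableAt_ballAmp n hσ hω hz).differentiableWithinAt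
  refine DifferentiableAt.add ((differentiableAt_ballAmp n hσ hω hz).const_mul _) ?_
  exact (h.deriv isOpen_re_pos).differentiableAt (isOpen_re_pos.mem_nhds hz)

theorem hasDerivAt_ephase_mul (c t : ℝ) :
    HasDerivAt (fun t : ℝ => ephase (c * t)) (2 * Real.pi * Complex.I * c * ephase (c * t)) t := by
  have h1 : HasDerivAt (fun z : ℂ => Complex.exp (2 * Real.pi * Complex.I * (c * z)))
      (Complex.exp (2 * Real.pi * Complex.I * (c * t)) * (2 * Real.pi * Complex.I * c)) (t : ℂ) := by
    have := (((hasDerivAt_id' (t : ℂ)).const_mul (c : ℂ)).const_mul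
      (2 * Real.pi * Complex.I)).cexp
    simpa using this
  have h2 := h1.comp_ofReal
  simp only [ephase, Complex.ofReal_mul]
  convert! h2 using 1
  ring

/-- Differentiate the ball formula in $t$: the derivative of a phase times `ballAmp` is the same
phase times `waveAmp`. No separate analysis of the surface measure is needed. -/
theorem sphereWave_eq_waveAmp {n : ℕ} {w : EucSucc n} (hw : w ≠ 0) {t : ℝ}
    (ht : 0 < t) :
    sphereWave w t = ephase (‖w‖ * t) * waveAmp n 1 ‖w‖ t +
      ephase (-‖w‖ * t) * waveAmp n (-1) ‖w‖ t := by
  have hω : 0 < ‖w‖ := norm_pos_iff.2 hw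
  have h1 : HasDerivAt (fun u => ∫ s in (0 : ℝ)..u, sphereWave w s) (sphereWave w t) t :=
    intervalIntegral.integral_hasDerivAt_right ((continuous_sphereWave w).intervalIntegrable _ _)
      (continuous_sphereWave w).aestronglyMeasurable.stronglyMeasurableAtFilter
      (continuous_sphereWave w).continuousAt
  have hb : ∀ σ : ℝ, |σ| = 1 → HasDerivAt (fun u : ℝ => ballAmp n σ ‖w‖ u)
      (deriv (ballAmp n σ ‖w‖) t) t := fun σ hσ =>
    ((differentiableAt_ballAmp n hσ hω (z := (t : ℂ)) (by simpa using ht)).hasDerivAt).comp_ofReal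
  have h2 : HasDerivAt (fun u : ℝ => ephase (‖w‖ * u) * ballAmp n 1 ‖w‖ u +
      ephase (-‖w‖ * u) * ballAmp n (-1) ‖w‖ u)
      (ephase (‖w‖ * t) * waveAmp n 1 ‖w‖ t + ephase (-‖w‖ * t) * waveAmp n (-1) ‖w‖ t) t := by
    have := ((hasDerivAt_ephase_mul ‖w‖ t).mul (hb 1 (by simp))).add
      ((hasDerivAt_ephase_mul (-‖w‖) t).mul (hb (-1) (by simp)))
    convert! this using 1
    simp only [waveAmp]
    push_cast; ring
  refine h1.unique (h2.congr_of_eventuallyEq ?_)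
  filter_upwards [lt_mem_nhds ht] with u hu
  rw [integral_sphereWave w hu, besselInt_eq_hankelAmp (neg_one_lt_half n) (mul_pos hu hω)]
  simp only [ballAmp]
  rw [show ‖w‖ * u = u * ‖w‖ by ring, show -‖w‖ * u = -(u * ‖w‖) by ring]
  push_cast
  rw [mul_comm (‖w‖ : ℂ) u]; ring

/-! ### Symbols, cutoffs and repeated integration by parts -/

/-- A function holomorphic in the right half plane and of size `M t^p` on the discs
`|z - t| ≤ t / 4`, `t ≥ 1`. -/
structure IsSymbol (P : ℂ → ℂ) (M p : ℝ) : Prop where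
  differentiableAt : ∀ z : ℂ, 0 < z.re → DifferentiableAt ℂ P z
  norm_le : ∀ t : ℝ, 1 ≤ t → ∀ z : ℂ, ‖z - t‖ ≤ t / 4 → ‖P z‖ ≤ M * t ^ p

theorem re_ge_of_norm_sub_le {z : ℂ} {t r : ℝ} (h : ‖z - t‖ ≤ r) : t - r ≤ z.re := by
  have := (Complex.abs_re_le_norm (z - t)).trans h
  rw [Complex.sub_re, Complex.ofReal_re] at this
  linarith [(abs_le.1 this).1]

theorem IsSymbol.nonneg {P : ℂ → ℂ} {M p : ℝ} (h : IsSymbol P M p) : 0 ≤ M := by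
  have := h.norm_le 1 le_rfl 1 (by norm_num)
  rw [Real.one_rpow, mul_one] at this
  exact (norm_nonneg _).trans this

theorem IsSymbol.norm_ofReal_le {P : ℂ → ℂ} {M p : ℝ} (h : IsSymbol P M p) {t : ℝ} (ht : 1 ≤ t) :
    ‖P t‖ ≤ M * t ^ p := h.norm_le t ht t (by simp; linarith)

/-- Cauchy's estimate on the disc of radius $t/4$. Holomorphy makes each derivative gain a factor
$t^{-1}$ without differentiating any explicit amplitude. -/
theorem IsSymbol.norm_iteratedDeriv_le {P : ℂ → ℂ} {M p : ℝ} (h : IsSymbol P M p) (j : ℕ) {t : ℝ}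
    (ht : 1 ≤ t) : ‖iteratedDeriv j P t‖ ≤ j.factorial * 4 ^ j * M * t ^ (p - j) := by
  have htp : 0 < t := by linarith
  have hd : DifferentiableOn ℂ P (Metric.closedBall (t : ℂ) (t / 4)) := fun z hz =>
    (h.differentiableAt z (by
      have := re_ge_of_norm_sub_le (mem_closedBall_iff_norm.1 hz)
      linarith)).differentiableWithinAt
  have := Complex.norm_iteratedDeriv_le_of_forall_mem_sphere_norm_le (f := P) (c := (t : ℂ))
    (R := t / 4) (C := M * t ^ p) j (by positivity) (hd.diffContOnCl_ball subset_rfl)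
    (fun z hz => h.norm_le t ht z (mem_sphere_iff_norm.1 hz).le)
  refine this.trans (le_of_eq ?_)
  rw [Real.rpow_sub htp, Real.rpow_natCast, div_pow]
  field_simp

theorem IsSymbol.contDiffAt {P : ℂ → ℂ} {M p : ℝ} (h : IsSymbol P M p) {t : ℝ} (ht : 0 < t)
    (m : ℕ) : ContDiffAt ℝ m (fun s : ℝ => P s) t := by
  have hd : DifferentiableOn ℂ P {z : ℂ | 0 < z.re} := fun z hz =>
    (h.differentiableAt z hz).differentiableWithinAt
  have ha : AnalyticAt ℂ P t := hd.analyticAt (isOpen_re_pos.mem_nhds (by simpa using ht))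
  have h1 : ContDiffAt ℝ m P (t : ℂ) := (ha.contDiffAt (n := m)).restrict_scalars ℝ
  exact ContDiffAt.comp t h1 (Complex.ofRealCLM.contDiff.contDiffAt)

theorem IsSymbol.iteratedDeriv_ofReal {P : ℂ → ℂ} {M p : ℝ} (h : IsSymbol P M p) (j : ℕ) :
    ∀ t : ℝ, 0 < t → iteratedDeriv j (fun s : ℝ => P s) t = iteratedDeriv j P t := by
  have hd : DifferentiableOn ℂ P {z : ℂ | 0 < z.re} := fun z hz =>
    (h.differentiableAt z hz).differentiableWithinAt
  induction j with
  | zero => intro t _; simp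
  | succ j ih =>
    intro t ht
    rw [iteratedDeriv_succ, iteratedDeriv_succ]
    have h1 : iteratedDeriv j (fun s : ℝ => P s) =ᶠ[𝓝 t] fun s : ℝ => iteratedDeriv j P s := by
      filter_upwards [lt_mem_nhds ht] with s hs using ih s hs
    rw [h1.deriv_eq]
    have ha : AnalyticAt ℂ P t := hd.analyticAt (isOpen_re_pos.mem_nhds (by simpa using ht))
    have h2 : DifferentiableAt ℂ (iteratedDeriv j P) t := by
      rw [iteratedDeriv_eq_iterate]; exact (ha.iterated_deriv j).differentiableAt
    exact (h2.hasDerivAt.comp_ofReal).deriv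

/-- A smooth function that vanishes on `(-∞, -1]` and is constant on `[2, ∞)`. -/
structure IsCutoff (ζ : ℝ → ℂ) : Prop where
  contDiff : ContDiff ℝ 3 ζ
  eq_zero : ∀ u ≤ -1, ζ u = 0
  eq_const : ∀ u, 2 ≤ u → ζ u = ζ 2

theorem IsCutoff.iteratedDeriv_eq_zero {ζ : ℝ → ℂ} (h : IsCutoff ζ) {i : ℕ} (hi : i ≠ 0) {u : ℝ}
    (hu : u < -1 ∨ 2 < u) : iteratedDeriv i ζ u = 0 := by
  have : ∃ c : ℂ, ζ =ᶠ[𝓝 u] fun _ => c := by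
    rcases hu with hu | hu
    · exact ⟨0, by filter_upwards [gt_mem_nhds hu] with v hv using h.eq_zero v hv.le⟩
    · exact ⟨ζ 2, by filter_upwards [lt_mem_nhds hu] with v hv using h.eq_const v hv.le⟩
  obtain ⟨c, hc⟩ := this
  rw [hc.iteratedDeriv_eq, iteratedDeriv_const]
  simp [hi]

theorem IsCutoff.exists_bound {ζ : ℝ → ℂ} (h : IsCutoff ζ) :
    ∃ Z : ℝ, 0 < Z ∧ ∀ i ≤ 3, ∀ u, ‖iteratedDeriv i ζ u‖ ≤ Z := by
  have hc : ∀ i : ℕ, i ≤ 3 → Continuous (iteratedDeriv i ζ) := fun i hi =>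
    h.contDiff.continuous_iteratedDeriv i (by exact_mod_cast hi)
  have key : ∀ i : ℕ, i ≤ 3 → ∃ Z : ℝ, ∀ u, ‖iteratedDeriv i ζ u‖ ≤ Z := by
    intro i hi
    obtain ⟨Z, hZ⟩ := isCompact_Icc.exists_bound_of_continuousOn
      (s := Set.Icc (-1 : ℝ) 2) (hc i hi).continuousOn
    refine ⟨Z, fun u => ?_⟩
    have hZ0 : 0 ≤ Z := (norm_nonneg _).trans (hZ 2 (by constructor <;> norm_num))
    by_cases hu : u ∈ Set.Icc (-1 : ℝ) 2
    · exact hZ u hu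
    · have hu' : u < -1 ∨ 2 < u := by
        by_contra hcon
        push Not at hcon
        exact hu ⟨hcon.1, hcon.2⟩
      rcases Nat.eq_zero_or_pos i with rfl | hi0
      · simp only [iteratedDeriv_zero] at hZ ⊢
        rcases hu' with hu' | hu'
        · rw [h.eq_zero u hu'.le]; simpa using hZ0
        · rw [h.eq_const u hu'.le]; exact hZ 2 (by constructor <;> norm_num)
      · rw [h.iteratedDeriv_eq_zero hi0.ne' hu']; simpa using hZ0
  choose! Z hZ using key
  refine ⟨|Z 0| + |Z 1| + |Z 2| + |Z 3| + 1, by positivity, fun i hi u => ?_⟩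
  have := hZ i hi u
  have h0 := abs_nonneg (Z 0)
  have h1 := abs_nonneg (Z 1)
  have h2 := abs_nonneg (Z 2)
  have h3 := abs_nonneg (Z 3)
  interval_cases i
  · linarith [le_abs_self (Z 0)]
  · linarith [le_abs_self (Z 1)]
  · linarith [le_abs_self (Z 2)]
  · linarith [le_abs_self (Z 3)]

theorem iteratedDeriv_scaled {ζ : ℝ → ℂ} (h : ContDiff ℝ 3 ζ) {i : ℕ} (hi : i ≤ 3) (l η t : ℝ) :
    iteratedDeriv i (fun t => ζ (η⁻¹ * (t - l))) t = (η⁻¹) ^ i • iteratedDeriv i ζ (η⁻¹ * (t - l)) := by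
  have h1 := iteratedDeriv_comp_const_smul (h.of_le (by exact_mod_cast hi) : ContDiff ℝ i ζ) η⁻¹
  have h2 := iteratedDeriv_comp_sub_const i (fun x => ζ (η⁻¹ * x)) l
  rw [h2, h1]

theorem rpow_le_of_mem_dyadic {p l t : ℝ} (hl : 0 < l) (h1 : l / 2 ≤ t) (h2 : t ≤ 2 * l) :
    t ^ p ≤ 2 ^ |p| * l ^ p := by
  have ht : 0 < t := by linarith
  rcases le_or_gt 0 p with hp | hp
  · rw [abs_of_nonneg hp, ← Real.mul_rpow (by norm_num) hl.le]
    exact Real.rpow_le_rpow ht.le h2 hp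
  · rw [abs_of_neg hp]
    calc t ^ p ≤ (l / 2) ^ p := Real.rpow_le_rpow_of_nonpos (by positivity) h1 hp.le
      _ = _ := by
        rw [Real.div_rpow hl.le (by norm_num), Real.rpow_neg (by norm_num)]
        field_simp

/-- In the layer $[l-\eta,l+2\eta]$ the worst case is that all derivatives fall on the cutoff, each
at cost $\eta^{-1}$. To the right of it only the symbol is differentiated, with weight the final
value `ζ 2`. -/
theorem IsCutoff.exists_iteratedDeriv_mul_le {ζ : ℝ → ℂ} (hζ : IsCutoff ζ) (p : ℝ) :
    ∃ K : ℝ, 0 < K ∧ ∀ (P : ℂ → ℂ) (M : ℝ), IsSymbol P M p → ∀ l η : ℝ, 4 ≤ l → 0 < η → η ≤ 1 →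
      ContDiff ℝ 3 (fun t : ℝ => ζ (η⁻¹ * (t - l)) * P t) ∧ ∀ j ≤ 3, ∀ t : ℝ,
      ‖iteratedDeriv j (fun t : ℝ => ζ (η⁻¹ * (t - l)) * P t) t‖ ≤
        K * M * ((Set.Icc (l - η) (l + 2 * η)).indicator (fun _ => l ^ p * η⁻¹ ^ j) t +
          ‖ζ 2‖ * (Set.Ioi l).indicator (fun t => t ^ (p - j)) t) := by
  obtain ⟨Z, hZ, hZb⟩ := hζ.exists_bound
  -- Here $8\ge\sum_i\binom ji$ and $6\cdot64\ge j!\,4^j$ for $j\le3$, while $2^{|p|}$ compares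
  -- $t^p$ with $l^p$: the layer lies in $[l/2,2l]$ because $l\ge4$ and $\eta\le1$.
  refine ⟨(8 * Z * (6 * 64) * 2 ^ |p|) + 6 * 64, by positivity, fun P M hP l η hl hη hη1 => ?_⟩
  have hM := hP.nonneg
  have hηinv : 1 ≤ η⁻¹ := (one_le_inv₀ hη).2 hη1
  set f : ℝ → ℂ := fun t => ζ (η⁻¹ * (t - l)) with hf
  have hfc : ContDiff ℝ 3 f := hζ.contDiff.comp (by fun_prop)
  have hfz : ∀ t < l - η, ∀ᶠ s in 𝓝 t, f s * P s = 0 := by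
    intro t ht
    filter_upwards [gt_mem_nhds ht] with s hs
    have : ζ (η⁻¹ * (s - l)) = 0 := hζ.eq_zero _ (by
      rw [inv_mul_le_iff₀ hη]; linarith)
    simp [hf, this]
  have hPc : ∀ t : ℝ, 0 < t → ∀ m : ℕ, ContDiffAt ℝ m (fun s : ℝ => P s) t := fun t ht m =>
    hP.contDiffAt ht m
  refine ⟨contDiff_iff_contDiffAt.2 fun t => ?_, fun j hj t => ?_⟩
  · rcases lt_or_ge t (l - η) with ht | ht
    · exact contDiffAt_const.congr_of_eventuallyEq (hfz t ht)
    · exact hfc.contDiffAt.mul (by exact_mod_cast hPc t (by linarith) 3)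
  rcases lt_or_ge t (l - η) with ht | ht
  · have h0 : (fun t : ℝ => f t * P t) =ᶠ[𝓝 t] fun _ => 0 := hfz t ht
    rw [h0.iteratedDeriv_eq, iteratedDeriv_const]
    rw [Set.indicator_of_notMem (fun hmem => ht.not_ge hmem.1), Set.indicator_of_notMem
      (by simp only [Set.mem_Ioi, not_lt]; linarith)]
    by_cases hj0 : j = 0 <;> simp [hj0]
  have ht1 : 1 ≤ t := by linarith
  have htp : 0 < t := by linarith
  have hleib : iteratedDeriv j (fun t : ℝ => f t * P t) t = ∑ i ∈ Finset.range (j + 1),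
      (j.choose i : ℂ) * iteratedDeriv i f t * iteratedDeriv (j - i) (fun s : ℝ => P s) t :=
    iteratedDeriv_mul (hfc.contDiffAt.of_le (by exact_mod_cast hj)) (hPc t htp j)
  have hfd : ∀ i ≤ 3, ‖iteratedDeriv i f t‖ = η⁻¹ ^ i * ‖iteratedDeriv i ζ (η⁻¹ * (t - l))‖ := by
    intro i hi
    rw [hf, iteratedDeriv_scaled hζ.contDiff hi, norm_smul, Real.norm_of_nonneg (by positivity)]
  have hPd : ∀ i ≤ 3, ‖iteratedDeriv i (fun s : ℝ => P s) t‖ ≤ 6 * 64 * M * t ^ (p - i) := by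
    intro i hi
    rw [hP.iteratedDeriv_ofReal i t htp]
    refine (hP.norm_iteratedDeriv_le i ht1).trans ?_
    have h6 : (i.factorial : ℝ) ≤ 6 := by
      exact_mod_cast (Nat.factorial_le hi).trans (by decide)
    have h64 : (4 : ℝ) ^ i ≤ 64 := by
      calc (4 : ℝ) ^ i ≤ 4 ^ 3 := pow_le_pow_right₀ (by norm_num) hi
        _ = 64 := by norm_num
    gcongr
  rcases le_or_gt t (l + 2 * η) with ht2 | ht2
  · rw [Set.indicator_of_mem (Set.mem_Icc.2 ⟨ht, ht2⟩), hleib]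
    have hterm : ∀ i ∈ Finset.range (j + 1), ‖(j.choose i : ℂ) * iteratedDeriv i f t *
        iteratedDeriv (j - i) (fun s : ℝ => P s) t‖ ≤
        (j.choose i : ℝ) * (Z * (6 * 64) * 2 ^ |p| * M * (l ^ p * η⁻¹ ^ j)) := by
      intro i hi
      have hij : i ≤ j := by simpa [Nat.lt_succ_iff] using hi
      rw [norm_mul, norm_mul, hfd i (hij.trans hj)]
      have h1 := hZb i (hij.trans hj) (η⁻¹ * (t - l))
      have h2 := hPd (j - i) (by omega)
      have h3 : t ^ (p - ((j - i : ℕ) : ℝ)) ≤ 2 ^ |p| * l ^ p := by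
        refine le_trans (Real.rpow_le_rpow_of_exponent_le ht1 ?_)
          (rpow_le_of_mem_dyadic (by linarith) (by linarith) (by linarith))
        have : (0 : ℝ) ≤ ((j - i : ℕ) : ℝ) := Nat.cast_nonneg _
        linarith
      have h4 : η⁻¹ ^ i ≤ η⁻¹ ^ j := pow_le_pow_right₀ hηinv hij
      rw [Complex.norm_natCast, mul_assoc]
      gcongr (j.choose i : ℝ) * ?_
      calc _ ≤ (η⁻¹ ^ j * Z) * (6 * 64 * M * (2 ^ |p| * l ^ p)) := by
            gcongr; exact h2.trans (by gcongr)
        _ = _ := by ring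
    refine (norm_sum_le_of_le _ hterm).trans ?_
    rw [← Finset.sum_mul]
    have hsum : ∑ i ∈ Finset.range (j + 1), (j.choose i : ℝ) ≤ 8 := by
      have : ∑ i ∈ Finset.range (j + 1), (j.choose i : ℝ) = 2 ^ j := by
        exact_mod_cast Nat.sum_range_choose j
      rw [this]
      calc (2 : ℝ) ^ j ≤ 2 ^ 3 := pow_le_pow_right₀ (by norm_num) hj
        _ = 8 := by norm_num
    have hlp : 0 ≤ l ^ p * η⁻¹ ^ j := by positivity
    have hind : 0 ≤ ‖ζ 2‖ * (Set.Ioi l).indicator (fun t => t ^ (p - j)) t := by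
      refine mul_nonneg (norm_nonneg _) (Set.indicator_nonneg (fun s hs => ?_) _)
      have : 0 < s := lt_trans (by linarith) hs
      positivity
    calc _ ≤ 8 * (Z * (6 * 64) * 2 ^ |p| * M * (l ^ p * η⁻¹ ^ j)) := by gcongr
      _ = (8 * Z * (6 * 64) * 2 ^ |p|) * M * (l ^ p * η⁻¹ ^ j) := by ring
      _ ≤ _ := by gcongr <;> linarith
  · rw [Set.indicator_of_notMem (by simp only [Set.mem_Icc, not_and, not_le]; intro; exact ht2),
      Set.indicator_of_mem (show t ∈ Set.Ioi l by simp only [Set.mem_Ioi]; linarith), zero_add]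
    have hu : 2 < η⁻¹ * (t - l) := by
      rw [lt_inv_mul_iff₀ hη]; linarith
    have hval : iteratedDeriv j (fun t : ℝ => f t * P t) t =
        ζ 2 * iteratedDeriv j (fun s : ℝ => P s) t := by
      rw [hleib, Finset.sum_range_succ', Finset.sum_eq_zero]
      · simp [hf, hζ.eq_const _ hu.le]
      · intro i hi
        have hij : i + 1 ≤ 3 := by have := Finset.mem_range.1 hi; omega
        have : iteratedDeriv (i + 1) f t = 0 := by
          rw [← norm_eq_zero, hfd (i + 1) hij, hζ.iteratedDeriv_eq_zero (by omega) (Or.inr hu)]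
          simp
        rw [this]; ring
    rw [hval, norm_mul]
    calc _ ≤ ‖ζ 2‖ * (6 * 64 * M * t ^ (p - j)) := by gcongr; exact hPd j hj
      _ = 6 * 64 * M * (‖ζ 2‖ * t ^ (p - j)) := by ring
      _ ≤ _ := by
        gcongr
        have : 0 ≤ 8 * Z * (6 * 64) * 2 ^ |p| := by positivity
        linarith

open FourierTransform in
-- Integration by parts expressed through the Fourier transform of a derivative; the factor
-- $(2\pi)^{-j}$ is given away.
theorem norm_integral_ephase_mul_le {G : ℝ → ℂ} (hG : ContDiff ℝ 3 G)
    (hint : ∀ i ≤ 3, Integrable (iteratedDeriv i G)) {θ : ℝ} (hθ : θ ≠ 0) {j : ℕ} (hj : j ≤ 3) :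
    ‖∫ t, ephase (θ * t) * G t‖ ≤ |θ|⁻¹ ^ j * ∫ t, ‖iteratedDeriv j G t‖ := by
  have hF : ∀ (f : ℝ → ℂ) (θ : ℝ), 𝓕 f (-θ) = ∫ t, ephase (θ * t) * f t := by
    intro f θ
    rw [Real.fourier_eq']
    congr 1; funext t
    rw [smul_eq_mul, ephase]
    congr 2
    simp; ring
  have h1 := Real.fourier_iteratedDeriv (f := G) (N := 3) (n := j) (by exact_mod_cast hG)
    (fun i hi => hint i (by exact_mod_cast hi)) (by exact_mod_cast hj)
  have h2 := congrFun h1 (-θ)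
  simp only [hF] at h2
  have h3 : ‖∫ t, ephase (θ * t) * iteratedDeriv j G t‖ ≤ ∫ t, ‖iteratedDeriv j G t‖ := by
    refine (norm_integral_le_integral_norm _).trans (le_of_eq ?_)
    congr 1; funext t
    rw [norm_mul, norm_ephase, one_mul]
  rw [h2, norm_smul, norm_pow] at h3
  have h4 : ‖2 * (Real.pi : ℂ) * Complex.I * ((-θ : ℝ) : ℂ)‖ = 2 * Real.pi * |θ| := by
    simp [abs_of_pos Real.pi_pos]
  rw [h4] at h3
  have hθ' : 0 < |θ| := abs_pos.2 hθ
  have h5 : |θ| ^ j ≤ (2 * Real.pi * |θ|) ^ j := by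
    gcongr
    nlinarith [Real.pi_gt_three]
  rw [inv_pow, ← div_eq_inv_mul, le_div_iff₀ (by positivity), mul_comm]
  exact (mul_le_mul_of_nonneg_right h5 (norm_nonneg _)).trans h3

/-- Repeated integration by parts against a cut-off symbol. -/
theorem IsCutoff.exists_norm_integral_le {ζ : ℝ → ℂ} (hζ : IsCutoff ζ) {p : ℝ}
    (hp : p < 0 ∨ ζ 2 = 0) :
    ∃ K : ℝ, 0 < K ∧ ∀ (P : ℂ → ℂ) (M : ℝ), IsSymbol P M p → ∀ l η : ℝ, 4 ≤ l → 0 < η → η ≤ 1 →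
      Integrable (fun t : ℝ => ζ (η⁻¹ * (t - l)) * P t) → ∀ j : ℕ, 1 ≤ j → j ≤ 3 →
      ∀ θ : ℝ, θ ≠ 0 → ‖∫ t : ℝ, ephase (θ * t) * (ζ (η⁻¹ * (t - l)) * P t)‖ ≤
        K * M * l ^ p * (η * η⁻¹ ^ j) * |θ|⁻¹ ^ j := by
  obtain ⟨K, hK, h⟩ := hζ.exists_iteratedDeriv_mul_le p
  -- The layer of length $3\eta$ gives the 3, and the tail $\int_l^\infty t^{p-j}\,dt$ gives
  -- $|p|^{-1}$. When $p=0$ the inverse is $0$ by convention, which is harmless because then `ζ 2 =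
  -- 0`.
  refine ⟨K * (3 + ‖ζ 2‖ * |p|⁻¹), by positivity, fun P M hP l η hl hη hη1 hint j hj1 hj3 θ hθ => ?_⟩
  obtain ⟨hc, hb⟩ := h P M hP l η hl hη hη1
  have hM := hP.nonneg
  have hlp : 0 < l := by linarith
  set G : ℝ → ℂ := fun t => ζ (η⁻¹ * (t - l)) * P t with hG
  have hI1 : ∀ i : ℕ, Integrable ((Set.Icc (l - η) (l + 2 * η)).indicator
      (fun _ : ℝ => l ^ p * η⁻¹ ^ i)) := fun i =>
    (integrable_indicator_iff measurableSet_Icc).2 (integrableOn_const (by simp))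
  have hI2 : ∀ i : ℕ, 1 ≤ i → Integrable (fun t => ‖ζ 2‖ * (Set.Ioi l).indicator
      (fun t : ℝ => t ^ (p - i)) t) := by
    intro i hi
    rcases hp with hp | hp
    · refine Integrable.const_mul ((integrable_indicator_iff measurableSet_Ioi).2
        (integrableOn_Ioi_rpow_of_lt ?_ hlp)) _
      have : (1 : ℝ) ≤ i := by exact_mod_cast hi
      linarith
    · simp [hp]
  have hJ : ∀ i ≤ 3, Integrable (iteratedDeriv i G) := by
    intro i hi
    rcases Nat.eq_zero_or_pos i with rfl | hi0
    · rw [iteratedDeriv_zero]; exact hint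
    · refine Integrable.mono' (((hI1 i).add (hI2 i hi0)).const_mul (K * M))
        (hc.continuous_iteratedDeriv i (by exact_mod_cast hi)).aestronglyMeasurable
        (Eventually.of_forall fun t => ?_)
      exact hb i hi t
  refine (norm_integral_ephase_mul_le hc hJ hθ hj3).trans ?_
  have hint2 : ∫ t, ‖iteratedDeriv j G t‖ ≤ K * M * (3 * (l ^ p * (η * η⁻¹ ^ j)) +
      ‖ζ 2‖ * (|p|⁻¹ * (l ^ p * (η * η⁻¹ ^ j)))) := by
    have hmono : ∫ t, ‖iteratedDeriv j G t‖ ≤ ∫ t, K * M *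
        ((Set.Icc (l - η) (l + 2 * η)).indicator (fun _ => l ^ p * η⁻¹ ^ j) t +
          ‖ζ 2‖ * (Set.Ioi l).indicator (fun t => t ^ (p - j)) t) :=
      integral_mono (hJ j hj3).norm (((hI1 j).add (hI2 j hj1)).const_mul (K * M)) (hb j hj3)
    refine hmono.trans ?_
    rw [integral_const_mul, integral_add (hI1 j) (hI2 j hj1), integral_const_mul,
      integral_indicator measurableSet_Icc, integral_indicator measurableSet_Ioi]
    gcongr ?_ * (?_ + ?_)
    · rw [setIntegral_const, Real.volume_real_Icc_of_le (by linarith), smul_eq_mul]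
      apply le_of_eq; ring
    · rcases hp with hp | hp
      · gcongr
        have hj1' : (1 : ℝ) ≤ j := by exact_mod_cast hj1
        rw [integral_Ioi_rpow_of_lt (by linarith) hlp, abs_of_neg hp]
        have e1 : -l ^ (p - j + 1) / (p - j + 1) = (-(p - j + 1))⁻¹ * l ^ (p - j + 1) := by
          rw [inv_neg]; ring
        rw [e1]
        have e2 : l ^ (p - j + 1) ≤ l ^ p :=
          Real.rpow_le_rpow_of_exponent_le (by linarith) (by linarith)
        have e3 : 1 ≤ η * η⁻¹ ^ j := by
          obtain ⟨k, rfl⟩ := Nat.exists_eq_add_of_le hj1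
          rw [pow_add, pow_one, ← mul_assoc, mul_inv_cancel₀ hη.ne', one_mul]
          exact one_le_pow₀ ((one_le_inv₀ hη).2 hη1)
        have e4 : (-(p - j + 1))⁻¹ ≤ (-p)⁻¹ := by
          apply inv_anti₀ (by linarith); linarith
        have e5 : 0 ≤ (-p)⁻¹ := inv_nonneg.2 (by linarith)
        have e6 : 0 ≤ l ^ p := by positivity
        calc _ ≤ (-p)⁻¹ * l ^ p := by gcongr
          _ = (-p)⁻¹ * (l ^ p * 1) := by rw [mul_one]
          _ ≤ _ := by gcongr
      · simp [hp]
  calc _ ≤ |θ|⁻¹ ^ j * (K * M * (3 * (l ^ p * (η * η⁻¹ ^ j)) +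
      ‖ζ 2‖ * (|p|⁻¹ * (l ^ p * (η * η⁻¹ ^ j))))) := by gcongr
    _ = _ := by ring

/-! ### Symbol bounds for the amplitudes -/

theorem IsSymbol.mul {P Q : ℂ → ℂ} {M N p q : ℝ} (hP : IsSymbol P M p) (hQ : IsSymbol Q N q) :
    IsSymbol (fun z => P z * Q z) (M * N) (p + q) where
  differentiableAt z hz := (hP.differentiableAt z hz).mul (hQ.differentiableAt z hz)
  norm_le t ht z hz := by
    have htp : 0 < t := by linarith
    have hM := hP.nonneg
    rw [norm_mul, Real.rpow_add htp]
    calc _ ≤ (M * t ^ p) * (N * t ^ q) := by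
          gcongr
          · exact hP.norm_le t ht z hz
          · exact hQ.norm_le t ht z hz
      _ = _ := by ring

theorem IsSymbol.mono {P : ℂ → ℂ} {M N p : ℝ} (hP : IsSymbol P M p) (h : M ≤ N) :
    IsSymbol P N p where
  differentiableAt := hP.differentiableAt
  norm_le t ht z hz := (hP.norm_le t ht z hz).trans (by gcongr)

/-- On $|z-t|\le t/4$ one has $|\mathrm{Im}\,z|\le\mathrm{Re}\,z$, hence $\mathrm{Re}\,z^2\ge0$. The
bound 1 does not depend on $c$, so the regularization costs nothing in later estimates. -/
theorem isSymbol_gaussian {c : ℝ} (hc : 0 ≤ c) :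
    IsSymbol (fun z => Complex.exp (-(c * z ^ 2))) 1 0 where
  differentiableAt z _ := by fun_prop
  norm_le t ht z hz := by
    rw [Real.rpow_zero, mul_one, Complex.norm_exp, Real.exp_le_one_iff]
    have h1 := re_ge_of_norm_sub_le hz
    have h2 : |z.im| ≤ t / 4 := by
      have := (Complex.abs_im_le_norm (z - t)).trans hz
      simpa using this
    have h3 : 0 ≤ (z ^ 2).re := by
      rw [pow_two, Complex.mul_re]
      nlinarith [abs_le.1 h2, sq_abs z.im, abs_nonneg z.im]
    rw [Complex.neg_re, Complex.re_ofReal_mul]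
    have := mul_nonneg hc h3
    linarith

theorem exists_isSymbol_hankelAmp {μ a : ℝ} (hμ : -1 < μ) (ha : 0 < a) :
    ∃ C : ℝ, 0 < C ∧ ∀ σ : ℝ, |σ| = 1 →
      IsSymbol (fun z => hankelAmp σ μ (a * z)) C (-μ - 1) := by
  obtain ⟨C, hC, h⟩ := exists_norm_hankelAmp_le hμ (show 0 < a / 2 by positivity)
  refine ⟨C * (a / 2) ^ (-μ - 1), by positivity, fun σ hσ => ⟨fun z hz => ?_, fun t ht z hz => ?_⟩⟩
  · have h1 : DifferentiableAt ℂ (hankelAmp σ μ) (a * z) :=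
      differentiableAt_hankelAmp hσ hμ (by simpa using mul_pos ha hz)
    exact DifferentiableAt.comp (g := hankelAmp σ μ) z h1 (by fun_prop)
  · have h1 := re_ge_of_norm_sub_le hz
    have h2 := h σ hσ (a / 2 * t) (a * z) (by nlinarith) (by
      rw [Complex.re_ofReal_mul]; nlinarith)
    rwa [Real.mul_rpow (by positivity) (by linarith), ← mul_assoc] at h2

/-- The discs have radius $t/2$ rather than $t/4$, to leave room for the Cauchy estimate of the
derivative on $|z-t|\le t/4$. -/
theorem exists_norm_ballAmp_le (n : ℕ) {ω₀ : ℝ} (hω₀ : 0 < ω₀) :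
    ∃ C : ℝ, 0 < C ∧ ∀ σ : ℝ, |σ| = 1 → ∀ ω : ℝ, ω₀ ≤ ω → ∀ t : ℝ, 1 ≤ t → ∀ z : ℂ,
      ‖z - t‖ ≤ t / 2 → ‖ballAmp n σ ω z‖ ≤ C * t ^ ((n : ℝ) / 2) * ω ^ (-((n : ℝ) / 2) - 1) := by
  obtain ⟨C, hC, h⟩ := exists_norm_hankelAmp_le (neg_one_lt_half n) (show 0 < ω₀ / 2 by positivity)
  have hm := ballMass_pos n (γ := 0) (by norm_num)
  refine ⟨ballMass n 0 * (3 / 2) ^ (n + 1) * (C * (1 / 2) ^ (-((n : ℝ) / 2) - 1)), by positivity,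
    fun σ hσ ω hω t ht z hz => ?_⟩
  have htp : 0 < t := by linarith
  have hωp : 0 < ω := by linarith
  have h1 := re_ge_of_norm_sub_le hz
  have h2 := h σ hσ (1 / 2 * (ω * t)) (ω * z) (by nlinarith) (by
      rw [Complex.re_ofReal_mul]; nlinarith)
  have h3 : ‖z‖ ≤ 3 / 2 * t := by
    calc ‖z‖ = ‖(z - t) + t‖ := by rw [sub_add_cancel]
      _ ≤ ‖z - t‖ + ‖(t : ℂ)‖ := norm_add_le _ _
      _ ≤ t / 2 + t := by
        gcongr; rw [Complex.norm_real, Real.norm_of_nonneg htp.le]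
      _ = _ := by ring
  rw [Real.mul_rpow (by positivity) (by positivity), Real.mul_rpow (by positivity) (by positivity)] at h2
  unfold ballAmp
  rw [norm_mul, norm_mul, norm_pow, Complex.norm_real, Real.norm_of_nonneg hm.le]
  have h4 : t ^ ((n : ℝ) / 2) = t ^ (n + 1) * t ^ (-((n : ℝ) / 2) - 1) := by
    rw [← Real.rpow_natCast, ← Real.rpow_add htp]; congr 1; push_cast; ring
  rw [h4]
  calc _ ≤ ballMass n 0 * (3 / 2 * t) ^ (n + 1) * (C * ((1 / 2) ^ (-((n : ℝ) / 2) - 1) *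
        (ω ^ (-((n : ℝ) / 2) - 1) * t ^ (-((n : ℝ) / 2) - 1)))) := by gcongr
    _ = _ := by rw [mul_pow]; ring

theorem exists_norm_deriv_ballAmp_le (n : ℕ) {ω₀ : ℝ} (hω₀ : 0 < ω₀) :
    ∃ C : ℝ, 0 < C ∧ ∀ σ : ℝ, |σ| = 1 → ∀ ω : ℝ, ω₀ ≤ ω → ∀ t : ℝ, 1 ≤ t → ∀ z : ℂ,
      ‖z - t‖ ≤ t / 4 →
        ‖deriv (ballAmp n σ ω) z‖ ≤ C * t ^ ((n : ℝ) / 2 - 1) * ω ^ (-((n : ℝ) / 2) - 1) := by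
  obtain ⟨C, hC, h⟩ := exists_norm_ballAmp_le n hω₀
  refine ⟨4 * C, by positivity, fun σ hσ ω hω t ht z hz => ?_⟩
  have htp : 0 < t := by linarith
  have hωp : 0 < ω := by linarith
  have hsub : ∀ y : ℂ, ‖y - z‖ ≤ t / 4 → ‖y - t‖ ≤ t / 2 := fun y hy => by
    calc ‖y - t‖ = ‖(y - z) + (z - t)‖ := by rw [sub_add_sub_cancel]
      _ ≤ t / 4 + t / 4 := (norm_add_le _ _).trans (add_le_add hy hz)
      _ = _ := by ring
  have hd : DifferentiableOn ℂ (ballAmp n σ ω) (Metric.closedBall z (t / 4)) := fun y hy =>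
    (differentiableAt_ballAmp n hσ hωp (by
      have := re_ge_of_norm_sub_le (hsub y (mem_closedBall_iff_norm.1 hy))
      linarith)).differentiableWithinAt
  have := Complex.norm_deriv_le_of_forall_mem_sphere_norm_le (c := z) (R := t / 4) (by positivity)
    (hd.diffContOnCl_ball subset_rfl)
    (fun y hy => h σ hσ ω hω t ht y (hsub y (mem_sphere_iff_norm.1 hy).le))
  refine this.trans (le_of_eq ?_)
  rw [Real.rpow_sub_one htp.ne']
  field_simp

/-- The phase derivative restores one factor $\omega$ lost in `ballAmp`; the derivative term is of
lower order in $t$, and its missing $\omega$ is paid for by $\omega^{-1}\le\omega_0^{-1}$. -/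
theorem exists_isSymbol_waveAmp (n : ℕ) {ω₀ : ℝ} (hω₀ : 0 < ω₀) :
    ∃ C : ℝ, 0 < C ∧ ∀ σ : ℝ, |σ| = 1 → ∀ ω : ℝ, ω₀ ≤ ω →
      IsSymbol (waveAmp n σ ω) (C * ω ^ (-((n : ℝ) / 2))) ((n : ℝ) / 2) := by
  obtain ⟨C, hC, h⟩ := exists_norm_ballAmp_le n hω₀
  obtain ⟨C', hC', h'⟩ := exists_norm_deriv_ballAmp_le n hω₀
  refine ⟨2 * Real.pi * C + C' * ω₀⁻¹, by positivity, fun σ hσ ω hω => ?_⟩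
  have hωp : 0 < ω := by linarith
  refine ⟨fun z hz => differentiableAt_waveAmp n hσ hωp hz, fun t ht z hz => ?_⟩
  have htp : 0 < t := by linarith
  have h1 := h σ hσ ω hω t ht z (hz.trans (by linarith))
  have h2 := h' σ hσ ω hω t ht z hz
  have h3 : ‖2 * (Real.pi : ℂ) * Complex.I * (σ * ω)‖ = 2 * Real.pi * ω := by
    simp [abs_of_pos Real.pi_pos, hσ, abs_of_pos hωp]
  have h4 : t ^ ((n : ℝ) / 2 - 1) ≤ t ^ ((n : ℝ) / 2) :=
    Real.rpow_le_rpow_of_exponent_le ht (by linarith)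
  have h5 : ω ^ (-((n : ℝ) / 2) - 1) = ω ^ (-((n : ℝ) / 2)) * ω⁻¹ := by
    rw [Real.rpow_sub_one hωp.ne', div_eq_mul_inv]
  have h6 : ω⁻¹ ≤ ω₀⁻¹ := inv_anti₀ hω₀ hω
  unfold waveAmp
  refine (norm_add_le _ _).trans ?_
  rw [norm_mul, h3]
  rw [h5] at h1 h2
  calc _ ≤ 2 * Real.pi * ω * (C * t ^ ((n : ℝ) / 2) * (ω ^ (-((n : ℝ) / 2)) * ω⁻¹)) +
        C' * t ^ ((n : ℝ) / 2) * (ω ^ (-((n : ℝ) / 2)) * ω₀⁻¹) := by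
        gcongr
        exact h2.trans (by gcongr)
    _ = _ := by field_simp

/-- The amplitude of the product of the Fourier transform of `bigU` and of `sphereWave`, with
Gaussian regularization. -/
def prodAmp (n : ℕ) (β a c σ τ ω : ℝ) (z : ℂ) : ℂ :=
  Complex.exp (-(c * z ^ 2)) * (hankelAmp σ (β + (n : ℝ) / 2) (a * z) * waveAmp n τ ω z)

theorem neg_one_lt_add_half {β : ℝ} (hβ : -1 < β) (n : ℕ) : -1 < β + (n : ℝ) / 2 := by
  have : (0 : ℝ) ≤ n := n.cast_nonneg
  linarith

/-- The orders $0$, $-(\beta+n/2)-1$ and $n/2$ add up to $-1-\beta$: the dimension cancels. The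
bound is uniform in $c\ge0$ and keeps the decay $\omega^{-n/2}$. -/
theorem exists_isSymbol_prodAmp (n : ℕ) {β a ω₀ : ℝ} (hβ : -1 < β) (ha : 0 < a) (hω₀ : 0 < ω₀) :
    ∃ C : ℝ, 0 < C ∧ ∀ c σ τ : ℝ, 0 ≤ c → |σ| = 1 → |τ| = 1 → ∀ ω : ℝ, ω₀ ≤ ω →
      IsSymbol (prodAmp n β a c σ τ ω) (C * ω ^ (-((n : ℝ) / 2))) (-1 - β) := by
  obtain ⟨C, hC, h⟩ := exists_isSymbol_hankelAmp (neg_one_lt_add_half hβ n) ha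
  obtain ⟨C', hC', h'⟩ := exists_isSymbol_waveAmp n hω₀
  refine ⟨C * C', by positivity, fun c σ τ hc hσ hτ ω hω => ?_⟩
  have := (isSymbol_gaussian hc).mul ((h σ hσ).mul (h' τ hτ ω hω))
  convert! this using 1
  · ring
  · ring

/-- The Fourier transform of `bigU` as a function of the radius. -/
def radialFT (n : ℕ) (β a t : ℝ) : ℂ :=
  ((ballMass n β * a ^ (2 * (β + (n : ℝ) / 2) + 1) : ℝ) : ℂ) *
    besselInt (β + (n : ℝ) / 2) (a * t)

theorem radialFT_eq_hankelAmp (n : ℕ) {β a t : ℝ} (hβ : -1 < β) (ha : 0 < a) (ht : 0 < t) :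
    radialFT n β a t = ((ballMass n β * a ^ (2 * (β + (n : ℝ) / 2) + 1) : ℝ) : ℂ) *
      (ephase (a * t) * hankelAmp 1 (β + (n : ℝ) / 2) (a * t) +
        ephase (-(a * t)) * hankelAmp (-1) (β + (n : ℝ) / 2) (a * t)) := by
  rw [radialFT, besselInt_eq_hankelAmp (neg_one_lt_add_half hβ n) (mul_pos ha ht)]
  push_cast; rfl

theorem exists_norm_radialFT_le (n : ℕ) {β a : ℝ} (hβ : -1 < β) (ha : 0 < a) :
    ∃ C : ℝ, 0 < C ∧ ∀ t : ℝ, 1 ≤ t → ‖radialFT n β a t‖ ≤ C * t ^ (-(β + (n : ℝ) / 2) - 1) := by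
  obtain ⟨C, hC, h⟩ := exists_isSymbol_hankelAmp (neg_one_lt_add_half hβ n) ha
  have hm := ballMass_pos n hβ
  refine ⟨ballMass n β * a ^ (2 * (β + (n : ℝ) / 2) + 1) * (C + C), by positivity, fun t ht => ?_⟩
  rw [radialFT_eq_hankelAmp n hβ ha (by linarith), norm_mul, Complex.norm_real,
    Real.norm_of_nonneg (by positivity), mul_assoc (ballMass n β * _)]
  refine mul_le_mul_of_nonneg_left ((norm_add_le _ _).trans ?_) (by positivity)
  rw [norm_mul, norm_mul, norm_ephase, norm_ephase, one_mul, one_mul, add_mul]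
  exact add_le_add ((h 1 (by simp)).norm_ofReal_le ht) ((h (-1) (by simp)).norm_ofReal_le ht)

open FourierTransform in
theorem fourier_bigU_eq_radialFT {n : ℕ} {β a : ℝ} (hβ : -1 < β) (ha : 0 < a) (ξ : EucSucc n) :
    𝓕 (fun x : EucSucc n => (bigU β a x : ℂ)) ξ = radialFT n β a ‖ξ‖ :=
  fourier_bigU hβ ha ξ

open FourierTransform in
theorem continuous_radialFT_norm {n : ℕ} {β a : ℝ} (hβ : -1 < β) (ha : 0 < a) :
    Continuous fun ξ : EucSucc n => radialFT n β a ‖ξ‖ := by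
  have h := VectorFourier.fourierIntegral_continuous Real.continuous_fourierChar
    (L := innerₗ (EucSucc n)) continuous_inner
    ((integrable_bigU (d := n + 1) hβ ha).ofReal (𝕜 := ℂ))
  have h2 : (fun ξ : EucSucc n => radialFT n β a ‖ξ‖) =
      𝓕 (fun x : EucSucc n => (bigU β a x : ℂ)) :=
    funext fun ξ => (fourier_bigU_eq_radialFT hβ ha ξ).symm
  rw [h2]
  exact h

/-- The phases in the product of the Fourier transform of `bigU` and of `sphereWave`. -/
theorem gaussian_mul_radialFT_mul_sphereWave {n : ℕ} {β a c : ℝ} (hβ : -1 < β) (ha : 0 < a)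
    {w : EucSucc n} (hw : w ≠ 0) {t : ℝ} (ht : 0 < t) :
    Complex.exp (-(c * (t : ℂ) ^ 2)) * radialFT n β a t * sphereWave w t =
      ((ballMass n β * a ^ (2 * (β + (n : ℝ) / 2) + 1) : ℝ) : ℂ) *
        (ephase ((a + ‖w‖) * t) * prodAmp n β a c 1 1 ‖w‖ t +
          ephase ((a - ‖w‖) * t) * prodAmp n β a c 1 (-1) ‖w‖ t +
          ephase ((-a + ‖w‖) * t) * prodAmp n β a c (-1) 1 ‖w‖ t +
          ephase ((-a - ‖w‖) * t) * prodAmp n β a c (-1) (-1) ‖w‖ t) := by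
  rw [radialFT_eq_hankelAmp n hβ ha ht, sphereWave_eq_waveAmp hw ht]
  simp only [prodAmp, sub_eq_add_neg, add_mul, ephase_add, neg_mul]
  ring

/-! ### Fourier inversion with a Gaussian factor -/

open scoped RealInnerProductSpace FourierTransform

/-- Fourier inversion with Gaussian regularization, at a point of continuity. -/
theorem tendsto_integral_gaussian_mul_fourier {V : Type*} [NormedAddCommGroup V]
    [InnerProductSpace ℝ V] [FiniteDimensional ℝ V] [MeasurableSpace V] [BorelSpace V]
    {f : V → ℂ} (hf : Integrable f) {v : V} (hv : ContinuousAt f v) :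
    Tendsto (fun c : ℝ => ∫ ξ : V, Complex.exp (-(((c⁻¹ : ℝ) : ℂ) * (‖ξ‖ : ℂ) ^ 2)) * 𝓕 f ξ * ephase ⟪v, ξ⟫)
      atTop (𝓝 (f v)) := by
  refine (Real.tendsto_integral_gaussian_smul' hf hv).congr' ?_
  filter_upwards [Ioi_mem_atTop 0] with c (hc : 0 < c)
  have J : Integrable (fun w : V => Complex.exp (-((c⁻¹ : ℝ) : ℂ) * (‖w‖ : ℂ) ^ 2 +
      2 * Real.pi * Complex.I * (⟪v, w⟫ : ℝ))) := by
    have := GaussianFourier.integrable_cexp_neg_mul_sq_norm_add (V := V) (b := ((c⁻¹ : ℝ) : ℂ))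
      (by simpa using hc) (2 * Real.pi * Complex.I) v
    simpa using this
  -- Self-adjointness of the Fourier transform moves it between $f$ and the modulated Gaussian.
  have h1 : ∫ w : V, 𝓕 (fun w : V => Complex.exp (-((c⁻¹ : ℝ) : ℂ) * (‖w‖ : ℂ) ^ 2 +
      2 * Real.pi * Complex.I * (⟪v, w⟫ : ℝ))) w • f w =
      ∫ ξ : V, Complex.exp (-((c⁻¹ : ℝ) : ℂ) * (‖ξ‖ : ℂ) ^ 2 +
      2 * Real.pi * Complex.I * (⟪v, ξ⟫ : ℝ)) • 𝓕 f ξ := by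
    simpa using! (VectorFourier.integral_fourierIntegral_smul_eq_flip (L := innerₗ V)
      Real.continuous_fourierChar continuous_inner J hf)
  have h2 : ∫ ξ : V, Complex.exp (-(((c⁻¹ : ℝ) : ℂ) * (‖ξ‖ : ℂ) ^ 2)) * 𝓕 f ξ * ephase ⟪v, ξ⟫ =
      ∫ ξ : V, Complex.exp (-((c⁻¹ : ℝ) : ℂ) * (‖ξ‖ : ℂ) ^ 2 +
      2 * Real.pi * Complex.I * (⟪v, ξ⟫ : ℝ)) • 𝓕 f ξ := by
    congr 1; funext ξ
    rw [Complex.exp_add, smul_eq_mul, ephase, neg_mul]; ring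
  rw [h2, ← h1]
  congr with w
  have hinv : ((c⁻¹ : ℝ) : ℂ) = (c : ℂ)⁻¹ := Complex.ofReal_inv c
  rw [fourier_gaussian_innerProductSpace' (by simpa using hc), hinv, div_inv_eq_mul, div_inv_eq_mul]
  congr 3
  ring

theorem integral_add_four {μ : Measure ℝ} {f g h k : ℝ → ℂ} (hf : Integrable f μ)
    (hg : Integrable g μ) (hh : Integrable h μ) (hk : Integrable k μ) :
    ∫ t, (f t + g t + h t + k t) ∂μ =
      ∫ t, f t ∂μ + ∫ t, g t ∂μ + ∫ t, h t ∂μ + ∫ t, k t ∂μ := by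
  have h1 : ∫ t, (f t + g t) ∂μ = _ := integral_add hf hg
  have h2 : ∫ t, (f t + g t + h t) ∂μ = _ := integral_add (hf.add hg) hh
  have h3 : ∫ t, (f t + g t + h t + k t) ∂μ = _ := integral_add ((hf.add hg).add hh) hk
  rw [h3, h2, h1]

/-! ### Smooth frequency truncation and the high-frequency remainder -/

/-- The smooth step from `0` to `1` as a cutoff function. -/
def stepCut (u : ℝ) : ℂ := (Real.smoothTransition u : ℝ)

theorem isCutoff_stepCut : IsCutoff stepCut where
  contDiff := Complex.ofRealCLM.contDiff.comp Real.smoothTransition.contDiff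
  eq_zero u hu := by simp [stepCut, Real.smoothTransition.zero_of_nonpos (show u ≤ 0 by linarith)]
  eq_const u hu := by
    simp [stepCut, Real.smoothTransition.one_of_one_le (show 1 ≤ u by linarith),
      Real.smoothTransition.one_of_one_le (show (1 : ℝ) ≤ 2 by norm_num)]

theorem stepCut_eq_zero {u : ℝ} (hu : u ≤ 0) : stepCut u = 0 := by
  simp [stepCut, Real.smoothTransition.zero_of_nonpos hu]

theorem stepCut_eq_one {u : ℝ} (hu : 1 ≤ u) : stepCut u = 1 := by
  simp [stepCut, Real.smoothTransition.one_of_one_le hu]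

theorem norm_stepCut_le (u : ℝ) : ‖stepCut u‖ ≤ 1 := by
  rw [stepCut, Complex.norm_real, Real.norm_of_nonneg (Real.smoothTransition.nonneg u)]
  exact Real.smoothTransition.le_one u

theorem norm_one_sub_stepCut_le (u : ℝ) : ‖1 - stepCut u‖ ≤ 1 := by
  rw [stepCut, ← Complex.ofReal_one, ← Complex.ofReal_sub, Complex.norm_real, Real.norm_of_nonneg]
  · linarith [Real.smoothTransition.nonneg u]
  · linarith [Real.smoothTransition.le_one u]

theorem continuous_stepCut : Continuous stepCut := isCutoff_stepCut.contDiff.continuous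

/-- The multiplier `1` on `|ξ| ≤ l`, `0` on `|ξ| ≥ l + η`, applied to the Fourier transform of
`bigU`. -/
def smoothedFT (n : ℕ) (β a l η : ℝ) (ξ : EucSucc n) : ℂ :=
  (1 - stepCut (η⁻¹ * (‖ξ‖ - l))) * radialFT n β a ‖ξ‖

/-- The inverse Fourier transform of `smoothedFT`. -/
def smoothed (n : ℕ) (β a l η : ℝ) (w : EucSucc n) : ℂ :=
  ∫ ξ : EucSucc n, smoothedFT n β a l η ξ * ephase ⟪w, ξ⟫

theorem continuous_smoothedFT {n : ℕ} {β a : ℝ} (hβ : -1 < β) (ha : 0 < a) (l η : ℝ) :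
    Continuous (smoothedFT n β a l η) :=
  (continuous_const.sub (continuous_stepCut.comp (by fun_prop))).mul
    (continuous_radialFT_norm hβ ha)

theorem smoothedFT_eq_zero {n : ℕ} {β a l η : ℝ} (hη : 0 < η) {ξ : EucSucc n}
    (h : l + η ≤ ‖ξ‖) : smoothedFT n β a l η ξ = 0 := by
  rw [smoothedFT, stepCut_eq_one, sub_self, zero_mul]
  rw [le_inv_mul_iff₀ hη]; linarith

theorem integrable_smoothedFT {n : ℕ} {β a l η : ℝ} (hβ : -1 < β) (ha : 0 < a) (hη : 0 < η) :
    Integrable (smoothedFT n β a l η) := by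
  refine (continuous_smoothedFT hβ ha l η).integrable_of_hasCompactSupport ?_
  refine HasCompactSupport.intro (isCompact_closedBall 0 (l + η)) fun ξ hξ => ?_
  refine smoothedFT_eq_zero hη ?_
  simp only [mem_closedBall_zero_iff, not_le] at hξ
  exact hξ.le

theorem norm_radialFT_le_integral {n : ℕ} {β a : ℝ} (hβ : -1 < β) (ha : 0 < a) (ξ : EucSucc n) :
    ‖radialFT n β a ‖ξ‖‖ ≤ ∫ x : EucSucc n, ‖(bigU β a x : ℂ)‖ := by
  rw [← fourier_bigU_eq_radialFT hβ ha]
  exact VectorFourier.norm_fourierIntegral_le_integral_norm _ _ _ _ _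

theorem integrable_gaussian_mul_radialFT {n : ℕ} {β a c : ℝ} (hβ : -1 < β) (ha : 0 < a)
    (hc : 0 < c) :
    Integrable fun ξ : EucSucc n => Complex.exp (-((c : ℂ) * (‖ξ‖ : ℂ) ^ 2)) * radialFT n β a ‖ξ‖ := by
  refine Integrable.mul_bdd ?_ (continuous_radialFT_norm hβ ha).aestronglyMeasurable
    (Eventually.of_forall fun ξ => norm_radialFT_le_integral hβ ha ξ)
  have := GaussianFourier.integrable_cexp_neg_mul_sq_norm_add (V := EucSucc n) (b := (c : ℂ))
      (by simpa using hc) 0 0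
  simpa using this

/-- The high frequency part of `bigU` as a regularized one-dimensional integral. -/
theorem tendsto_highFrequency {n : ℕ} {β a l η : ℝ} (hβ : -1 < β) (ha : 0 < a) (hη : 0 < η)
    {w : EucSucc n} (hc : ContinuousAt (fun x : EucSucc n => (bigU β a x : ℂ)) w) :
    Tendsto (fun c : ℝ => ∫ t in Set.Ioi (0 : ℝ), stepCut (η⁻¹ * (t - l)) *
      (Complex.exp (-(((c⁻¹ : ℝ) : ℂ) * (t : ℂ) ^ 2)) * radialFT n β a t * sphereWave w t))
      atTop (𝓝 (bigU β a w - smoothed n β a l η w)) := by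
  have hU : Integrable fun x : EucSucc n => (bigU β a x : ℂ) :=
    (integrable_bigU (d := n + 1) hβ ha).ofReal
  have h1 := tendsto_integral_gaussian_mul_fourier hU hc
  have hsm : Integrable fun ξ : EucSucc n => smoothedFT n β a l η ξ * ephase ⟪w, ξ⟫ :=
    (integrable_smoothedFT hβ ha hη).mul_bdd (c := 1)
      (continuous_ephase.comp (by fun_prop)).aestronglyMeasurable
      (Eventually.of_forall fun x => (norm_ephase _).le)
  -- The truncated transform is integrable, so here the Gaussian factor disappears in the limit
  -- without any continuity of `bigU`; subtracting leaves the multiplier `stepCut`.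
  have h2 := Real.tendsto_integral_cexp_sq_smul hsm
  refine (h1.sub h2).congr' ?_
  filter_upwards [Ioi_mem_atTop 0] with c (hc : 0 < c)
  have hc' : 0 < c⁻¹ := inv_pos.2 hc
  have hg := integrable_gaussian_mul_radialFT (n := n) hβ ha hc'
  have hstep : Integrable fun ξ : EucSucc n => stepCut (η⁻¹ * (‖ξ‖ - l)) *
      (Complex.exp (-(((c⁻¹ : ℝ) : ℂ) * (‖ξ‖ : ℂ) ^ 2)) * radialFT n β a ‖ξ‖) :=
    hg.bdd_mul (c := 1) (continuous_stepCut.comp (by fun_prop)).aestronglyMeasurable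
      (Eventually.of_forall fun x => norm_stepCut_le _)
  have hpol := integral_radial_mul_ephase w (k := fun t : ℝ => stepCut (η⁻¹ * (t - l)) *
      (Complex.exp (-(((c⁻¹ : ℝ) : ℂ) * (t : ℂ) ^ 2)) * radialFT n β a t)) hstep
  have hr : ∫ t in Set.Ioi (0 : ℝ), stepCut (η⁻¹ * (t - l)) *
      (Complex.exp (-(((c⁻¹ : ℝ) : ℂ) * (t : ℂ) ^ 2)) * radialFT n β a t * sphereWave w t) =
      ∫ t in Set.Ioi (0 : ℝ), stepCut (η⁻¹ * (t - l)) *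
      (Complex.exp (-(((c⁻¹ : ℝ) : ℂ) * (t : ℂ) ^ 2)) * radialFT n β a t) * sphereWave w t := by
    congr 1; funext t; ring
  rw [hr, ← hpol, ← integral_sub]
  · congr 1; funext ξ
    rw [fourier_bigU_eq_radialFT hβ ha, smoothedFT, smul_eq_mul, neg_mul]
    ring
  · simp_rw [fourier_bigU_eq_radialFT hβ ha]
    exact hg.mul_bdd (c := 1)
      (continuous_ephase.comp (by fun_prop)).aestronglyMeasurable
      (Eventually.of_forall fun x => (norm_ephase _).le)
  · refine hsm.bdd_mul (c := 1) (by fun_prop) (Eventually.of_forall fun ξ => ?_)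
    rw [Complex.norm_exp, Real.exp_le_one_iff]
    have : 0 ≤ c⁻¹ * ‖ξ‖ ^ 2 := by positivity
    simpa [← Complex.ofReal_pow] using this

/-- The symbol bound $t^{-1-\beta}$ alone is not integrable at infinity when $\beta\le0$; the
Gaussian with $c>0$ supplies integrability. -/
theorem integrable_stepCut_mul_prodAmp {n : ℕ} {β a c σ τ ω l η : ℝ} (hβ : -1 < β) (ha : 0 < a)
    (hc : 0 < c) (hσ : |σ| = 1) (hτ : |τ| = 1) (hω : 0 < ω) (hl : 4 ≤ l) (hη : 0 < η) (hη1 : η ≤ 1) :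
    Integrable fun t : ℝ => stepCut (η⁻¹ * (t - l)) * prodAmp n β a c σ τ ω t := by
  obtain ⟨C, hC, h⟩ := exists_isSymbol_prodAmp n hβ ha hω
  obtain ⟨K, -, hK⟩ := isCutoff_stepCut.exists_iteratedDeriv_mul_le (-1 - β)
  have hcont := (hK _ _ (h c σ τ hc.le hσ hτ ω le_rfl) l η hl hη hη1).1.continuous
  have hg : Integrable fun t : ℝ => C * ω ^ (-((n : ℝ) / 2)) * Real.exp (-c * t ^ 2) :=
    (integrable_exp_neg_mul_sq hc).const_mul _
  refine hg.mono' hcont.aestronglyMeasurable (Eventually.of_forall fun t => ?_)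
  rcases le_or_gt t l with ht | ht
  · rw [stepCut_eq_zero (mul_nonpos_of_nonneg_of_nonpos (by positivity) (by linarith)), zero_mul,
      norm_zero]
    positivity
  · have h0 := (h 0 σ τ le_rfl hσ hτ ω le_rfl).norm_ofReal_le (t := t) (by linarith)
    have e1 : prodAmp n β a c σ τ ω t = Complex.exp (-(c * (t : ℂ) ^ 2)) * prodAmp n β a 0 σ τ ω t := by
      simp [prodAmp]
    have e2 : ‖Complex.exp (-(c * (t : ℂ) ^ 2))‖ = Real.exp (-c * t ^ 2) := by
      rw [Complex.norm_exp]; congr 1; simp [← Complex.ofReal_pow]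
    have e3 : t ^ (-1 - β) ≤ 1 := Real.rpow_le_one_of_one_le_of_nonpos (by linarith) (by linarith)
    rw [norm_mul, e1, norm_mul, e2]
    calc _ ≤ 1 * (Real.exp (-c * t ^ 2) * (C * ω ^ (-((n : ℝ) / 2)) * 1)) := by
          gcongr
          · exact norm_stepCut_le _
          · exact h0.trans (by gcongr)
      _ = _ := by ring

/-- Off the sphere `|w| = a` the high frequency part is small, with decay in `w`. -/
theorem exists_norm_bigU_sub_smoothed_le (n : ℕ) {β a ρ : ℝ} (hβ : -1 < β) (ha : 0 < a)
    (hρ : a < ρ) :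
    ∃ K : ℝ, 0 < K ∧ ∀ w : EucSucc n, ρ ≤ ‖w‖ → ∀ l η : ℝ, 4 ≤ l → 0 < η → η ≤ 1 →
      ∀ j : ℕ, 1 ≤ j → j ≤ 3 →
      ‖smoothed n β a l η w‖ ≤
        K * l ^ (-1 - β) * (η * η⁻¹ ^ j) * (‖w‖ ^ (-((n : ℝ) / 2)) * ‖w‖⁻¹ ^ j) := by
  have hρ0 : 0 < ρ := by linarith
  obtain ⟨C, hC, hsym⟩ := exists_isSymbol_prodAmp n hβ ha hρ0
  obtain ⟨K, hK, hosc⟩ := isCutoff_stepCut.exists_norm_integral_le (p := -1 - β) (Or.inl (by linarith))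
  set κ := ballMass n β * a ^ (2 * (β + (n : ℝ) / 2) + 1) with hκ
  have hκ0 : 0 < κ := by have := ballMass_pos n hβ; positivity
  -- With this $q$ all four frequencies $\pm a\pm\|w\|$ have modulus at least $q\|w\|$ when
  -- $\|w\|\ge\rho>a$, so each integration by parts gains $\|w\|^{-1}$.
  set q := 1 - a / ρ with hq
  have hq0 : 0 < q := by rw [hq, sub_pos, div_lt_one hρ0]; exact hρ
  have hq1 : q ≤ 1 := by rw [hq]; have : 0 < a / ρ := by positivity
                         linarith
  refine ⟨κ * (4 * (K * C * q⁻¹ ^ 3)), by positivity, fun w hw l η hl hη hη1 j hj1 hj3 => ?_⟩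
  have hω0 : 0 < ‖w‖ := by linarith
  have hw0 : w ≠ 0 := norm_pos_iff.1 hω0
  have hlp : 0 < l := by linarith
  have hUzero : bigU β a w = 0 := by rw [bigU, if_neg (by linarith)]
  have hUc : ContinuousAt (fun x : EucSucc n => (bigU β a x : ℂ)) w := by
    have : (fun x : EucSucc n => (bigU β a x : ℂ)) =ᶠ[𝓝 w] fun _ => 0 := by
      filter_upwards [(continuous_norm.tendsto w).eventually (lt_mem_nhds (show a < ‖w‖ by linarith))]
        with x hx
      rw [bigU, if_neg (by linarith)]; simp
    exact continuousAt_const.congr this.symm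
  have hlim := tendsto_highFrequency (l := l) hβ ha hη hUc
  rw [hUzero, Complex.ofReal_zero, zero_sub] at hlim
  rw [← norm_neg]
  refine le_of_tendsto hlim.norm ?_
  filter_upwards [Ioi_mem_atTop 0] with c (hc : 0 < c)
  have hc' : 0 < c⁻¹ := inv_pos.2 hc
  set F : ℝ → ℝ → ℝ → ℝ → ℂ := fun θ σ τ t => ephase (θ * t) *
    (stepCut (η⁻¹ * (t - l)) * prodAmp n β a c⁻¹ σ τ ‖w‖ t) with hF
  have hsplit : ∀ t ∈ Set.Ioi (0 : ℝ), stepCut (η⁻¹ * (t - l)) *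
      (Complex.exp (-(((c⁻¹ : ℝ) : ℂ) * (t : ℂ) ^ 2)) * radialFT n β a t * sphereWave w t) =
      (κ : ℂ) * (F (a + ‖w‖) 1 1 t + F (a - ‖w‖) 1 (-1) t + F (-a + ‖w‖) (-1) 1 t +
        F (-a - ‖w‖) (-1) (-1) t) := by
    intro t ht
    rw [gaussian_mul_radialFT_mul_sphereWave hβ ha hw0 ht]
    simp only [hF]; ring
  have hFint : ∀ θ σ τ : ℝ, |σ| = 1 → |τ| = 1 → Integrable (F θ σ τ) := fun θ σ τ hσ hτ =>
    (integrable_stepCut_mul_prodAmp hβ ha hc' hσ hτ hω0 hl hη hη1).bdd_mul (c := 1)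
      (continuous_ephase.comp (by fun_prop)).aestronglyMeasurable
      (Eventually.of_forall fun x => (norm_ephase _).le)
  have hFzero : ∀ θ σ τ : ℝ, ∀ t ∉ Set.Ioi (0 : ℝ), F θ σ τ t = 0 := by
    intro θ σ τ t ht
    have ht' : t ≤ 0 := not_lt.1 ht
    simp only [hF]
    rw [stepCut_eq_zero (mul_nonpos_of_nonneg_of_nonpos (by positivity) (by linarith))]; ring
  have hFb : ∀ θ σ τ : ℝ, |σ| = 1 → |τ| = 1 → q * ‖w‖ ≤ |θ| →
      ‖∫ t in Set.Ioi (0 : ℝ), F θ σ τ t‖ ≤ K * C * q⁻¹ ^ 3 *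
        (l ^ (-1 - β) * (η * η⁻¹ ^ j) * (‖w‖ ^ (-((n : ℝ) / 2)) * ‖w‖⁻¹ ^ j)) := by
    intro θ σ τ hσ hτ hθ
    have hqw : 0 < q * ‖w‖ := by positivity
    have hθ0 : 0 < |θ| := by linarith
    rw [setIntegral_eq_integral_of_forall_compl_eq_zero (hFzero θ σ τ)]
    have h1 := hosc _ _ (hsym c⁻¹ σ τ hc'.le hσ hτ ‖w‖ hw) l η hl hη hη1
      (integrable_stepCut_mul_prodAmp hβ ha hc' hσ hτ hω0 hl hη hη1) j hj1 hj3 θ (abs_pos.1 hθ0)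
    refine h1.trans ?_
    have h2 : |θ|⁻¹ ≤ q⁻¹ * ‖w‖⁻¹ := by rw [← mul_inv]; exact inv_anti₀ hqw hθ
    have h3 : q⁻¹ ^ j ≤ q⁻¹ ^ 3 := pow_le_pow_right₀ ((one_le_inv₀ hq0).2 hq1) hj3
    have h4 : |θ|⁻¹ ^ j ≤ q⁻¹ ^ 3 * ‖w‖⁻¹ ^ j := by
      calc |θ|⁻¹ ^ j ≤ (q⁻¹ * ‖w‖⁻¹) ^ j := by gcongr
        _ = q⁻¹ ^ j * ‖w‖⁻¹ ^ j := mul_pow _ _ _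
        _ ≤ _ := by gcongr
    calc _ ≤ K * (C * ‖w‖ ^ (-((n : ℝ) / 2))) * l ^ (-1 - β) * (η * η⁻¹ ^ j) *
          (q⁻¹ ^ 3 * ‖w‖⁻¹ ^ j) := by gcongr
      _ = _ := by ring
  rw [setIntegral_congr_fun measurableSet_Ioi hsplit, integral_const_mul, norm_mul,
    Complex.norm_real, Real.norm_of_nonneg hκ0.le]
  have hi : ∀ θ σ τ : ℝ, |σ| = 1 → |τ| = 1 → IntegrableOn (F θ σ τ) (Set.Ioi 0) :=
    fun θ σ τ hσ hτ => (hFint θ σ τ hσ hτ).integrableOn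
  have o1 : |(1 : ℝ)| = 1 := abs_one
  have o2 : |(-1 : ℝ)| = 1 := by simp
  have hqa : q * ‖w‖ ≤ ‖w‖ - a := by
    have : a / ρ * ‖w‖ ≥ a := by
      rw [ge_iff_le, div_mul_eq_mul_div, le_div_iff₀ hρ0]; nlinarith
    rw [hq]; linarith
  rw [integral_add_four (hi _ _ _ o1 o1) (hi _ _ _ o1 o2) (hi _ _ _ o2 o1) (hi _ _ _ o2 o2)]
  have b1 := hFb (a + ‖w‖) 1 1 o1 o1 (by rw [abs_of_pos (by linarith)]; linarith)
  have b2 := hFb (a - ‖w‖) 1 (-1) o1 o2 (by rw [abs_of_neg (by linarith)]; linarith)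
  have b3 := hFb (-a + ‖w‖) (-1) 1 o2 o1 (by rw [abs_of_pos (by linarith)]; linarith)
  have b4 := hFb (-a - ‖w‖) (-1) (-1) o2 o2 (by rw [abs_of_neg (by linarith)]; linarith)
  calc _ ≤ κ * (4 * (K * C * q⁻¹ ^ 3 *
        (l ^ (-1 - β) * (η * η⁻¹ ^ j) * (‖w‖ ^ (-((n : ℝ) / 2)) * ‖w‖⁻¹ ^ j)))) := by
        gcongr
        refine (norm_add_le _ _).trans ((add_le_add ((norm_add_le _ _).trans (add_le_add
          ((norm_add_le _ _).trans (add_le_add b1 b2)) b3)) b4).trans (le_of_eq ?_))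
        ring
    _ = _ := by ring

/-! ### Lattice sums, characters and Poisson summation -/

theorem latticePoint_apply {d : ℕ} (m : Fin d → ℤ) (i : Fin d) : latticePoint m i = m i := rfl

theorem latticePoint_add {d : ℕ} (m k : Fin d → ℤ) :
    latticePoint (m + k) = latticePoint m + latticePoint k := by
  ext i; simp [latticePoint_apply]

theorem latticePoint_injective {d : ℕ} : Function.Injective (latticePoint (d := d)) := by
  intro m k h
  ext i
  have : latticePoint m i = latticePoint k i := by rw [h]
  rw [latticePoint_apply, latticePoint_apply] at this
  exact Int.cast_injective (α := ℝ) this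

theorem character_eq_ephase {d : ℕ} (m : Fin d → ℤ) (x : EuclideanSpace ℝ (Fin d)) :
    character m x = ephase ⟪x, latticePoint m⟫ := by
  rw [character, ephase, PiLp.inner_apply]
  simp only [RCLike.inner_apply, latticePoint_apply]
  simp

theorem norm_character {d : ℕ} (m : Fin d → ℤ) (x : EuclideanSpace ℝ (Fin d)) :
    ‖character m x‖ = 1 := by rw [character_eq_ephase, norm_ephase]

theorem continuous_character {d : ℕ} (m : Fin d → ℤ) : Continuous (character m) := by
  have : character m = fun x => ephase ⟪x, latticePoint m⟫ := by
    funext x; exact character_eq_ephase m x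
  rw [this]
  exact continuous_ephase.comp (by fun_prop)

theorem character_add_latticePoint {d : ℕ} (m k : Fin d → ℤ) (x : EuclideanSpace ℝ (Fin d)) :
    character m (x + latticePoint k) = character m x := by
  have h : (∑ i, (m i : ℝ) * (x + latticePoint k) i) =
      ∑ i, (m i : ℝ) * x i + ((∑ i, m i * k i : ℤ) : ℝ) := by
    simp [latticePoint_apply, mul_add, Finset.sum_add_distrib]
  rw [character, character, h, Complex.ofReal_add, mul_add, Complex.exp_add]
  have := Complex.exp_int_mul_two_pi_mul_I (∑ i, m i * k i : ℤ)
  rw [show 2 * (Real.pi : ℂ) * Complex.I * (((∑ i, m i * k i : ℤ) : ℝ) : ℂ) =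
    ((∑ i, m i * k i : ℤ) : ℂ) * (2 * Real.pi * Complex.I) by push_cast; ring, this, mul_one]

theorem mFourier_coe {d : ℕ} (m : Fin d → ℤ) (x : Fin d → ℝ) :
    UnitAddTorus.mFourier m (fun i => (x i : UnitAddCircle)) = character m (WithLp.toLp 2 x) := by
  rw [UnitAddTorus.mFourier, ContinuousMap.coe_mk, character, Complex.ofReal_sum, Finset.mul_sum,
    Complex.exp_sum]
  refine Finset.prod_congr rfl fun i _ => ?_
  rw [fourier_coe_apply]
  congr 1
  push_cast
  simp
  ring

theorem latticePoint_mem_span {d : ℕ} (k : Fin d → ℤ) : latticePoint k ∈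
    Submodule.span ℤ (Set.range (EuclideanSpace.basisFun (Fin d) ℝ).toBasis) := by
  have h : latticePoint k = ∑ i, k i • (EuclideanSpace.basisFun (Fin d) ℝ).toBasis i := by
    ext j
    simp [latticePoint_apply, Finset.sum_apply, Pi.single_apply]
  rw [h]
  exact Submodule.sum_mem _ fun i _ => Submodule.smul_mem _ _ (Submodule.subset_span ⟨i, rfl⟩)

theorem summable_norm_rpow_of_injective {E ι : Type*} [NormedAddCommGroup E] [NormedSpace ℝ E]
    [FiniteDimensional ℝ E] (L : Submodule ℤ E) [DiscreteTopology L] [IsZLattice ℝ L]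
    {u : ι → E} (hu : Function.Injective u) (hL : ∀ k, u k ∈ L) {p : ℝ}
    (hp : (Module.finrank ℝ E : ℝ) < p) : Summable fun k => ‖u k‖ ^ (-p) := by
  have h := ZLattice.summable_norm_rpow L (-p) (by rw [ZLattice.rank ℝ L]; linarith)
  exact h.comp_injective (i := fun k => (⟨u k, hL k⟩ : L)) fun k k' hk =>
    hu (congrArg Subtype.val hk)

theorem summable_norm_latticePoint_rpow (d : ℕ) {p : ℝ} (hp : (d : ℝ) < p) :
    Summable fun k : Fin d → ℤ => ‖latticePoint k‖ ^ (-p) :=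
  summable_norm_rpow_of_injective _ latticePoint_injective latticePoint_mem_span
    (by rwa [finrank_euclideanSpace_fin])

theorem summable_one_add_norm_latticePoint_rpow (d : ℕ) {p : ℝ} (hp : (d : ℝ) < p) :
    Summable fun k : Fin d → ℤ => (1 + ‖latticePoint k‖) ^ (-p) := by
  have hp0 : 0 < p := lt_of_le_of_lt (Nat.cast_nonneg d) hp
  refine Summable.of_norm_bounded_eventually (summable_norm_latticePoint_rpow d hp) ?_
  have : ({0}ᶜ : Set (Fin d → ℤ)) ∈ cofinite := (Set.finite_singleton 0).compl_mem_cofinite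
  filter_upwards [this] with k hk
  have hk0 : 0 < ‖latticePoint k‖ := by
    rw [norm_pos_iff]
    intro h0
    exact hk (latticePoint_injective (h0.trans (by ext i; simp [latticePoint_apply])))
  rw [Real.norm_of_nonneg (by positivity)]
  exact Real.rpow_le_rpow_of_nonpos hk0 (by linarith) (by linarith)

/-- Peetre's inequality: the decay of a lattice translate is uniform for $x$ in a bounded set. -/
theorem one_add_norm_add_rpow_le {V : Type*} [NormedAddCommGroup V] {p R : ℝ} (hp : 0 ≤ p)
    {x : V} (hx : ‖x‖ ≤ R) (y : V) :
    (1 + ‖x + y‖) ^ (-p) ≤ (1 + R) ^ p * (1 + ‖y‖) ^ (-p) := by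
  have hR : 0 ≤ R := (norm_nonneg x).trans hx
  have h1 : 1 + ‖y‖ ≤ (1 + R) * (1 + ‖x + y‖) := by
    have : ‖y‖ ≤ ‖x + y‖ + ‖x‖ := by
      calc ‖y‖ = ‖(x + y) - x‖ := by rw [add_sub_cancel_left]
        _ ≤ _ := norm_sub_le _ _
    nlinarith [norm_nonneg (x + y)]
  have h2 : (1 + ‖y‖) ^ p ≤ (1 + R) ^ p * (1 + ‖x + y‖) ^ p := by
    rw [← Real.mul_rpow (by positivity) (by positivity)]
    exact Real.rpow_le_rpow (by positivity) h1 hp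
  have h3 : 0 < (1 + ‖y‖) ^ p := by positivity
  have h4 : 0 < (1 + ‖x + y‖) ^ p := by positivity
  rw [Real.rpow_neg (by positivity), Real.rpow_neg (by positivity), ← div_eq_mul_inv, le_div_iff₀ h3,
    inv_mul_le_iff₀ h4]
  linarith

theorem summable_norm_periodization {d : ℕ} {f : EuclideanSpace ℝ (Fin d) → ℂ} {C p : ℝ}
    (hp : (d : ℝ) < p) (hf : ∀ w, ‖f w‖ ≤ C * (1 + ‖w‖) ^ (-p)) (x : EuclideanSpace ℝ (Fin d)) :
    Summable fun k => ‖f (x + latticePoint k)‖ := by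
  have hp0 : 0 ≤ p := (Nat.cast_nonneg d).trans hp.le
  have hC : 0 ≤ C := by
    have := (norm_nonneg _).trans (hf 0)
    simpa using this
  refine Summable.of_nonneg_of_le (fun _ => norm_nonneg _) (fun k => ?_)
    ((summable_one_add_norm_latticePoint_rpow d hp).mul_left (C * (1 + ‖x‖) ^ p))
  calc _ ≤ C * (1 + ‖x + latticePoint k‖) ^ (-p) := hf _
    _ ≤ C * ((1 + ‖x‖) ^ p * (1 + ‖latticePoint k‖) ^ (-p)) := by
        gcongr; exact one_add_norm_add_rpow_le hp0 le_rfl _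
    _ = _ := by ring

theorem continuous_periodization {d : ℕ} {f : EuclideanSpace ℝ (Fin d) → ℂ} {C p : ℝ}
    (hp : (d : ℝ) < p) (hfc : Continuous f) (hf : ∀ w, ‖f w‖ ≤ C * (1 + ‖w‖) ^ (-p)) :
    Continuous fun x => ∑' k, f (x + latticePoint k) := by
  have hp0 : 0 ≤ p := (Nat.cast_nonneg d).trans hp.le
  have hC : 0 ≤ C := by
    have := (norm_nonneg _).trans (hf 0)
    simpa using this
  rw [continuous_iff_continuousAt]
  intro x
  have hon : ContinuousOn (fun x => ∑' k, f (x + latticePoint k)) (Metric.ball 0 (‖x‖ + 1)) := by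
    refine continuousOn_tsum (u := fun k => C * (1 + (‖x‖ + 1)) ^ p * (1 + ‖latticePoint k‖) ^ (-p))
      (fun k => (hfc.comp (by fun_prop)).continuousOn)
      ((summable_one_add_norm_latticePoint_rpow d hp).mul_left _) fun k y hy => ?_
    calc _ ≤ C * (1 + ‖y + latticePoint k‖) ^ (-p) := hf _
      _ ≤ C * ((1 + (‖x‖ + 1)) ^ p * (1 + ‖latticePoint k‖) ^ (-p)) := by
          gcongr
          refine one_add_norm_add_rpow_le hp0 ?_ _
          exact (mem_ball_zero_iff.1 hy).le
      _ = _ := by ring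
  exact hon.continuousAt (Metric.isOpen_ball.mem_nhds (by simp))

/-- The half-open unit cube with lower corner `k - 1/2`. -/
def latticeCube {d : ℕ} (k : Fin d → ℤ) : Set (Fin d → ℝ) :=
  Set.pi Set.univ fun i => Set.Ioc ((k i : ℝ) - 1 / 2) (k i + 1 / 2)

theorem measurableSet_latticeCube {d : ℕ} (k : Fin d → ℤ) : MeasurableSet (latticeCube k) :=
  MeasurableSet.univ_pi fun _ => measurableSet_Ioc

theorem volume_latticeCube {d : ℕ} (k : Fin d → ℤ) : volume (latticeCube k) = 1 := by
  rw [latticeCube, Real.volume_pi_Ioc]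
  norm_num

theorem iUnion_latticeCube (d : ℕ) : ⋃ k : Fin d → ℤ, latticeCube k = Set.univ := by
  refine Set.eq_univ_of_forall fun x => Set.mem_iUnion.2 ⟨fun i => ⌈x i - 1 / 2⌉, fun i _ => ?_⟩
  have h1 := Int.le_ceil (x i - 1 / 2)
  have h2 := Int.ceil_lt_add_one (x i - 1 / 2)
  constructor <;> simp only <;> linarith

theorem pairwise_disjoint_latticeCube (d : ℕ) :
    Pairwise (Function.onFun Disjoint (latticeCube (d := d))) := by
  intro k k' hk
  rw [Function.onFun, Set.disjoint_left]
  intro x hx hx'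
  refine hk (funext fun i => ?_)
  obtain ⟨h1, h2⟩ := hx i (Set.mem_univ i)
  obtain ⟨h3, h4⟩ := hx' i (Set.mem_univ i)
  have a1 : (k i : ℝ) < k' i + 1 := by linarith
  have a2 : (k' i : ℝ) < k i + 1 := by linarith
  have b1 : k i < k' i + 1 := by exact_mod_cast a1
  have b2 : k' i < k i + 1 := by exact_mod_cast a2
  omega

theorem integral_eq_tsum_latticeCube {d : ℕ} {h : (Fin d → ℝ) → ℂ} (hh : Integrable h) :
    ∫ x, h x = ∑' k : Fin d → ℤ, ∫ x in latticeCube 0, h (x + fun i => (k i : ℝ)) := by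
  have h1 := hasSum_integral_iUnion (fun k => measurableSet_latticeCube k)
    (pairwise_disjoint_latticeCube d) hh.integrableOn
  rw [iUnion_latticeCube, Measure.restrict_univ] at h1
  rw [← h1.tsum_eq]
  refine tsum_congr fun k => ?_
  have hmp := measurePreserving_add_right (volume : Measure (Fin d → ℝ)) (fun i => (k i : ℝ))
  have := hmp.setIntegral_preimage_emb (MeasurableEquiv.addRight _).measurableEmbedding h
    (latticeCube k)
  rw [← this]
  congr 2
  ext x
  simp only [latticeCube, Set.mem_preimage, Set.mem_pi, Set.mem_univ, true_implies, Set.mem_Ioc,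
    Pi.add_apply, Pi.zero_apply, Int.cast_zero]
  refine forall_congr' fun i => ?_
  constructor <;> rintro ⟨u, v⟩ <;> constructor <;> linarith

/-- **Poisson summation** on `ℝ^d`, for a function with finitely many lattice values and whose
inverse Fourier transform decays. -/
theorem tsum_fourierInv_latticePoint {d : ℕ} {g : EuclideanSpace ℝ (Fin d) → ℂ} {C p : ℝ}
    (hgc : Continuous g) (hgi : Integrable g) (hp : (d : ℝ) < p)
    (hf : ∀ w, ‖𝓕⁻ g w‖ ≤ C * (1 + ‖w‖) ^ (-p))
    (hfin : {m : Fin d → ℤ | g (latticePoint m) ≠ 0}.Finite) (x : EuclideanSpace ℝ (Fin d)) :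
    ∑' k, 𝓕⁻ g (x + latticePoint k) = ∑ m ∈ hfin.toFinset, g (latticePoint m) * character m x := by
  set f := 𝓕⁻ g with hfdef
  have hp0 : 0 ≤ p := (Nat.cast_nonneg d).trans hp.le
  have hC : 0 ≤ C := by
    have := (norm_nonneg _).trans (hf 0)
    simpa using this
  have hfc : Continuous f := by
    have : f = fun w => 𝓕 g (-w) := by
      funext w; rw [hfdef, Real.fourierInv_eq_fourier_neg]
    rw [this]
    exact (VectorFourier.fourierIntegral_continuous Real.continuous_fourierChar
      (by exact continuous_inner) hgi).comp continuous_neg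
  have hfi : Integrable f := by
    have h1 : Integrable fun w : EuclideanSpace ℝ (Fin d) => C * (1 + ‖w‖) ^ (-p) :=
      (integrable_one_add_norm (by simpa using hp)).const_mul C
    exact h1.mono' hfc.aestronglyMeasurable (Eventually.of_forall hf)
  have hgF : Integrable (𝓕 g) := by
    have : 𝓕 g = fun w => f (-w) := by
      funext w; rw [hfdef, Real.fourierInv_eq_fourier_neg, neg_neg]
    rw [this]; exact hfi.comp_neg
  have hinv : 𝓕 f = g := hgc.fourier_fourierInv_eq hgi hgF
  let P : EuclideanSpace ℝ (Fin d) → ℂ := fun x => ∑' k, f (x + latticePoint k)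
  have hPc : Continuous P := continuous_periodization hp hfc hf
  have hPper : ∀ (y : EuclideanSpace ℝ (Fin d)) (k : Fin d → ℤ), P (y + latticePoint k) = P y := by
    intro y k
    change ∑' m, f (y + latticePoint k + latticePoint m) = ∑' m, f (y + latticePoint m)
    rw [← (Equiv.addLeft k).tsum_eq (fun m => f (y + latticePoint m))]
    refine tsum_congr fun m => ?_
    rw [Equiv.coe_addLeft, latticePoint_add, add_assoc]
  let proj : C(Fin d → ℝ, UnitAddTorus (Fin d)) :=
    ⟨Pi.map fun _ => ((↑) : ℝ → UnitAddCircle), by fun_prop⟩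
  have hq : IsOpenQuotientMap proj := IsOpenQuotientMap.piMap fun _ =>
    QuotientAddGroup.isOpenQuotientMap_mk
  let G : C(Fin d → ℝ, ℂ) := ⟨fun y => P (WithLp.toLp 2 y), hPc.comp (by fun_prop)⟩
  -- Points with the same projection differ by an integer vector, so the continuous periodic $P$
  -- descends to the torus as a continuous function.
  have hfact : Function.FactorsThrough G proj := by
    intro y z hyz
    have : ∀ i, ∃ n : ℤ, y i = z i + n := by
      intro i
      have h1 : ((y i : ℝ) : UnitAddCircle) = (z i : ℝ) := congrFun hyz i
      rw [← sub_eq_zero, ← AddCircle.coe_sub, AddCircle.coe_eq_zero_iff] at h1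
      obtain ⟨n, hn⟩ := h1
      exact ⟨n, by rw [zsmul_eq_mul, mul_one] at hn; linarith⟩
    choose k hk using this
    have e : WithLp.toLp 2 y = WithLp.toLp 2 z + latticePoint k := by
      ext i; simpa [latticePoint_apply] using hk i
    change P _ = P _
    rw [e, hPper]
  let Q : C(UnitAddTorus (Fin d), ℂ) := hq.isQuotientMap.lift G hfact
  have hQ : ∀ y : Fin d → ℝ, Q (fun i => (y i : UnitAddCircle)) = P (WithLp.toLp 2 y) := by
    intro y
    have := hq.isQuotientMap.lift_comp G hfact
    exact congrArg (fun h : C(Fin d → ℝ, ℂ) => h y) this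
  have hcoeff : ∀ m : Fin d → ℤ, UnitAddTorus.mFourierCoeff Q m = g (latticePoint m) := by
    intro m
    rw [UnitAddTorus.mFourierCoeff_eq_integral Q m (fun _ => -(1 / 2))]
    have hset : {x : Fin d → ℝ | ∀ i, x i ∈ Set.Ioc (-(1 / 2) : ℝ) (-(1 / 2) + 1)} =
        latticeCube 0 := by
      ext y
      simp only [latticeCube, Set.mem_pi, Set.mem_univ, true_implies, Pi.zero_apply, Int.cast_zero]
      norm_num
    rw [hset]
    let h : (Fin d → ℝ) → ℂ := fun y =>
      character (-m) (WithLp.toLp 2 y) * f (WithLp.toLp 2 y)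
    have hmp := PiLp.volume_preserving_toLp (Fin d)
    have hem := (MeasurableEquiv.toLp 2 (Fin d → ℝ)).measurableEmbedding
    have hhi : Integrable fun y : EuclideanSpace ℝ (Fin d) => character (-m) y * f y :=
      hfi.bdd_mul (c := 1) (continuous_character _).aestronglyMeasurable
        (Eventually.of_forall fun y => (norm_character _ _).le)
    have hhi' : Integrable h := (hmp.integrable_comp_emb hem).2 hhi
    have hshift : ∀ (y : Fin d → ℝ) (k : Fin d → ℤ), h (y + fun i => (k i : ℝ)) =
        character (-m) (WithLp.toLp 2 y) * f (WithLp.toLp 2 y + latticePoint k) := by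
      intro y k
      have : WithLp.toLp 2 (y + fun i => (k i : ℝ)) = WithLp.toLp 2 y + latticePoint k := rfl
      simp only [h]
      rw [this, character_add_latticePoint]
    have hvol : (volume.restrict (latticeCube (0 : Fin d → ℤ))) Set.univ = 1 := by
      rw [Measure.restrict_apply_univ, volume_latticeCube]
    have : IsFiniteMeasure (volume.restrict (latticeCube (0 : Fin d → ℤ))) :=
      ⟨by rw [hvol]; exact ENNReal.one_lt_top⟩
    have hbd : ∀ k : Fin d → ℤ, ∀ y ∈ latticeCube (0 : Fin d → ℤ),
        ‖h (y + fun i => (k i : ℝ))‖ ≤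
          C * (1 + Real.sqrt d) ^ p * (1 + ‖latticePoint k‖) ^ (-p) := by
      intro k y hy
      rw [hshift, norm_mul, norm_character, one_mul]
      have hy' : ‖WithLp.toLp 2 y‖ ≤ Real.sqrt d := by
        rw [EuclideanSpace.norm_eq]
        refine Real.sqrt_le_sqrt ?_
        calc ∑ i, ‖(WithLp.toLp 2 y) i‖ ^ 2 ≤ ∑ _i : Fin d, (1 : ℝ) := by
              refine Finset.sum_le_sum fun i _ => ?_
              obtain ⟨h1, h2⟩ := hy i (Set.mem_univ i)
              simp only [Pi.zero_apply, Int.cast_zero] at h1 h2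
              have : |y i| ≤ 1 := abs_le.2 ⟨by linarith, by linarith⟩
              simpa using this
          _ = d := by simp
      calc _ ≤ C * (1 + ‖WithLp.toLp 2 y + latticePoint k‖) ^ (-p) := hf _
        _ ≤ C * ((1 + Real.sqrt d) ^ p * (1 + ‖latticePoint k‖) ^ (-p)) := by
            gcongr; exact one_add_norm_add_rpow_le hp0 hy' _
        _ = _ := by ring
    have hint : ∀ k : Fin d → ℤ, Integrable (fun y => h (y + fun i => (k i : ℝ)))
        (volume.restrict (latticeCube 0)) := fun k => (hhi'.comp_add_right _).integrableOn
    have hsum : Summable fun k : Fin d → ℤ =>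
        ∫ y in latticeCube 0, ‖h (y + fun i => (k i : ℝ))‖ := by
      refine Summable.of_nonneg_of_le (fun k => integral_nonneg fun y => norm_nonneg _) (fun k => ?_)
        ((summable_one_add_norm_latticePoint_rpow d hp).mul_left (C * (1 + Real.sqrt d) ^ p))
      calc _ ≤ ∫ y in latticeCube (0 : Fin d → ℤ),
              C * (1 + Real.sqrt d) ^ p * (1 + ‖latticePoint k‖) ^ (-p) :=
            setIntegral_mono_on (hint k).norm (integrable_const _) (measurableSet_latticeCube 0)
              (hbd k)
        _ = _ := by simp [Measure.real, hvol]
    calc ∫ y in latticeCube (0 : Fin d → ℤ),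
          UnitAddTorus.mFourier (-m) (fun i => (y i : UnitAddCircle)) •
            Q (fun i => (y i : UnitAddCircle))
        = ∫ y in latticeCube (0 : Fin d → ℤ), ∑' k : Fin d → ℤ, h (y + fun i => (k i : ℝ)) := by
          congr 1; funext y
          rw [hQ, mFourier_coe, smul_eq_mul]
          simp_rw [hshift]
          rw [tsum_mul_left]
      _ = ∑' k : Fin d → ℤ, ∫ y in latticeCube (0 : Fin d → ℤ), h (y + fun i => (k i : ℝ)) :=
          (integral_tsum_of_summable_integral_norm hint hsum).symm
      _ = ∫ y, h y := (integral_eq_tsum_latticeCube hhi').symm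
      _ = ∫ y : EuclideanSpace ℝ (Fin d), character (-m) y * f y :=
          hmp.integral_comp hem (fun y => character (-m) y * f y)
      _ = 𝓕 f (latticePoint m) := by
          rw [Real.fourier_eq']
          congr 1; funext y
          rw [character, smul_eq_mul]
          congr 2
          rw [PiLp.inner_apply]
          simp only [RCLike.inner_apply, latticePoint_apply, Pi.neg_apply]
          push_cast
          simp only [neg_mul, mul_neg, Finset.sum_neg_distrib, Finset.mul_sum, Finset.sum_mul]
          congr 1
          refine Finset.sum_congr rfl fun i _ => ?_
          simp
          ring
      _ = g (latticePoint m) := by rw [hinv]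
  -- Unfolding has identified the Fourier coefficients of $Q$ with the lattice values of $g$. Only
  -- finitely many are nonzero, so the Fourier series represents $Q$ at every point.
  have hsummable : Summable (UnitAddTorus.mFourierCoeff Q) := by
    refine summable_of_hasFiniteSupport (hfin.subset ?_)
    intro m hm
    rw [Function.mem_support, hcoeff] at hm
    exact hm
  have h1 := UnitAddTorus.hasSum_mFourier_series_apply_of_summable hsummable
    (fun i => (x i : UnitAddCircle))
  have h2 : Q (fun i => (x i : UnitAddCircle)) = P x := hQ (WithLp.ofLp x)
  rw [h2] at h1
  rw [show ∑' k, f (x + latticePoint k) = P x from rfl, ← h1.tsum_eq]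
  have h3 : ∀ m, UnitAddTorus.mFourierCoeff Q m •
      UnitAddTorus.mFourier m (fun i => (x i : UnitAddCircle)) =
      g (latticePoint m) * character m x := by
    intro m
    rw [hcoeff, smul_eq_mul]
    congr 1
    exact mFourier_coe m (WithLp.ofLp x)
  simp_rw [h3]
  refine tsum_eq_sum fun m hm => ?_
  have : g (latticePoint m) = 0 := by
    by_contra h0
    exact hm (hfin.mem_toFinset.2 h0)
  rw [this, zero_mul]

theorem fourierInv_eq_integral_ephase {d : ℕ} (g : EuclideanSpace ℝ (Fin d) → ℂ)
    (w : EuclideanSpace ℝ (Fin d)) : 𝓕⁻ g w = ∫ ξ, g ξ * ephase ⟪w, ξ⟫ := by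
  rw [Real.fourierInv_eq']
  congr 1; funext ξ
  rw [smul_eq_mul, mul_comm, ephase, real_inner_comm]
  congr 2
  push_cast
  ring

theorem norm_integral_mul_ephase_le {d : ℕ} (g : EuclideanSpace ℝ (Fin d) → ℂ)
    (w : EuclideanSpace ℝ (Fin d)) : ‖∫ ξ, g ξ * ephase ⟪w, ξ⟫‖ ≤ ∫ ξ, ‖g ξ‖ := by
  refine (norm_integral_le_integral_norm _).trans (le_of_eq ?_)
  congr 1; funext ξ
  rw [norm_mul, norm_ephase, mul_one]

/-! ### Lattice sums compared with integrals -/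

/-- Interpolation between the first and the third order decay. -/
theorem le_mul_rpow_of_le_pow {n : ℕ} {F B η ω : ℝ} (hB : 0 ≤ B) (hη : 0 < η) (hω : 0 < ω)
    (h : ∀ j : ℕ, 1 ≤ j → j ≤ 3 → F ≤ B * (η * η⁻¹ ^ j) * (ω ^ (-((n : ℝ) / 2)) * ω⁻¹ ^ j)) :
    F ≤ B * η ^ (-(8 / 5) : ℝ) * ω ^ (-((n : ℝ) / 2 + 13 / 5)) := by
  have hηω : 0 < η * ω := by positivity
  have e : B * η ^ (-(8 / 5) : ℝ) * ω ^ (-((n : ℝ) / 2 + 13 / 5)) =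
      B * ω ^ (-((n : ℝ) / 2)) * ω⁻¹ * (η * ω) ^ (-(8 / 5) : ℝ) := by
    rw [Real.mul_rpow hη.le hω.le, show -((n : ℝ) / 2 + 13 / 5) =
      -((n : ℝ) / 2) + (-1) + (-(8 / 5)) by ring, Real.rpow_add hω, Real.rpow_add hω,
      Real.rpow_neg_one]
    ring
  rw [e]
  -- The hypothesis reads $F\le B\omega^{-n/2-1}(\eta\omega)^{1-j}$, and $8/5$ lies between the
  -- exponents $0$ and $2$: $j=1$ suffices for $\eta\omega\le1$, $j=3$ otherwise.
  rcases le_or_gt (η * ω) 1 with h1 | h1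
  · refine (h 1 le_rfl (by norm_num)).trans ?_
    have : 1 ≤ (η * ω) ^ (-(8 / 5) : ℝ) := by
      exact Real.one_le_rpow_of_pos_of_le_one_of_nonpos hηω h1 (by norm_num)
    calc _ = B * ω ^ (-((n : ℝ) / 2)) * ω⁻¹ * 1 := by
          rw [pow_one, pow_one, mul_inv_cancel₀ hη.ne']; ring
      _ ≤ _ := by gcongr
  · refine (h 3 (by norm_num) le_rfl).trans ?_
    have : (η * ω) ^ (-2 : ℝ) ≤ (η * ω) ^ (-(8 / 5) : ℝ) :=
      Real.rpow_le_rpow_of_exponent_le h1.le (by norm_num)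
    calc _ = B * ω ^ (-((n : ℝ) / 2)) * ω⁻¹ * (η * ω) ^ (-2 : ℝ) := by
          rw [Real.rpow_neg hηω.le, Real.rpow_two]
          field_simp
      _ ≤ _ := by gcongr

theorem one_le_norm_latticePoint {d : ℕ} {k : Fin d → ℤ} (hk : k ≠ 0) : 1 ≤ ‖latticePoint k‖ := by
  obtain ⟨i, hi⟩ := Function.ne_iff.1 hk
  refine le_trans ?_ (PiLp.norm_apply_le (latticePoint k) i)
  rw [latticePoint_apply, Real.norm_eq_abs]
  exact_mod_cast Int.one_le_abs hi

theorem latticePoint_zero (d : ℕ) : latticePoint (0 : Fin d → ℤ) = 0 := by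
  ext i; simp [latticePoint_apply]

/-- A lattice sum is the integral, up to an error controlled by the decay of the Fourier
transform. -/
theorem exists_norm_lattice_sum_sub_integral_le {n : ℕ} (hn : n ≤ 3) :
    ∃ S : ℝ, 0 < S ∧ ∀ (g : EucSucc n → ℂ), Continuous g → Integrable g → ∀ B η : ℝ, 0 ≤ B → 0 < η →
      (∀ w : EucSucc n, 1 / 2 ≤ ‖w‖ → ∀ j : ℕ, 1 ≤ j → j ≤ 3 →
        ‖∫ ξ, g ξ * ephase ⟪w, ξ⟫‖ ≤
          B * (η * η⁻¹ ^ j) * (‖w‖ ^ (-((n : ℝ) / 2)) * ‖w‖⁻¹ ^ j)) →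
      ∀ x : EucSucc n, ‖x‖ ≤ 1 / 2 → ∀ s : Finset (Fin (n + 1) → ℤ),
      (∀ m ∉ s, g (latticePoint m) = 0) →
      ‖∑ m ∈ s, g (latticePoint m) * character m x - ∫ ξ, g ξ * ephase ⟪x, ξ⟫‖ ≤
        S * (B * η ^ (-(8 / 5) : ℝ)) := by
  -- Summability over $\mathbb Z^{n+1}$ asks $p>n+1$, that is $8/5>n/2$, which holds because
  -- $n\le3$.
  set p : ℝ := (n : ℝ) / 2 + 13 / 5 with hp
  have hn' : (n : ℝ) ≤ 3 := by exact_mod_cast hn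
  have hpd : ((n + 1 : ℕ) : ℝ) < p := by push_cast; rw [hp]; linarith
  have hp0 : 0 < p := by rw [hp]; positivity
  have hsumm := (summable_norm_latticePoint_rpow (n + 1) hpd).mul_left ((2 : ℝ) ^ p)
  set S := ∑' k : Fin (n + 1) → ℤ, (2 : ℝ) ^ p * ‖latticePoint k‖ ^ (-p) with hS
  have hS0 : 0 ≤ S := tsum_nonneg fun k => by positivity
  refine ⟨S + 1, by linarith, fun g hgc hgi B η hB hη hdec x hx s hs => ?_⟩
  set D := B * η ^ (-(8 / 5) : ℝ) with hD
  have hD0 : 0 ≤ D := by rw [hD]; positivity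
  have hdec' : ∀ w : EucSucc n, 1 / 2 ≤ ‖w‖ → ‖𝓕⁻ g w‖ ≤ D * ‖w‖ ^ (-p) := by
    intro w hw
    rw [fourierInv_eq_integral_ephase]
    exact le_mul_rpow_of_le_pow hB hη (by linarith) (hdec w hw)
  -- Poisson summation needs decay for all $w$. The factor $3^p$ comes from $1+\|w\|\le3\|w\|$ for
  -- $\|w\|\ge1/2$ and $1+\|w\|\le3$ otherwise. This crude constant involves $\int\|g\|$ and serves
  -- only for convergence; it does not enter the final bound.
  have hglob : ∀ w : EucSucc n, ‖𝓕⁻ g w‖ ≤ (3 : ℝ) ^ p * (D + ∫ ξ, ‖g ξ‖) * (1 + ‖w‖) ^ (-p) := by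
    intro w
    have hI : 0 ≤ ∫ ξ, ‖g ξ‖ := integral_nonneg fun _ => norm_nonneg _
    have e1 : ∀ u : ℝ, 0 < u → 1 + ‖w‖ ≤ 3 * u → u ^ (-p) ≤ 3 ^ p * (1 + ‖w‖) ^ (-p) := by
      intro u hu h3
      have e2 : (3 * u) ^ (-p) ≤ (1 + ‖w‖) ^ (-p) :=
        Real.rpow_le_rpow_of_nonpos (by positivity) h3 (by linarith)
      have e3 : u ^ (-p) = 3 ^ p * (3 * u) ^ (-p) := by
        rw [Real.mul_rpow (by norm_num) hu.le, ← mul_assoc, ← Real.rpow_add (by norm_num)]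
        simp
      rw [e3]; gcongr
    rcases le_or_gt (1 / 2) ‖w‖ with hw | hw
    · calc _ ≤ D * ‖w‖ ^ (-p) := hdec' w hw
        _ ≤ (D + ∫ ξ, ‖g ξ‖) * (3 ^ p * (1 + ‖w‖) ^ (-p)) := by
            gcongr
            · linarith
            · exact e1 _ (by linarith) (by linarith)
        _ = _ := by ring
    · have h1 := e1 1 one_pos (by linarith)
      rw [Real.one_rpow] at h1
      calc _ ≤ (∫ ξ, ‖g ξ‖) * 1 := by
            rw [mul_one, fourierInv_eq_integral_ephase]; exact norm_integral_mul_ephase_le g w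
        _ ≤ (D + ∫ ξ, ‖g ξ‖) * (3 ^ p * (1 + ‖w‖) ^ (-p)) := by
            gcongr; linarith
        _ = _ := by ring
  have hfin : {m : Fin (n + 1) → ℤ | g (latticePoint m) ≠ 0}.Finite :=
    s.finite_toSet.subset fun m hm => by
      by_contra h; exact hm (hs m h)
  have hP := tsum_fourierInv_latticePoint hgc hgi hpd hglob hfin x
  have hsum : ∑ m ∈ hfin.toFinset, g (latticePoint m) * character m x =
      ∑ m ∈ s, g (latticePoint m) * character m x := by
    refine Finset.sum_subset (fun m hm => ?_) fun m _ hm => ?_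
    · by_contra h
      exact (hfin.mem_toFinset.1 hm) (hs m h)
    · have : g (latticePoint m) = 0 := by
        by_contra h; exact hm (hfin.mem_toFinset.2 h)
      rw [this, zero_mul]
  have hsn := summable_norm_periodization hpd hglob x
  rw [hsum, hsn.of_norm.tsum_eq_add_tsum_ite (0 : Fin (n + 1) → ℤ), latticePoint_zero, add_zero,
    fourierInv_eq_integral_ephase] at hP
  rw [← hP, add_sub_cancel_left]
  have hb : ∀ k : Fin (n + 1) → ℤ, ‖(if k = 0 then 0 else 𝓕⁻ g (x + latticePoint k))‖ ≤
      D * ((2 : ℝ) ^ p * ‖latticePoint k‖ ^ (-p)) := by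
    intro k
    split_ifs with hk
    · rw [norm_zero]; positivity
    · have h1 := one_le_norm_latticePoint hk
      have h2 : ‖latticePoint k‖ - 1 / 2 ≤ ‖x + latticePoint k‖ := by
        have := norm_sub_le (x + latticePoint k) x
        rw [add_sub_cancel_left] at this
        linarith
      refine (hdec' _ (by linarith)).trans ?_
      gcongr
      -- For $k\ne0$, $\|k\|\ge1$ and $\|x\|\le1/2$ give $\|x+k\|\ge\|k\|-1/2\ge\|k\|/2$, which is
      -- also at least $1/2$, where the decay hypothesis applies.
      have e2 : ‖x + latticePoint k‖ ^ (-p) ≤ (2⁻¹ * ‖latticePoint k‖) ^ (-p) :=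
        Real.rpow_le_rpow_of_nonpos (by positivity) (by linarith) (by linarith)
      refine e2.trans (le_of_eq ?_)
      rw [Real.mul_rpow (by norm_num) (by positivity), Real.inv_rpow (by norm_num),
        Real.rpow_neg (by norm_num), inv_inv]
  refine (tsum_of_norm_bounded (hsumm.mul_left D).hasSum hb).trans ?_
  rw [tsum_mul_left, ← hS]
  nlinarith

/-! ### Lattice points in a thin spherical shell -/

/-- A smooth bump, equal to `1` on `[0, 1]` and supported in `[-1, 2]`. -/
def bumpReal (u : ℝ) : ℝ := Real.smoothTransition (u + 1) * Real.smoothTransition (2 - u)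

/-- `bumpReal` with complex values. -/
def bumpCut (u : ℝ) : ℂ := (bumpReal u : ℝ)

theorem bumpReal_eq_zero_of_le {u : ℝ} (hu : u ≤ -1) : bumpReal u = 0 := by
  rw [bumpReal, Real.smoothTransition.zero_of_nonpos (by linarith), zero_mul]

theorem bumpReal_eq_zero_of_ge {u : ℝ} (hu : 2 ≤ u) : bumpReal u = 0 := by
  rw [bumpReal, Real.smoothTransition.zero_of_nonpos (x := 2 - u) (by linarith), mul_zero]

theorem bumpReal_eq_one {u : ℝ} (h0 : 0 ≤ u) (h1 : u ≤ 1) : bumpReal u = 1 := by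
  rw [bumpReal, Real.smoothTransition.one_of_one_le (by linarith),
    Real.smoothTransition.one_of_one_le (by linarith), mul_one]

theorem bumpReal_nonneg (u : ℝ) : 0 ≤ bumpReal u :=
  mul_nonneg (Real.smoothTransition.nonneg _) (Real.smoothTransition.nonneg _)

theorem bumpReal_le_one (u : ℝ) : bumpReal u ≤ 1 :=
  mul_le_one₀ (Real.smoothTransition.le_one _) (Real.smoothTransition.nonneg _)
    (Real.smoothTransition.le_one _)

theorem isCutoff_bumpCut : IsCutoff bumpCut where
  contDiff := by
    refine Complex.ofRealCLM.contDiff.comp ?_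
    exact (Real.smoothTransition.contDiff.comp (by fun_prop)).mul
      (Real.smoothTransition.contDiff.comp (by fun_prop))
  eq_zero u hu := by rw [bumpCut, bumpReal_eq_zero_of_le (by linarith), Complex.ofReal_zero]
  eq_const u hu := by
    rw [bumpCut, bumpCut, bumpReal_eq_zero_of_ge hu, bumpReal_eq_zero_of_ge le_rfl]

theorem norm_bumpCut_le (u : ℝ) : ‖bumpCut u‖ ≤ 1 := by
  rw [bumpCut, Complex.norm_real, Real.norm_of_nonneg (bumpReal_nonneg u)]
  exact bumpReal_le_one u

theorem bumpCut_eq_zero_of_notMem {l η t : ℝ} (hη : 0 < η) (ht : t ∉ Set.Icc (l - η) (l + 2 * η)) :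
    bumpCut (η⁻¹ * (t - l)) = 0 := by
  rw [Set.mem_Icc, not_and_or, not_le, not_le] at ht
  rw [bumpCut]
  rcases ht with ht | ht
  · rw [bumpReal_eq_zero_of_le, Complex.ofReal_zero]
    rw [inv_mul_le_iff₀ hη]; linarith
  · rw [bumpReal_eq_zero_of_ge, Complex.ofReal_zero]
    rw [le_inv_mul_iff₀ hη]; linarith

theorem continuous_bumpCut : Continuous bumpCut := isCutoff_bumpCut.contDiff.continuous

theorem integrable_bumpCut_norm {n : ℕ} {η : ℝ} (hη : 0 < η) (l : ℝ) :
    Integrable fun ξ : EucSucc n => bumpCut (η⁻¹ * (‖ξ‖ - l)) := by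
  refine (continuous_bumpCut.comp (by fun_prop)).integrable_of_hasCompactSupport ?_
  refine HasCompactSupport.intro (isCompact_closedBall 0 (l + 2 * η)) fun ξ hξ => ?_
  refine bumpCut_eq_zero_of_notMem hη fun h => hξ ?_
  simpa using h.2

/-- The spherical wave has frequencies $\pm\|w\|$ and amplitudes of order $n/2$. Their growth is
harmless because the bump vanishes past the shell, which is the alternative `ζ 2 = 0` in the
integration by parts. -/
theorem exists_norm_fourier_bumpCut_le (n : ℕ) :
    ∃ K : ℝ, 0 < K ∧ ∀ w : EucSucc n, 1 / 2 ≤ ‖w‖ → ∀ l η : ℝ, 4 ≤ l → 0 < η → η ≤ 1 →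
      ∀ j : ℕ, 1 ≤ j → j ≤ 3 →
      ‖∫ ξ : EucSucc n, bumpCut (η⁻¹ * (‖ξ‖ - l)) * ephase ⟪w, ξ⟫‖ ≤
        K * l ^ ((n : ℝ) / 2) * (η * η⁻¹ ^ j) * (‖w‖ ^ (-((n : ℝ) / 2)) * ‖w‖⁻¹ ^ j) := by
  obtain ⟨C, hC, hsym⟩ := exists_isSymbol_waveAmp n (ω₀ := 1 / 2) (by norm_num)
  obtain ⟨K, hK, hosc⟩ := isCutoff_bumpCut.exists_norm_integral_le (p := (n : ℝ) / 2)
    (Or.inr (by rw [bumpCut, bumpReal_eq_zero_of_ge le_rfl, Complex.ofReal_zero]))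
  refine ⟨2 * (K * C), by positivity, fun w hw l η hl hη hη1 j hj1 hj3 => ?_⟩
  have hω : 0 < ‖w‖ := by linarith
  have hw0 : w ≠ 0 := norm_pos_iff.1 hω
  rw [integral_radial_mul_ephase w (k := fun t => bumpCut (η⁻¹ * (t - l)))
    (integrable_bumpCut_norm hη l)]
  set F : ℝ → ℝ → ℝ → ℂ := fun θ σ t => ephase (θ * t) *
    (bumpCut (η⁻¹ * (t - l)) * waveAmp n σ ‖w‖ t) with hF
  have hsplit : ∀ t ∈ Set.Ioi (0 : ℝ), bumpCut (η⁻¹ * (t - l)) * sphereWave w t =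
      F ‖w‖ 1 t + F (-‖w‖) (-1) t := by
    intro t ht
    rw [sphereWave_eq_waveAmp hw0 ht]
    simp only [hF]; ring
  have hz : ∀ t ∉ Set.Icc (l - η) (l + 2 * η), bumpCut (η⁻¹ * (t - l)) = 0 :=
    fun t ht => bumpCut_eq_zero_of_notMem hη ht
  obtain ⟨K', -, hK'⟩ := isCutoff_bumpCut.exists_iteratedDeriv_mul_le ((n : ℝ) / 2)
  have hint : ∀ σ : ℝ, |σ| = 1 →
      Integrable fun t : ℝ => bumpCut (η⁻¹ * (t - l)) * waveAmp n σ ‖w‖ t := by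
    intro σ hσ
    have hcont := (hK' _ _ (hsym σ hσ ‖w‖ hw) l η hl hη hη1).1.continuous
    refine hcont.integrable_of_hasCompactSupport 
      (HasCompactSupport.intro (K := Set.Icc (l - η) (l + 2 * η)) isCompact_Icc fun t ht => ?_)
    rw [hz t ht, zero_mul]
  have hFint : ∀ θ σ : ℝ, |σ| = 1 → Integrable (F θ σ) := fun θ σ hσ =>
    (hint σ hσ).bdd_mul (c := 1) (continuous_ephase.comp (by fun_prop)).aestronglyMeasurable
      (Eventually.of_forall fun x => (norm_ephase _).le)
  have hFb : ∀ θ σ : ℝ, |σ| = 1 → |θ| = ‖w‖ → ‖∫ t in Set.Ioi (0 : ℝ), F θ σ t‖ ≤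
      K * C * (l ^ ((n : ℝ) / 2) * (η * η⁻¹ ^ j) * (‖w‖ ^ (-((n : ℝ) / 2)) * ‖w‖⁻¹ ^ j)) := by
    intro θ σ hσ hθ
    have hFz : ∀ t ∉ Set.Ioi (0 : ℝ), F θ σ t = 0 := by
      intro t ht
      simp only [hF]
      rw [hz t fun h => ht (by have := h.1; exact Set.mem_Ioi.2 (by linarith)), zero_mul, mul_zero]
    rw [setIntegral_eq_integral_of_forall_compl_eq_zero hFz]
    have h1 := hosc _ _ (hsym σ hσ ‖w‖ hw) l η hl hη hη1 (hint σ hσ) j hj1 hj3 θ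
      (abs_pos.1 (by rw [hθ]; exact hω))
    rw [hθ] at h1
    refine h1.trans (le_of_eq ?_)
    ring
  rw [setIntegral_congr_fun measurableSet_Ioi hsplit]
  have hadd : ∫ t in Set.Ioi (0 : ℝ), (F ‖w‖ 1 t + F (-‖w‖) (-1) t) = _ :=
    integral_add (hFint _ _ abs_one).integrableOn (hFint _ _ (by simp)).integrableOn
  rw [hadd]
  have b1 := hFb ‖w‖ 1 abs_one (abs_norm w)
  have b2 := hFb (-‖w‖) (-1) (by simp) (by simp)
  refine (norm_add_le _ _).trans ((add_le_add b1 b2).trans (le_of_eq ?_))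
  ring

/-- The trivial bound by volume: a shell of thickness $3\eta$ on which $t\le2l$. This is the
zero-frequency term in the count. -/
theorem exists_norm_integral_bumpCut_le (n : ℕ) :
    ∃ K : ℝ, 0 < K ∧ ∀ l η : ℝ, 4 ≤ l → 0 < η → η ≤ 1 →
      ‖∫ ξ : EucSucc n, bumpCut (η⁻¹ * (‖ξ‖ - l)) * ephase ⟪(0 : EucSucc n), ξ⟫‖ ≤
        K * (l ^ n * η) := by
  set V := (volume : Measure (EucSucc n)).toSphere.real Set.univ with hV
  have hV0 : 0 ≤ V := measureReal_nonneg
  refine ⟨3 * (V + 1) * 2 ^ n, by positivity, fun l η hl hη hη1 => ?_⟩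
  rw [integral_radial_mul_ephase 0 (k := fun t => bumpCut (η⁻¹ * (t - l)))
    (integrable_bumpCut_norm hη l)]
  have hsub : Set.Icc (l - η) (l + 2 * η) ⊆ Set.Ioi (0 : ℝ) := fun t ht =>
    Set.mem_Ioi.2 (by have := ht.1; linarith)
  rw [setIntegral_eq_of_subset_of_forall_sdiff_eq_zero measurableSet_Ioi hsub fun t ht => by
    rw [bumpCut_eq_zero_of_notMem hη ht.2, zero_mul]]
  have := norm_setIntegral_le_of_norm_le_const (μ := volume) (s := Set.Icc (l - η) (l + 2 * η))
    (f := fun t => bumpCut (η⁻¹ * (t - l)) * sphereWave (0 : EucSucc n) t) (C := (V + 1) * (2 * l) ^ n)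
    (by simp) (fun t ht => by
      have h0 : 0 ≤ t := le_of_lt (hsub ht)
      have h2 : t ≤ 2 * l := by have := ht.2; linarith
      rw [norm_mul]
      calc _ ≤ 1 * (V * t ^ n) := by
            gcongr
            · exact norm_bumpCut_le _
            · exact norm_sphereWave_le 0 h0
        _ ≤ 1 * ((V + 1) * (2 * l) ^ n) := by gcongr; linarith
        _ = _ := one_mul _)
  refine this.trans (le_of_eq ?_)
  rw [Real.volume_real_Icc_of_le (by linarith), mul_pow]
  ring

/-- The number of lattice points in a thin spherical shell. -/
theorem exists_card_shell_le {n : ℕ} (hn : n ≤ 3) :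
    ∃ K : ℝ, 0 < K ∧ ∀ l η : ℝ, 4 ≤ l → 0 < η → η ≤ 1 → ∀ s : Finset (Fin (n + 1) → ℤ),
      (∀ m ∈ s, l ≤ ‖latticePoint m‖ ∧ ‖latticePoint m‖ ≤ l + η) →
      (s.card : ℝ) ≤ K * (l ^ n * η + l ^ ((n : ℝ) / 2) * η ^ (-(8 / 5) : ℝ)) := by
  obtain ⟨S, hS, hsum⟩ := exists_norm_lattice_sum_sub_integral_le hn
  obtain ⟨K₁, hK₁, h₁⟩ := exists_norm_fourier_bumpCut_le n
  obtain ⟨K₂, hK₂, h₂⟩ := exists_norm_integral_bumpCut_le n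
  refine ⟨K₂ + S * K₁, by positivity, fun l η hl hη hη1 s hs => ?_⟩
  set T := (finite_lattice_ball (n + 1) (l + 3 * η)).toFinset with hT
  set g : EucSucc n → ℂ := fun ξ => bumpCut (η⁻¹ * (‖ξ‖ - l)) with hg
  have hsT : s ⊆ T := fun m hm => by
    rw [hT, Set.Finite.mem_toFinset]
    have := (hs m hm).2
    change ‖latticePoint m‖ < _
    linarith
  have h3 := hsum g (continuous_bumpCut.comp (by fun_prop)) (integrable_bumpCut_norm hη l)
    (K₁ * l ^ ((n : ℝ) / 2)) η (by positivity) hη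
    (fun w hw j hj1 hj3 => h₁ w hw l η hl hη hη1 j hj1 hj3) 0 (by simp) T (fun m hm => by
      refine bumpCut_eq_zero_of_notMem hη fun h => hm ?_
      rw [hT, Set.Finite.mem_toFinset]
      change ‖latticePoint m‖ < _
      have := h.2
      linarith)
  have h4 := h₂ l η hl hη hη1
  have h5 : ∑ m ∈ T, g (latticePoint m) * character m 0 =
      ((∑ m ∈ T, bumpReal (η⁻¹ * (‖latticePoint m‖ - l)) : ℝ) : ℂ) := by
    rw [Complex.ofReal_sum]
    refine Finset.sum_congr rfl fun m _ => ?_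
    have : character m 0 = 1 := by simp [character]
    rw [this, mul_one]; rfl
  -- The bump is nonnegative and equals 1 on the shell, so its lattice sum dominates the count;
  -- Poisson summation at the origin then bounds that sum.
  have h6 : (s.card : ℝ) ≤ ∑ m ∈ T, bumpReal (η⁻¹ * (‖latticePoint m‖ - l)) := by
    calc (s.card : ℝ) = ∑ m ∈ s, (1 : ℝ) := by simp
      _ ≤ ∑ m ∈ s, bumpReal (η⁻¹ * (‖latticePoint m‖ - l)) := by
          refine Finset.sum_le_sum fun m hm => ?_
          obtain ⟨u, v⟩ := hs m hm
          rw [bumpReal_eq_one]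
          · exact mul_nonneg (by positivity) (by linarith)
          · rw [inv_mul_le_iff₀ hη]; linarith
      _ ≤ _ := Finset.sum_le_sum_of_subset_of_nonneg hsT fun _ _ _ => bumpReal_nonneg _
  have h7 : ‖∑ m ∈ T, g (latticePoint m) * character m 0‖ ≤ S * (K₁ * l ^ ((n : ℝ) / 2) *
      η ^ (-(8 / 5) : ℝ)) + K₂ * (l ^ n * η) := by
    have := norm_add_le (∑ m ∈ T, g (latticePoint m) * character m 0 -
      ∫ ξ, g ξ * ephase ⟪(0 : EucSucc n), ξ⟫) (∫ ξ, g ξ * ephase ⟪(0 : EucSucc n), ξ⟫)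
    rw [sub_add_cancel] at this
    linarith
  rw [h5, Complex.norm_real] at h7
  have h8 := (h6.trans (le_abs_self _)).trans h7
  have a1 : 0 ≤ l ^ n * η := by positivity
  have a2 : 0 ≤ l ^ ((n : ℝ) / 2) * η ^ (-(8 / 5) : ℝ) := by positivity
  refine h8.trans ?_
  have b1 : 0 ≤ S * K₁ * (l ^ n * η) := by positivity
  have b2 : 0 ≤ K₂ * (l ^ ((n : ℝ) / 2) * η ^ (-(8 / 5) : ℝ)) := by positivity
  nlinarith

/-! ### The oscillatory integral behind the Gibbs constant -/

/-- The weight `e^{-c s²} s^{-1-β}`. -/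
def oscWeight (β c s : ℝ) : ℝ := Real.exp (-c * s ^ 2) * s ^ (-1 - β)

/-- The derivative of `oscWeight`. -/
def oscWeightDeriv (β c s : ℝ) : ℝ :=
  -(2 * (c * s ^ 2) * Real.exp (-c * s ^ 2) + (1 + β) * Real.exp (-c * s ^ 2)) * s ^ (-2 - β)

theorem hasDerivAt_oscWeight (β c : ℝ) {s : ℝ} (hs : 0 < s) :
    HasDerivAt (oscWeight β c) (oscWeightDeriv β c s) s := by
  have h1 : HasDerivAt (fun s : ℝ => Real.exp (-c * s ^ 2)) (Real.exp (-c * s ^ 2) * (-c * (2 * s))) s := by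
    have := ((hasDerivAt_pow 2 s).const_mul (-c)).exp
    simpa using this
  have h2 : HasDerivAt (fun s : ℝ => s ^ (-1 - β)) ((-1 - β) * s ^ (-1 - β - 1)) s :=
    Real.hasDerivAt_rpow_const (Or.inl hs.ne')
  refine (h1.mul h2).congr_deriv ?_
  have e1 : s ^ (-1 - β) = s * s ^ (-2 - β) := by
    rw [show -1 - β = 1 + (-2 - β) by ring, Real.rpow_add hs, Real.rpow_one]
  have e2 : s ^ (-1 - β - 1) = s ^ (-2 - β) := by congr 1; ring
  rw [e1, e2, oscWeightDeriv]
  ring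

theorem continuousOn_oscWeight (β c : ℝ) : ContinuousOn (oscWeight β c) (Set.Ioi 0) :=
  fun _ hs => (hasDerivAt_oscWeight β c hs).continuousAt.continuousWithinAt

theorem continuousOn_oscWeightDeriv (β c : ℝ) : ContinuousOn (oscWeightDeriv β c) (Set.Ioi 0) := by
  unfold oscWeightDeriv
  refine ContinuousOn.mul (by fun_prop) ?_
  exact ContinuousOn.rpow_const continuousOn_id fun s hs => Or.inl (ne_of_gt hs)

/-- Uniformity in $c$ comes from $xe^{-x}\le1$ with $x=cs^2$; hence the constant $2+(1+\beta)$. -/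
theorem abs_oscWeightDeriv_le {β c s : ℝ} (hβ : -1 < β) (hc : 0 ≤ c) (hs : 0 < s) :
    |oscWeightDeriv β c s| ≤ (3 + β) * s ^ (-2 - β) := by
  have hx : 0 ≤ c * s ^ 2 := by positivity
  have h1 : c * s ^ 2 * Real.exp (-c * s ^ 2) ≤ 1 := by
    rw [neg_mul, Real.exp_neg, mul_inv_le_iff₀ (Real.exp_pos _)]
    linarith [Real.add_one_le_exp (c * s ^ 2)]
  have h2 : Real.exp (-c * s ^ 2) ≤ 1 := by rw [Real.exp_le_one_iff]; linarith
  have h3 : 0 < Real.exp (-c * s ^ 2) := Real.exp_pos _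
  rw [oscWeightDeriv, abs_mul, abs_neg, abs_of_pos (Real.rpow_pos_of_pos hs _)]
  gcongr
  rw [abs_of_nonneg (by nlinarith [mul_nonneg hx h3.le])]
  nlinarith

theorem integrableOn_rpow_neg_two_sub {β : ℝ} (hβ : -1 < β) :
    IntegrableOn (fun s : ℝ => s ^ (-2 - β)) (Set.Ioi 1) :=
  integrableOn_Ioi_rpow_of_lt (by linarith) one_pos

theorem integrableOn_oscWeightDeriv_mul {β c k φ : ℝ} (hβ : -1 < β) (hc : 0 ≤ c) :
    IntegrableOn (fun s => oscWeightDeriv β c s * (1 + Real.cos (k * s - φ))) (Set.Ioi 1) := by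
  have hsub : Set.Ioi (1 : ℝ) ⊆ Set.Ioi 0 := Set.Ioi_subset_Ioi zero_le_one
  refine ((integrableOn_rpow_neg_two_sub hβ).const_mul ((3 + β) * 2)).mono'
    ((((continuousOn_oscWeightDeriv β c).mono hsub).mul (by fun_prop)).aestronglyMeasurable
      measurableSet_Ioi) ?_
  filter_upwards [ae_restrict_mem measurableSet_Ioi] with s hs
  have h1 := abs_oscWeightDeriv_le hβ hc (hsub hs)
  rw [norm_mul, Real.norm_eq_abs, Real.norm_eq_abs]
  have h2 : |1 + Real.cos (k * s - φ)| ≤ 2 := by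
    rw [abs_le]; constructor <;> linarith [Real.neg_one_le_cos (k * s - φ), Real.cos_le_one (k * s - φ)]
  calc _ ≤ ((3 + β) * s ^ (-2 - β)) * 2 :=
        mul_le_mul h1 h2 (abs_nonneg _) ((abs_nonneg _).trans h1)
    _ = _ := by ring

/-- The value of the regularized oscillatory integrals. -/
def oscValue (β k φ c : ℝ) : ℝ :=
  k⁻¹ * ∫ s in Set.Ioi 1, oscWeightDeriv β c s * (1 + Real.cos (k * s - φ))

/-- Integration by parts against $1+\cos(ks-\varphi)$, which vanishes at $s=1$ exactly because
$k-\varphi=\pi$. The new integrand is $O(s^{-2-\beta})$, so the limit exists even for $c=0$, where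
the original integral may converge only conditionally. -/
theorem tendsto_intervalIntegral_oscWeight_mul_sin {β c k φ : ℝ} (hβ : -1 < β) (hc : 0 ≤ c)
    (hk : 0 < k) (hφ : k - φ = Real.pi) :
    Tendsto (fun R : ℝ => ∫ s in (1 : ℝ)..R, oscWeight β c s * Real.sin (k * s - φ)) atTop
      (𝓝 (oscValue β k φ c)) := by
  have hsub : Set.Ioi (1 : ℝ) ⊆ Set.Ioi 0 := Set.Ioi_subset_Ioi zero_le_one
  have h1 := (intervalIntegral_tendsto_integral_Ioi 1
    (integrableOn_oscWeightDeriv_mul (k := k) (φ := φ) hβ hc) tendsto_id).const_mul k⁻¹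
  have h2 : Tendsto (fun R => k⁻¹ * (oscWeight β c R * (1 + Real.cos (k * R - φ)))) atTop (𝓝 0) := by
    have hz : Tendsto (fun R : ℝ => k⁻¹ * (R ^ (-(1 + β)) * 2)) atTop (𝓝 0) := by
      simpa using ((tendsto_rpow_neg_atTop (show 0 < 1 + β by linarith)).mul_const 2).const_mul k⁻¹
    refine squeeze_zero_norm' ?_ hz
    filter_upwards [eventually_gt_atTop 0] with R hR
    have h3 : |1 + Real.cos (k * R - φ)| ≤ 2 := by
      rw [abs_le]
      constructor <;> linarith [Real.neg_one_le_cos (k * R - φ), Real.cos_le_one (k * R - φ)]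
    have h4 : Real.exp (-c * R ^ 2) ≤ 1 := by
      rw [Real.exp_le_one_iff]; nlinarith [mul_nonneg hc (sq_nonneg R)]
    rw [norm_mul, norm_mul, Real.norm_of_nonneg (inv_nonneg.2 hk.le), Real.norm_eq_abs,
      Real.norm_eq_abs, oscWeight, abs_of_nonneg (by positivity), show -1 - β = -(1 + β) by ring]
    gcongr
    have : 0 < R ^ (-(1 + β)) := by positivity
    nlinarith
  have h3 := h1.sub h2
  rw [sub_zero] at h3
  refine h3.congr' ?_
  filter_upwards [eventually_ge_atTop 1] with R hR
  have hpos : ∀ s ∈ Set.uIcc 1 R, 0 < s := fun s hs => by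
    rw [Set.uIcc_of_le hR] at hs; linarith [hs.1]
  have hg : ∀ s ∈ Set.uIcc 1 R, HasDerivAt (fun s => 1 + Real.cos (k * s - φ))
      (-(k * Real.sin (k * s - φ))) s := by
    intro s _
    have h5 : HasDerivAt (fun s => k * s - φ) k s := by
      simpa using ((hasDerivAt_id s).const_mul k).sub_const φ
    refine (h5.cos.const_add 1).congr_deriv ?_
    ring
  have hparts := intervalIntegral.integral_mul_deriv_eq_deriv_mul
    (u := oscWeight β c) (v := fun s => 1 + Real.cos (k * s - φ)) (u' := oscWeightDeriv β c)
    (v' := fun s => -(k * Real.sin (k * s - φ))) (a := 1) (b := R)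
    (fun s hs => hasDerivAt_oscWeight β c (hpos s hs)) hg
    (((continuousOn_oscWeightDeriv β c).mono hpos).intervalIntegrable)
    (Continuous.intervalIntegrable (by fun_prop) _ _)
  have e1 : ∫ s in (1 : ℝ)..R, oscWeight β c s * -(k * Real.sin (k * s - φ)) =
      -k * ∫ s in (1 : ℝ)..R, oscWeight β c s * Real.sin (k * s - φ) := by
    rw [← intervalIntegral.integral_const_mul]
    congr 1; funext s; ring
  have e2 : 1 + Real.cos (k * 1 - φ) = 0 := by rw [mul_one, hφ, Real.cos_pi]; ring
  rw [e1, e2, mul_zero, sub_zero] at hparts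
  simp only [id]
  field_simp
  linarith

theorem integrableOn_oscWeight {β c : ℝ} (hβ : -1 < β) (hc : 0 < c) {b : ℝ} (hb : 0 < b) :
    IntegrableOn (oscWeight β c) (Set.Ioi b) := by
  have hsub : Set.Ioi b ⊆ Set.Ioi 0 := Set.Ioi_subset_Ioi hb.le
  have h1 : Integrable fun s : ℝ => b ^ (-1 - β) * Real.exp (-c * s ^ 2) :=
    (integrable_exp_neg_mul_sq hc).const_mul _
  refine h1.integrableOn.mono' (((continuousOn_oscWeight β c).mono hsub).aestronglyMeasurable
    measurableSet_Ioi) ?_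
  filter_upwards [ae_restrict_mem measurableSet_Ioi] with s hs
  have hs' : b < s := hs
  have hs0 : 0 < s := hb.trans hs'
  rw [oscWeight, Real.norm_of_nonneg (by positivity), mul_comm]
  exact mul_le_mul_of_nonneg_right (Real.rpow_le_rpow_of_nonpos hb hs'.le (by linarith))
    (Real.exp_pos _).le

theorem integrableOn_oscWeight_mul_sin {β c : ℝ} (hβ : -1 < β) (hc : 0 < c) {b : ℝ} (hb : 0 < b)
    (k φ : ℝ) : IntegrableOn (fun s => oscWeight β c s * Real.sin (k * s - φ)) (Set.Ioi b) := by
  refine (integrableOn_oscWeight hβ hc hb).mul_bdd (c := 1)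
    (Continuous.aestronglyMeasurable (by fun_prop)) (Eventually.of_forall fun s => ?_)
  exact Real.abs_sin_le_one _

theorem integral_oscWeight_mul_sin {β c k φ : ℝ} (hβ : -1 < β) (hc : 0 < c) (hk : 0 < k)
    (hφ : k - φ = Real.pi) :
    ∫ s in Set.Ioi 1, oscWeight β c s * Real.sin (k * s - φ) = oscValue β k φ c :=
  tendsto_nhds_unique (intervalIntegral_tendsto_integral_Ioi 1
    (integrableOn_oscWeight_mul_sin hβ hc one_pos k φ) tendsto_id)
    (tendsto_intervalIntegral_oscWeight_mul_sin hβ hc.le hk hφ)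

theorem tendsto_oscValue {β k φ : ℝ} (hβ : -1 < β) :
    Tendsto (oscValue β k φ) (𝓝[>] 0) (𝓝 (oscValue β k φ 0)) := by
  refine Tendsto.const_mul _ ?_
  have hsub : Set.Ioi (1 : ℝ) ⊆ Set.Ioi 0 := Set.Ioi_subset_Ioi zero_le_one
  refine tendsto_integral_filter_of_dominated_convergence (fun s => (3 + β) * 2 * s ^ (-2 - β)) ?_ ?_
    ((integrableOn_rpow_neg_two_sub hβ).const_mul _) ?_
  · filter_upwards [self_mem_nhdsWithin] with c (hc : 0 < c)
    exact (integrableOn_oscWeightDeriv_mul hβ hc.le).aestronglyMeasurable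
  · filter_upwards [self_mem_nhdsWithin] with c (hc : 0 < c)
    filter_upwards [ae_restrict_mem measurableSet_Ioi] with s hs
    have h1 := abs_oscWeightDeriv_le hβ hc.le (hsub hs)
    rw [norm_mul, Real.norm_eq_abs, Real.norm_eq_abs]
    have h2 : |1 + Real.cos (k * s - φ)| ≤ 2 := by
      rw [abs_le]
      constructor <;> linarith [Real.neg_one_le_cos (k * s - φ), Real.cos_le_one (k * s - φ)]
    calc _ ≤ ((3 + β) * s ^ (-2 - β)) * 2 :=
          mul_le_mul h1 h2 (abs_nonneg _) ((abs_nonneg _).trans h1)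
      _ = _ := by ring
  · refine Eventually.of_forall fun s => ?_
    have hc : Continuous fun c => oscWeightDeriv β c s * (1 + Real.cos (k * s - φ)) := by
      unfold oscWeightDeriv; fun_prop
    exact (hc.tendsto 0).mono_left nhdsWithin_le_nhds

/-- After the integration by parts the integrand is the negative derivative of $s^{-1-\beta}$ times
$1+\cos\ge0$. The integral is therefore nonpositive, and strictly negative since the cosine is not
identically $-1$. -/
theorem oscValue_zero_neg {β k φ : ℝ} (hβ : -1 < β) (hk : 0 < k) : oscValue β k φ 0 < 0 := by
  have e : ∫ s in Set.Ioi (1 : ℝ), oscWeightDeriv β 0 s * (1 + Real.cos (k * s - φ)) =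
      -∫ s in Set.Ioi (1 : ℝ), (1 + β) * s ^ (-2 - β) * (1 + Real.cos (k * s - φ)) := by
    rw [← integral_neg]
    congr 1; funext s
    simp [oscWeightDeriv]
    ring
  have hpos : 0 < ∫ s in Set.Ioi (1 : ℝ), (1 + β) * s ^ (-2 - β) * (1 + Real.cos (k * s - φ)) := by
    have hi : IntegrableOn (fun s => (1 + β) * s ^ (-2 - β) * (1 + Real.cos (k * s - φ)))
        (Set.Ioi 1) := by
      refine ((integrableOn_oscWeightDeriv_mul (k := k) (φ := φ) hβ le_rfl).neg).congr ?_
      refine Eventually.of_forall fun s => ?_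
      simp [oscWeightDeriv]
      ring
    have hnn : ∀ s : ℝ, 1 < s → 0 ≤ (1 + β) * s ^ (-2 - β) * (1 + Real.cos (k * s - φ)) := by
      intro s hs
      have : 0 < 1 + β := by linarith
      have := Real.neg_one_le_cos (k * s - φ)
      exact mul_nonneg (by positivity) (by linarith)
    rw [setIntegral_pos_iff_support_of_nonneg_ae
      ((ae_restrict_mem measurableSet_Ioi).mono fun s hs => hnn s hs) hi]
    -- A point $s_0>1$ with $ks_0-\varphi\in2\pi\mathbb Z$, where $1+\cos=2$; a neighbourhood of it
    -- has positive measure.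
    obtain ⟨N, hN⟩ := exists_nat_gt ((k - φ) / (2 * Real.pi))
    have hN' : k - φ < N * (2 * Real.pi) := (div_lt_iff₀ (by positivity)).1 hN
    set s₀ : ℝ := (φ + N * (2 * Real.pi)) / k with hs₀
    have hs1 : 1 < s₀ := by rw [hs₀, lt_div_iff₀ hk]; linarith
    have hopen : IsOpen {s : ℝ | 0 < 1 + Real.cos (k * s - φ)} :=
      isOpen_lt continuous_const (by fun_prop)
    have hmem : s₀ ∈ {s : ℝ | 0 < 1 + Real.cos (k * s - φ)} := by
      have : k * s₀ - φ = N * (2 * Real.pi) := by rw [hs₀]; field_simp; ring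
      change 0 < 1 + Real.cos (k * s₀ - φ)
      rw [this, Real.cos_nat_mul_two_pi]; norm_num
    refine ((hopen.inter isOpen_Ioi).measure_pos volume ⟨s₀, hmem, hs1⟩).trans_le
      (measure_mono ?_)
    rintro s ⟨h1, h2⟩
    refine ⟨?_, h2⟩
    have h1' : 0 < 1 + Real.cos (k * s - φ) := h1
    have h2' : (1 : ℝ) < s := h2
    have : 0 < 1 + β := by linarith
    have : 0 < s := by linarith
    rw [Function.mem_support]
    positivity
  rw [oscValue, e, mul_neg, neg_lt_zero]
  positivity

/-- The improper integral in the Gibbs constant. -/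
theorem hasImproperIntegral_gibbsIntegrand {ε β k : ℝ} (hβ : -1 < β) (hk : 0 < k)
    (hφ : k - ε * (β / 2) * Real.pi = Real.pi) :
    HasImproperIntegral (gibbsIntegrand ε β) Real.pi
      (k ^ (-β) * oscValue β k (ε * (β / 2) * Real.pi) 0) := by
  set φ := ε * (β / 2) * Real.pi with hφd
  have h1 := (tendsto_intervalIntegral_oscWeight_mul_sin hβ le_rfl hk hφ).const_mul (k ^ (-β))
  have h2 : Tendsto (fun R : ℝ => k⁻¹ * (R + φ)) atTop atTop :=
    (tendsto_atTop_add_const_right _ _ tendsto_id).const_mul_atTop (inv_pos.2 hk)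
  refine (h1.comp h2).congr' ?_
  filter_upwards [h2.eventually_ge_atTop 1] with R hR
  -- The substitution $s=kx-\varphi$ sends $x=1$ to $s=\pi$ and $s+\varphi$ to $kx$.
  have h3 := intervalIntegral.integral_comp_mul_sub (gibbsIntegrand ε β) hk.ne' φ
    (a := 1) (b := k⁻¹ * (R + φ))
  rw [mul_one, hφ, mul_inv_cancel_left₀ hk.ne', add_sub_cancel_right, smul_eq_mul] at h3
  have h4 : ∫ x in (1 : ℝ)..(k⁻¹ * (R + φ)), gibbsIntegrand ε β (k * x - φ) =
      ∫ x in (1 : ℝ)..(k⁻¹ * (R + φ)), k ^ (-1 - β) * (oscWeight β 0 x * Real.sin (k * x - φ)) := by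
    refine intervalIntegral.integral_congr fun x hx => ?_
    rw [Set.uIcc_of_le hR] at hx
    have hx0 : 0 < x := by linarith [hx.1]
    have e : (k * x) ^ (β + 1) = (k ^ (-1 - β) * x ^ (-1 - β))⁻¹ := by
      rw [Real.mul_rpow hk.le hx0.le, mul_inv, ← Real.rpow_neg hk.le, ← Real.rpow_neg hx0.le]
      congr 2 <;> ring
    simp only [gibbsIntegrand, oscWeight]
    rw [← hφd, sub_add_cancel, e, div_inv_eq_mul]
    simp
    ring
  rw [h4, intervalIntegral.integral_const_mul] at h3
  have e5 : k ^ (-β) = k * k ^ (-1 - β) := by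
    rw [show -β = 1 + (-1 - β) by ring, Real.rpow_add hk, Real.rpow_one]
  simp only [Function.comp_apply]
  rw [e5, mul_assoc, h3, mul_inv_cancel_left₀ hk.ne']

/-- The regularized oscillatory integrals over `(l, ∞)` converge. -/
theorem tendsto_integral_oscWeight_scaled {β k φ l : ℝ} (hβ : -1 < β) (hk : 0 < k)
    (hφ : k - φ = Real.pi) (hl : 0 < l) :
    Tendsto (fun c : ℝ => ∫ t in Set.Ioi l, oscWeight β c⁻¹ t * Real.sin (k * (l⁻¹ * t) - φ)) atTop
      (𝓝 (l ^ (-β) * oscValue β k φ 0)) := by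
  -- Rescaling $t=ls$ turns the regularization parameter $c^{-1}$ into $l^2c^{-1}$, which still
  -- tends to $0$ from above.
  have h1 : Tendsto (fun c : ℝ => l ^ 2 * c⁻¹) atTop (𝓝[>] 0) := by
    rw [tendsto_nhdsWithin_iff]
    refine ⟨by simpa using tendsto_inv_atTop_zero.const_mul (l ^ 2), ?_⟩
    filter_upwards [eventually_gt_atTop 0] with c hc
    exact Set.mem_Ioi.2 (by positivity)
  refine (((tendsto_oscValue hβ).comp h1).const_mul (l ^ (-β))).congr' ?_
  filter_upwards [eventually_gt_atTop 0] with c hc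
  have h2 := integral_comp_mul_left_Ioi
    (fun t => oscWeight β c⁻¹ t * Real.sin (k * (l⁻¹ * t) - φ)) 1 hl
  rw [mul_one, smul_eq_mul] at h2
  have h3 : ∫ s in Set.Ioi (1 : ℝ), oscWeight β c⁻¹ (l * s) * Real.sin (k * (l⁻¹ * (l * s)) - φ) =
      ∫ s in Set.Ioi (1 : ℝ), l ^ (-1 - β) * (oscWeight β (l ^ 2 * c⁻¹) s * Real.sin (k * s - φ)) := by
    refine setIntegral_congr_fun measurableSet_Ioi fun s hs => ?_
    have hs0 : (0 : ℝ) < s := one_pos.trans hs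
    simp only [oscWeight]
    rw [inv_mul_cancel_left₀ hl.ne', Real.mul_rpow hl.le hs0.le,
      show -c⁻¹ * (l * s) ^ 2 = -(l ^ 2 * c⁻¹) * s ^ 2 by ring]
    ring
  rw [h3, integral_const_mul, integral_oscWeight_mul_sin hβ (by positivity) hk hφ] at h2
  have e5 : l ^ (-β) = l * l ^ (-1 - β) := by
    rw [show -β = 1 + (-1 - β) by ring, Real.rpow_add hl, Real.rpow_one]
  simp only [Function.comp_apply]
  rw [e5, mul_assoc, h2, mul_inv_cancel_left₀ hl.ne']

/-! ### The leading term near the sphere -/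

/-- The leading coefficient of `prodAmp` with opposite signs. -/
def prodLead (n : ℕ) (β a σ ω : ℝ) : ℂ :=
  (hankelLead σ (β + (n : ℝ) / 2) * ((a ^ (-(β + (n : ℝ) / 2) - 1) : ℝ) : ℂ)) *
    (2 * Real.pi * Complex.I * (((-σ : ℝ) : ℂ) * ω) *
      ((ballMass n 0 : ℂ) * (hankelLead (-σ) ((n : ℝ) / 2) * ((ω ^ (-((n : ℝ) / 2) - 1) : ℝ) : ℂ))))

/-- The amplitude of the main oscillation near the sphere `|x| = a`. -/
def gibbsAmp (n : ℕ) (β a ω : ℝ) : ℝ :=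
  Real.Gamma (β + 1) * Real.pi ^ (-1 - β) * a ^ β * (a / ω) ^ ((n : ℝ) / 2)

/-- The Gamma factors of the two Hankel coefficients cancel the denominators of the two ball masses,
leaving only $\Gamma(\beta+1)$ and powers. -/
theorem prodLead_modulus (n : ℕ) {β a ω : ℝ} (hβ : -1 < β) (ha : 0 < a) (hω : 0 < ω) :
    ballMass n β * a ^ (2 * (β + (n : ℝ) / 2) + 1) *
      (2 ^ (β + (n : ℝ) / 2) * Real.Gamma (β + (n : ℝ) / 2 + 1) *
        (2 * Real.pi) ^ (-(β + (n : ℝ) / 2) - 1) * a ^ (-(β + (n : ℝ) / 2) - 1)) *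
      (2 * Real.pi * ω * (ballMass n 0 * (2 ^ ((n : ℝ) / 2) * Real.Gamma ((n : ℝ) / 2 + 1) *
        (2 * Real.pi) ^ (-((n : ℝ) / 2) - 1) * ω ^ (-((n : ℝ) / 2) - 1)))) =
      gibbsAmp n β a ω / 2 := by
  have h1 := ballMass_mul_Gamma n hβ
  have h2 := ballMass_mul_Gamma n (γ := 0) (by norm_num)
  rw [zero_add, zero_add, Real.Gamma_one, mul_one] at h2
  set ν := (n : ℝ) / 2 with hν
  have hπ := Real.pi_pos
  rw [gibbsAmp, Real.mul_rpow two_pos.le hπ.le, Real.mul_rpow two_pos.le hπ.le,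
    Real.div_rpow ha.le hω.le]
  calc _ = (ballMass n β * Real.Gamma (β + ν + 1)) * (ballMass n 0 * Real.Gamma (ν + 1)) *
        (a ^ (2 * (β + ν) + 1) * a ^ (-(β + ν) - 1)) *
        (2 ^ (β + ν) * 2 ^ (-(β + ν) - 1) * 2 ^ ν * 2 ^ (-ν - 1)) * 2 *
        (Real.pi ^ (-(β + ν) - 1) * Real.pi ^ (-ν - 1) * Real.pi) *
        (ω ^ (-ν - 1) * ω) := by ring
    _ = _ := by
        rw [h1, h2]
        have e1 : a ^ (2 * (β + ν) + 1) * a ^ (-(β + ν) - 1) = a ^ β * a ^ ν := by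
          rw [← Real.rpow_add ha, ← Real.rpow_add ha]; congr 1; ring
        have e2 : (2 : ℝ) ^ (β + ν) * 2 ^ (-(β + ν) - 1) * 2 ^ ν * 2 ^ (-ν - 1) = 1 / 4 := by
          rw [← Real.rpow_add two_pos, ← Real.rpow_add two_pos, ← Real.rpow_add two_pos,
            show β + ν + (-(β + ν) - 1) + ν + (-ν - 1) = -2 by ring, Real.rpow_neg two_pos.le]
          norm_num
        have e3 : Real.pi ^ ν * Real.pi ^ ν * (Real.pi ^ (-(β + ν) - 1) * Real.pi ^ (-ν - 1) * Real.pi) =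
            Real.pi ^ (-1 - β) := by
          nth_rewrite 5 [← Real.rpow_one Real.pi]
          rw [← Real.rpow_add hπ, ← Real.rpow_add hπ, ← Real.rpow_add hπ, ← Real.rpow_add hπ]
          congr 1; ring
        have e4 : ω ^ (-ν - 1) * ω = (ω ^ ν)⁻¹ := by
          nth_rewrite 2 [← Real.rpow_one ω]
          rw [← Real.rpow_add hω, ← Real.rpow_neg hω.le]; congr 1; ring
        rw [e1, e2, e4, ← e3]
        ring

/-- The two Hankel phases have opposite signs, so their $n$-dependent parts cancel and only
$e^{-\sigma i\pi\beta/2}$ remains. -/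
theorem ballMass_mul_prodLead (n : ℕ) {β a ω : ℝ} (hβ : -1 < β) (ha : 0 < a) (hω : 0 < ω) (σ : ℝ) :
    ((ballMass n β * a ^ (2 * (β + (n : ℝ) / 2) + 1) : ℝ) : ℂ) * prodLead n β a σ ω =
      ((gibbsAmp n β a ω / 2 : ℝ) : ℂ) *
        (-(σ * Complex.I) * Complex.exp (-(σ * (Real.pi * β / 2)) * Complex.I)) := by
  rw [← prodLead_modulus n hβ ha hω, prodLead, hankelLead, hankelLead]
  have hexp : Complex.exp (-(σ * (Real.pi * β / 2)) * Complex.I) =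
      Complex.exp (-(σ * (Real.pi * (β + (n : ℝ) / 2 + 1) / 2 : ℝ)) * Complex.I) *
      Complex.exp (-(((-σ : ℝ) : ℂ) * (Real.pi * ((n : ℝ) / 2 + 1) / 2 : ℝ)) * Complex.I) := by
    rw [← Complex.exp_add]
    congr 1
    push_cast
    ring
  rw [hexp]
  push_cast
  ring

theorem ballMass_mul_prodLead_sum (n : ℕ) {β a ω : ℝ} (hβ : -1 < β) (ha : 0 < a) (hω : 0 < ω)
    (y : ℝ) :
    ((ballMass n β * a ^ (2 * (β + (n : ℝ) / 2) + 1) : ℝ) : ℂ) *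
      (ephase y * prodLead n β a 1 ω + ephase (-y) * prodLead n β a (-1) ω) =
      ((gibbsAmp n β a ω * Real.sin (2 * Real.pi * y - Real.pi * β / 2) : ℝ) : ℂ) := by
  have h1 := ballMass_mul_prodLead n hβ ha hω 1
  have h2 := ballMass_mul_prodLead n hβ ha hω (-1)
  rw [mul_add, mul_left_comm, h1, mul_left_comm _ (ephase (-y)), h2]
  have e1 : ephase y * Complex.exp (-(((1 : ℝ) : ℂ) * (Real.pi * β / 2)) * Complex.I) =
      Complex.exp (((2 * Real.pi * y - Real.pi * β / 2 : ℝ) : ℂ) * Complex.I) := by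
    rw [ephase, ← Complex.exp_add]; congr 1; push_cast; ring
  have e2 : ephase (-y) * Complex.exp (-(((-1 : ℝ) : ℂ) * (Real.pi * β / 2)) * Complex.I) =
      Complex.exp (-((2 * Real.pi * y - Real.pi * β / 2 : ℝ) : ℂ) * Complex.I) := by
    rw [ephase, ← Complex.exp_add]; congr 1; push_cast; ring
  calc _ = ((gibbsAmp n β a ω / 2 : ℝ) : ℂ) * (-Complex.I *
        (ephase y * Complex.exp (-(((1 : ℝ) : ℂ) * (Real.pi * β / 2)) * Complex.I)) + Complex.I *
        (ephase (-y) * Complex.exp (-(((-1 : ℝ) : ℂ) * (Real.pi * β / 2)) * Complex.I))) := by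
        push_cast; ring
    _ = _ := by
        rw [e1, e2, Complex.ofReal_mul, Complex.ofReal_sin, Complex.sin]
        push_cast
        ring

/-- The derivative term of `waveAmp` is one order lower in $t$, so the leading term is that of the
Hankel amplitude. Confining $\omega$ to $[a/2,2a]$ makes the constants uniform. -/
theorem exists_norm_waveAmp_sub_le (n : ℕ) {a : ℝ} (ha : 0 < a) :
    ∃ C : ℝ, 0 < C ∧ ∀ τ : ℝ, (τ = 1 ∨ τ = -1) → ∀ ω : ℝ, a / 2 ≤ ω → ω ≤ 2 * a → ∀ t : ℝ, 1 ≤ t →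
      ‖waveAmp n τ ω t - 2 * Real.pi * Complex.I * ((τ : ℂ) * ω) * ((ballMass n 0 : ℂ) *
        (hankelLead τ ((n : ℝ) / 2) * ((ω ^ (-((n : ℝ) / 2) - 1) : ℝ) : ℂ))) *
        ((t ^ ((n : ℝ) / 2) : ℝ) : ℂ)‖ ≤ C * t ^ ((n : ℝ) / 2 - 1) := by
  have ha2 : 0 < a / 2 := by positivity
  obtain ⟨C₁, hC₁, h₁⟩ := exists_norm_deriv_ballAmp_le n ha2
  obtain ⟨C₂, hC₂, h₂⟩ := exists_hankelAmp_sub_lead_le (neg_one_lt_half n) ha2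
  have hm := ballMass_pos n (γ := 0) (by norm_num)
  have hn0 : (0 : ℝ) ≤ n := n.cast_nonneg
  refine ⟨C₁ * (a / 2) ^ (-((n : ℝ) / 2) - 1) + 2 * Real.pi * (2 * a) * (ballMass n 0 *
    (C₂ * (a / 2) ^ (-((n : ℝ) / 2) - 2))), by positivity, fun τ hτ ω hω1 hω2 t ht => ?_⟩
  have htp : 0 < t := by linarith
  have hωp : 0 < ω := by linarith
  have hτ1 : |τ| = 1 := by rcases hτ with h | h <;> simp [h]
  have b1 := h₁ τ hτ1 ω hω1 t ht t (by simp; linarith)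
  have b2 := h₂ τ hτ (ω * t) (by nlinarith)
  set ν := (n : ℝ) / 2 with hν
  have ep : ((t : ℂ)) ^ (n + 1) * ((((ω * t) ^ (-ν - 1) : ℝ) : ℂ)) =
      ((ω ^ (-ν - 1) : ℝ) : ℂ) * ((t ^ ν : ℝ) : ℂ) := by
    rw [← Complex.ofReal_pow, ← Complex.ofReal_mul, ← Complex.ofReal_mul]
    congr 1
    rw [Real.mul_rpow hωp.le htp.le, mul_left_comm, ← Real.rpow_natCast, ← Real.rpow_add htp]
    congr 2; push_cast; rw [hν]; ring
  have key : waveAmp n τ ω t - 2 * Real.pi * Complex.I * ((τ : ℂ) * ω) * ((ballMass n 0 : ℂ) *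
        (hankelLead τ ν * ((ω ^ (-ν - 1) : ℝ) : ℂ))) * ((t ^ ν : ℝ) : ℂ) =
      deriv (ballAmp n τ ω) t + 2 * Real.pi * Complex.I * ((τ : ℂ) * ω) * ((ballMass n 0 : ℂ) *
        ((t : ℂ) ^ (n + 1) * (hankelAmp τ ν ((ω * t : ℝ) : ℂ) -
          hankelLead τ ν * (((ω * t) ^ (-ν - 1) : ℝ) : ℂ)))) := by
    rw [waveAmp, ballAmp, mul_sub, mul_left_comm ((t : ℂ) ^ (n + 1)) (hankelLead τ ν), ep,
      Complex.ofReal_mul]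
    ring
  rw [key]
  have n1 : ‖2 * (Real.pi : ℂ) * Complex.I * ((τ : ℂ) * ω)‖ = 2 * Real.pi * ω := by
    simp [abs_of_pos Real.pi_pos, hτ1, abs_of_pos hωp]
  have n2 : ‖(ballMass n 0 : ℂ)‖ = ballMass n 0 := by
    rw [Complex.norm_real, Real.norm_of_nonneg hm.le]
  have n3 : ‖(t : ℂ) ^ (n + 1)‖ = t ^ (n + 1) := by
    rw [norm_pow, Complex.norm_real, Real.norm_of_nonneg htp.le]
  refine (norm_add_le _ _).trans ?_
  rw [norm_mul, n1, norm_mul, n2, norm_mul, n3, add_mul]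
  have m1 : ω ^ (-ν - 1) ≤ (a / 2) ^ (-ν - 1) :=
    Real.rpow_le_rpow_of_nonpos ha2 hω1 (by rw [hν]; linarith)
  have m2 : ω ^ (-ν - 2) ≤ (a / 2) ^ (-ν - 2) :=
    Real.rpow_le_rpow_of_nonpos ha2 hω1 (by rw [hν]; linarith)
  have m3 : t ^ (n + 1) * (ω * t) ^ (-ν - 2) = ω ^ (-ν - 2) * t ^ (ν - 1) := by
    rw [Real.mul_rpow hωp.le htp.le, mul_left_comm, ← Real.rpow_natCast, ← Real.rpow_add htp]
    congr 2; push_cast; rw [hν]; ring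
  refine add_le_add (b1.trans ?_) ?_
  · calc C₁ * t ^ (ν - 1) * ω ^ (-ν - 1) ≤ C₁ * t ^ (ν - 1) * (a / 2) ^ (-ν - 1) := by gcongr
      _ = _ := by ring
  · calc _ ≤ 2 * Real.pi * (2 * a) * (ballMass n 0 * (t ^ (n + 1) * (C₂ * (ω * t) ^ (-ν - 2)))) := by
          gcongr
      _ = 2 * Real.pi * (2 * a) * (ballMass n 0 * (C₂ * (t ^ (n + 1) * (ω * t) ^ (-ν - 2)))) := by
          ring
      _ ≤ 2 * Real.pi * (2 * a) * (ballMass n 0 * (C₂ * ((a / 2) ^ (-ν - 2) * t ^ (ν - 1)))) := by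
          rw [m3]; gcongr
      _ = _ := by ring

/-- Product rule for asymptotics: $AW-A_0W_0=(A-A_0)W+A_0(W-W_0)$, each summand being one order
below $t^{-1-\beta}$. -/
theorem exists_norm_prodAmp_sub_lead_le (n : ℕ) {β a : ℝ} (hβ : -1 < β) (ha : 0 < a) :
    ∃ C : ℝ, 0 < C ∧ ∀ σ : ℝ, (σ = 1 ∨ σ = -1) → ∀ ω : ℝ, a / 2 ≤ ω → ω ≤ 2 * a → ∀ t : ℝ, 1 ≤ t →
      ‖prodAmp n β a 0 σ (-σ) ω t - prodLead n β a σ ω * ((t ^ (-1 - β) : ℝ) : ℂ)‖ ≤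
        C * t ^ (-2 - β) := by
  have ha2 : 0 < a / 2 := by positivity
  obtain ⟨C₁, hC₁, h₁⟩ := exists_norm_waveAmp_sub_le n ha
  obtain ⟨C₂, hC₂, h₂⟩ := exists_hankelAmp_sub_lead_le (neg_one_lt_add_half hβ n) ha
  obtain ⟨C₃, hC₃, h₃⟩ := exists_isSymbol_waveAmp n ha2
  set ν := (n : ℝ) / 2 with hν
  set μ := β + ν with hμ
  have hn0 : (0 : ℝ) ≤ n := n.cast_nonneg
  set D := ‖hankelLead 1 μ‖ + ‖hankelLead (-1) μ‖ with hD
  have hD0 : 0 ≤ D := by positivity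
  refine ⟨C₂ * a ^ (-μ - 2) * (C₃ * (a / 2) ^ (-ν)) + D * a ^ (-μ - 1) * C₁, by positivity,
    fun σ hσ ω hω1 hω2 t ht => ?_⟩
  have htp : 0 < t := by linarith
  have hωp : 0 < ω := by linarith
  have hσ' : -σ = 1 ∨ -σ = -1 := by rcases hσ with h | h <;> simp [h]
  have hσ1 : |-σ| = 1 := by rcases hσ with h | h <;> simp [h]
  have b1 := h₁ (-σ) hσ' ω hω1 hω2 t ht
  have b2 := h₂ σ hσ (a * t) (by nlinarith)
  have b3 := (h₃ (-σ) hσ1 ω hω1).norm_ofReal_le ht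
  set W : ℂ := 2 * Real.pi * Complex.I * (((-σ : ℝ) : ℂ) * ω) * ((ballMass n 0 : ℂ) *
        (hankelLead (-σ) ν * ((ω ^ (-ν - 1) : ℝ) : ℂ))) with hW
  have ep : ((((a * t) ^ (-μ - 1) : ℝ) : ℂ)) * ((t ^ ν : ℝ) : ℂ) =
      ((a ^ (-μ - 1) : ℝ) : ℂ) * ((t ^ (-1 - β) : ℝ) : ℂ) := by
    rw [← Complex.ofReal_mul, ← Complex.ofReal_mul]
    congr 1
    rw [Real.mul_rpow ha.le htp.le, mul_assoc, ← Real.rpow_add htp]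
    congr 2; rw [hμ]; ring
  have key : prodAmp n β a 0 σ (-σ) ω t - prodLead n β a σ ω * ((t ^ (-1 - β) : ℝ) : ℂ) =
      (hankelAmp σ μ ((a * t : ℝ) : ℂ) - hankelLead σ μ * (((a * t) ^ (-μ - 1) : ℝ) : ℂ)) *
        waveAmp n (-σ) ω t +
      hankelLead σ μ * (((a * t) ^ (-μ - 1) : ℝ) : ℂ) * (waveAmp n (-σ) ω t -
        W * ((t ^ ν : ℝ) : ℂ)) := by
    have e1 : prodLead n β a σ ω * ((t ^ (-1 - β) : ℝ) : ℂ) =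
        hankelLead σ μ * W * (((((a * t) ^ (-μ - 1) : ℝ) : ℂ)) * ((t ^ ν : ℝ) : ℂ)) := by
      rw [ep, prodLead, ← hν, ← hμ, ← hW]; ring
    rw [e1, prodAmp, ← hν, ← hμ, Complex.ofReal_mul]
    simp only [Complex.ofReal_zero, zero_mul, neg_zero, Complex.exp_zero, one_mul]
    ring
  rw [key]
  refine (norm_add_le _ _).trans ?_
  rw [norm_mul, norm_mul, norm_mul, Complex.norm_real, Real.norm_of_nonneg (by positivity), add_mul]
  have m1 : ω ^ (-ν) ≤ (a / 2) ^ (-ν) :=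
    Real.rpow_le_rpow_of_nonpos ha2 hω1 (by rw [hν]; linarith)
  have m2 : (a * t) ^ (-μ - 2) * t ^ ν = a ^ (-μ - 2) * t ^ (-2 - β) := by
    rw [Real.mul_rpow ha.le htp.le, mul_assoc, ← Real.rpow_add htp]
    congr 2; rw [hμ]; ring
  have m3 : (a * t) ^ (-μ - 1) * t ^ (ν - 1) = a ^ (-μ - 1) * t ^ (-2 - β) := by
    rw [Real.mul_rpow ha.le htp.le, mul_assoc, ← Real.rpow_add htp]
    congr 2; rw [hμ]; ring
  have m4 : ‖hankelLead σ μ‖ ≤ D := by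
    rcases hσ with h | h <;> rw [h, hD] <;> simp
  refine add_le_add ?_ ?_
  · calc _ ≤ C₂ * (a * t) ^ (-μ - 2) * (C₃ * (a / 2) ^ (-ν) * t ^ ν) := by
          gcongr
          exact b3.trans (by gcongr)
      _ = C₂ * (C₃ * (a / 2) ^ (-ν)) * ((a * t) ^ (-μ - 2) * t ^ ν) := by ring
      _ = _ := by rw [m2]; ring
  · calc _ ≤ D * (a * t) ^ (-μ - 1) * (C₁ * t ^ (ν - 1)) := by gcongr
      _ = D * C₁ * ((a * t) ^ (-μ - 1) * t ^ (ν - 1)) := by ring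
      _ = _ := by rw [m3]; ring

theorem continuousAt_bigU {d : ℕ} (β : ℝ) {a : ℝ} {w : EuclideanSpace ℝ (Fin d)}
    (hw : ‖w‖ ≠ a) : ContinuousAt (fun x : EuclideanSpace ℝ (Fin d) => (bigU β a x : ℂ)) w := by
  refine Complex.continuous_ofReal.continuousAt.comp ?_
  rcases lt_or_gt_of_ne hw with h | h
  · have h1 : (fun x : EuclideanSpace ℝ (Fin d) => (a ^ 2 - ‖x‖ ^ 2) ^ β) =ᶠ[𝓝 w] bigU β a := by
      filter_upwards [(continuous_norm.tendsto w).eventually (gt_mem_nhds h)] with x hx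
      rw [bigU, if_pos hx]
    refine ContinuousAt.congr ?_ h1
    refine ContinuousAt.rpow_const (by fun_prop) (Or.inl ?_)
    have : ‖w‖ ^ 2 < a ^ 2 := by gcongr
    linarith
  · have h1 : (fun _ : EuclideanSpace ℝ (Fin d) => (0 : ℝ)) =ᶠ[𝓝 w] bigU β a := by
      filter_upwards [(continuous_norm.tendsto w).eventually (lt_mem_nhds h)] with x hx
      rw [bigU, if_neg (by linarith)]
    exact continuousAt_const.congr h1

theorem gibbsAmp_nonneg (n : ℕ) {β a ω : ℝ} (hβ : -1 < β) (ha : 0 < a) (hω : 0 < ω) :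
    0 ≤ gibbsAmp n β a ω := by
  have := Real.Gamma_pos_of_pos (show 0 < β + 1 by linarith)
  unfold gibbsAmp
  positivity

theorem gibbsAmp_le (n : ℕ) {β a ω : ℝ} (hβ : -1 < β) (ha : 0 < a) (hω : a / 2 ≤ ω) :
    gibbsAmp n β a ω ≤ Real.Gamma (β + 1) * Real.pi ^ (-1 - β) * a ^ β * 2 ^ ((n : ℝ) / 2) := by
  have := Real.Gamma_pos_of_pos (show 0 < β + 1 by linarith)
  have hω0 : 0 < ω := by linarith
  unfold gibbsAmp
  gcongr
  rw [div_le_iff₀ hω0]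
  linarith

theorem prodAmp_eq_exp_mul (n : ℕ) (β a c σ τ ω t : ℝ) :
    prodAmp n β a c σ τ ω t =
      ((Real.exp (-c * t ^ 2) : ℝ) : ℂ) * prodAmp n β a 0 σ τ ω t := by
  simp [prodAmp]

/-- The opposite-sign part of the regularized high frequency integral. -/
theorem norm_integral_opposite_sub_main_le (n : ℕ) {β a : ℝ} (hβ : -1 < β) (ha : 0 < a) :
    ∃ K : ℝ, 0 < K ∧ ∀ ε q φ k l η ω c : ℝ, (ε = 1 ∨ ε = -1) → k = 2 * Real.pi * q →
      φ = ε * (β / 2) * Real.pi → 4 ≤ l → 0 < η → η ≤ 1 → 0 < c → a / 2 ≤ ω → ω ≤ 2 * a →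
      a - ω = ε * (q / l) →
      ‖((ballMass n β * a ^ (2 * (β + (n : ℝ) / 2) + 1) : ℝ) : ℂ) *
        ((∫ t in Set.Ioi (0 : ℝ), ephase ((a - ω) * t) *
            (stepCut (η⁻¹ * (t - l)) * prodAmp n β a c 1 (-1) ω t)) +
          ∫ t in Set.Ioi (0 : ℝ), ephase ((-a + ω) * t) *
            (stepCut (η⁻¹ * (t - l)) * prodAmp n β a c (-1) 1 ω t)) -
        ((gibbsAmp n β a ω * (ε * ∫ t in Set.Ioi l, oscWeight β c t *
          Real.sin (k * (l⁻¹ * t) - φ)) : ℝ) : ℂ)‖ ≤ K * l ^ (-1 - β) := by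
  obtain ⟨C, hC, hlead⟩ := exists_norm_prodAmp_sub_lead_le n hβ ha
  have hm := ballMass_pos n hβ
  set κ := ballMass n β * a ^ (2 * (β + (n : ℝ) / 2) + 1) with hκ
  have hκ0 : 0 < κ := by positivity
  set G := Real.Gamma (β + 1) * Real.pi ^ (-1 - β) * a ^ β * 2 ^ ((n : ℝ) / 2) with hG
  have hG0 : 0 < G := by
    have := Real.Gamma_pos_of_pos (show 0 < β + 1 by linarith)
    positivity
  have hβ1 : 0 < 1 + β := by linarith
  refine ⟨2 * κ * C * (1 + β)⁻¹ + G, by positivity,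
    fun ε q φ k l η ω c hε hk hφ hl hη hη1 hc hω1 hω2 hωl => ?_⟩
  have hlp : 0 < l := by linarith
  have hω0 : 0 < ω := by linarith
  have o2 : |(-1 : ℝ)| = 1 := by simp
  have hε2 : ε * ε = 1 := by rcases hε with h | h <;> rw [h] <;> norm_num
  have hε1 : |ε| = 1 := by rcases hε with h | h <;> simp [h]
  set F : ℝ → ℝ → ℝ → ℝ → ℂ := fun θ σ τ t => ephase (θ * t) *
    (stepCut (η⁻¹ * (t - l)) * prodAmp n β a c σ τ ω t) with hF
  set m : ℝ → ℝ := fun t => gibbsAmp n β a ω * (ε * (oscWeight β c t *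
    Real.sin (k * (l⁻¹ * t) - φ))) with hmdef
  have hFint : ∀ θ σ τ : ℝ, |σ| = 1 → |τ| = 1 → Integrable (F θ σ τ) := fun θ σ τ hσ hτ =>
    (integrable_stepCut_mul_prodAmp hβ ha hc hσ hτ hω0 hl hη hη1).bdd_mul (c := 1)
      (continuous_ephase.comp (by fun_prop)).aestronglyMeasurable
      (Eventually.of_forall fun x => (norm_ephase _).le)
  have hFzero : ∀ θ σ τ : ℝ, ∀ t ∈ Set.Ioi (0 : ℝ) \ Set.Ioi l, F θ σ τ t = 0 := by
    intro θ σ τ t ht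
    have ht' : t ≤ l := not_lt.1 ht.2
    simp only [hF]
    rw [stepCut_eq_zero (mul_nonpos_of_nonneg_of_nonpos (by positivity) (by linarith))]; ring
  have hsub : Set.Ioi l ⊆ Set.Ioi (0 : ℝ) := Set.Ioi_subset_Ioi hlp.le
  have hrestr : ∀ θ σ τ : ℝ, ∫ t in Set.Ioi (0 : ℝ), F θ σ τ t = ∫ t in Set.Ioi l, F θ σ τ t :=
    fun θ σ τ => setIntegral_eq_of_subset_of_forall_sdiff_eq_zero measurableSet_Ioi hsub
      (hFzero θ σ τ)
  have hmi : IntegrableOn m (Set.Ioi l) := by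
    have := integrableOn_oscWeight_mul_sin hβ hc hlp (k * l⁻¹) φ
    simp only [hmdef]
    refine ((this.congr_fun (fun t _ => ?_) measurableSet_Ioi).const_mul ε).const_mul _
    simp only [mul_assoc]
  have hmi' : Integrable (fun t => ((m t : ℝ) : ℂ)) (volume.restrict (Set.Ioi l)) := hmi.ofReal
  have hM : ((gibbsAmp n β a ω * (ε * ∫ t in Set.Ioi l, oscWeight β c t *
          Real.sin (k * (l⁻¹ * t) - φ)) : ℝ) : ℂ) = ∫ t in Set.Ioi l, ((m t : ℝ) : ℂ) := by
    rw [integral_complex_ofReal, ← integral_const_mul, ← integral_const_mul]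
  have hA : Integrable (fun t => (κ : ℂ) * (F (a - ω) 1 (-1) t + F (-a + ω) (-1) 1 t))
      (volume.restrict (Set.Ioi l)) :=
    ((hFint _ _ _ abs_one o2).integrableOn.add (hFint _ _ _ o2 abs_one).integrableOn).const_mul _
  have hsum : (κ : ℂ) * ((∫ t in Set.Ioi (0 : ℝ), F (a - ω) 1 (-1) t) +
      ∫ t in Set.Ioi (0 : ℝ), F (-a + ω) (-1) 1 t) =
      ∫ t in Set.Ioi l, (κ : ℂ) * (F (a - ω) 1 (-1) t + F (-a + ω) (-1) 1 t) := by
    have h1 : ∫ t in Set.Ioi l, (F (a - ω) 1 (-1) t + F (-a + ω) (-1) 1 t) = _ :=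
      integral_add (hFint _ _ _ abs_one o2).integrableOn (hFint _ _ _ o2 abs_one).integrableOn
    rw [integral_const_mul, h1, hrestr, hrestr]
  have hd : ∫ t in Set.Ioi l, ((κ : ℂ) * (F (a - ω) 1 (-1) t + F (-a + ω) (-1) 1 t) - (m t : ℝ)) = _ :=
    integral_sub hA hmi'
  change ‖(κ : ℂ) * ((∫ t in Set.Ioi (0 : ℝ), F (a - ω) 1 (-1) t) +
      ∫ t in Set.Ioi (0 : ℝ), F (-a + ω) (-1) 1 t) - _‖ ≤ _
  rw [hM, hsum, ← hd]
  -- Two errors: replacing the amplitudes by their leading terms costs $t^{-2-\beta}$, and replacing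
  -- the smooth step by the sharp one at $l$ costs $l^{-1-\beta}$ on a layer of length $\eta\le1$.
  -- Both integrate to $O(l^{-1-\beta})$.
  set bd : ℝ → ℝ := fun t => 2 * κ * C * t ^ (-2 - β) +
    (Set.Ioc l (l + η)).indicator (fun _ => G * l ^ (-1 - β)) t with hbd
  have hr : IntegrableOn (fun t : ℝ => 2 * κ * C * t ^ (-2 - β)) (Set.Ioi l) :=
    (integrableOn_Ioi_rpow_of_lt (by linarith) hlp).const_mul _
  have hind : Integrable ((Set.Ioc l (l + η)).indicator (fun _ : ℝ => G * l ^ (-1 - β))) := by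
    rw [integrable_indicator_iff measurableSet_Ioc]
    exact integrableOn_const (by simp)
  have hpt : ∀ t ∈ Set.Ioi l,
      ‖(κ : ℂ) * (F (a - ω) 1 (-1) t + F (-a + ω) (-1) 1 t) - (m t : ℝ)‖ ≤ bd t := by
    intro t ht
    have htl : l < t := ht
    have ht1 : 1 ≤ t := by linarith
    have ht0 : 0 < t := by linarith
    set y := (a - ω) * t with hy
    set e := Real.exp (-c * t ^ 2) with he
    have he1 : e ≤ 1 := by
      rw [he, Real.exp_le_one_iff]; nlinarith [mul_nonneg hc.le (sq_nonneg t)]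
    have he0 : 0 < e := Real.exp_pos _
    -- The phase $2\pi(a-\omega)t-\pi\beta/2$ equals $\varepsilon(kt/l-\varphi)$ because
    -- $\varepsilon^2=1$; oddness of the sine then takes $\varepsilon$ out.
    have hsin : Real.sin (2 * Real.pi * y - Real.pi * β / 2) =
        ε * Real.sin (k * (l⁻¹ * t) - φ) := by
      have h1 : 2 * Real.pi * y - Real.pi * β / 2 = ε * (k * (l⁻¹ * t) - φ) := by
        rw [hy, hωl, hk, hφ]
        have : ε * (ε * (β / 2) * Real.pi) = (ε * ε) * (β / 2 * Real.pi) := by ring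
        rw [mul_sub, this, hε2]
        field_simp
      rw [h1]
      rcases hε with h | h
      · rw [h, one_mul, one_mul]
      · rw [h, neg_one_mul, Real.sin_neg, neg_one_mul]
    have hml : ((m t : ℝ) : ℂ) = (e : ℂ) * ((t ^ (-1 - β) : ℝ) : ℂ) * ((κ : ℂ) *
        (ephase y * prodLead n β a 1 ω + ephase (-y) * prodLead n β a (-1) ω)) := by
      rw [hκ, ballMass_mul_prodLead_sum n hβ ha hω0 y, hsin, ← Complex.ofReal_mul,
        ← Complex.ofReal_mul]
      congr 1
      simp only [hmdef, oscWeight, ← he]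
      ring
    have hmn : |m t| ≤ G * l ^ (-1 - β) := by
      have h1 := gibbsAmp_le n hβ ha hω1
      have h2 := gibbsAmp_nonneg n hβ ha hω0
      have h3 : t ^ (-1 - β) ≤ l ^ (-1 - β) :=
        Real.rpow_le_rpow_of_nonpos hlp htl.le (by linarith)
      have h4 := Real.abs_sin_le_one (k * (l⁻¹ * t) - φ)
      simp only [hmdef, oscWeight]
      rw [abs_mul, abs_mul, abs_mul, hε1, one_mul, abs_of_nonneg h2, ← he,
        abs_of_nonneg (by positivity)]
      calc _ ≤ G * (1 * l ^ (-1 - β) * 1) := by gcongr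
        _ = _ := by ring
    have l1 := hlead 1 (Or.inl rfl) ω hω1 hω2 t ht1
    have l2 := hlead (-1) (Or.inr rfl) ω hω1 hω2 t ht1
    rw [neg_neg] at l2
    set R₁ := prodAmp n β a 0 1 (-1) ω t - prodLead n β a 1 ω * ((t ^ (-1 - β) : ℝ) : ℂ)
    set R₂ := prodAmp n β a 0 (-1) 1 ω t - prodLead n β a (-1) ω * ((t ^ (-1 - β) : ℝ) : ℂ)
    have hdec : (κ : ℂ) * (F (a - ω) 1 (-1) t + F (-a + ω) (-1) 1 t) - (m t : ℝ) =
        stepCut (η⁻¹ * (t - l)) * ((e : ℂ) * ((κ : ℂ) * (ephase y * R₁ + ephase (-y) * R₂))) -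
          (1 - stepCut (η⁻¹ * (t - l))) * (m t : ℝ) := by
      have hy2 : (-a + ω) * t = -y := by rw [hy]; ring
      simp only [hF]
      rw [hy2, ← hy, prodAmp_eq_exp_mul n β a c 1, prodAmp_eq_exp_mul n β a c (-1), ← he, hml]
      simp only [R₁, R₂]
      ring
    rw [hdec, hbd]
    refine (norm_sub_le _ _).trans (add_le_add ?_ ?_)
    · rw [norm_mul, norm_mul, norm_mul, Complex.norm_real, Complex.norm_real,
        Real.norm_of_nonneg he0.le, Real.norm_of_nonneg hκ0.le]
      have h5 : ‖ephase y * R₁ + ephase (-y) * R₂‖ ≤ 2 * (C * t ^ (-2 - β)) := by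
        refine (norm_add_le _ _).trans ?_
        rw [norm_mul, norm_mul, norm_ephase, norm_ephase]
        linarith
      calc _ ≤ 1 * (1 * (κ * (2 * (C * t ^ (-2 - β))))) := by
            gcongr
            exact norm_stepCut_le _
        _ = _ := by ring
    · rcases le_or_gt t (l + η) with h6 | h6
      · rw [Set.indicator_of_mem (show t ∈ Set.Ioc l (l + η) from ⟨htl, h6⟩), norm_mul,
          Complex.norm_real, Real.norm_eq_abs]
        calc _ ≤ 1 * (G * l ^ (-1 - β)) := by
              gcongr
              exact norm_one_sub_stepCut_le _
          _ = _ := one_mul _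
      · rw [Set.indicator_of_notMem (fun h => not_lt.2 h.2 h6), stepCut_eq_one, sub_self, zero_mul,
          norm_zero]
        rw [le_inv_mul_iff₀ hη]; linarith
  refine (norm_integral_le_of_norm_le (hr.add hind.integrableOn)
    ((ae_restrict_mem measurableSet_Ioi).mono hpt)).trans ?_
  have hI : ∫ t in Set.Ioi l, (2 * κ * C * t ^ (-2 - β) +
      (Set.Ioc l (l + η)).indicator (fun _ => G * l ^ (-1 - β)) t) = _ :=
    integral_add hr hind.integrableOn
  change ∫ t in Set.Ioi l, (2 * κ * C * t ^ (-2 - β) +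
      (Set.Ioc l (l + η)).indicator (fun _ => G * l ^ (-1 - β)) t) ≤ _
  rw [hI, integral_const_mul, integral_Ioi_rpow_of_lt (by linarith) hlp,
    setIntegral_indicator measurableSet_Ioc, Set.inter_eq_right.2 Set.Ioc_subset_Ioi_self,
    setIntegral_const, Real.volume_real_Ioc_of_le (by linarith), smul_eq_mul, add_mul]
  have hl0 : 0 < l ^ (-1 - β) := by positivity
  refine add_le_add (le_of_eq ?_) ?_
  · rw [show -2 - β + 1 = -1 - β by ring, show -1 - β = -(1 + β) by ring]
    field_simp
  · rw [add_sub_cancel_left]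
    have : 0 < G * l ^ (-1 - β) := by positivity
    nlinarith

/-- The high frequency part of `bigU` near the sphere `|x| = a`. -/
theorem exists_norm_bigU_sub_smoothed_sub_main_le (n : ℕ) {β a : ℝ} (hβ : -1 < β) (ha : 0 < a) :
    ∃ K : ℝ, 0 < K ∧ ∀ ε q φ k l η : ℝ, (ε = 1 ∨ ε = -1) → 0 < q → k = 2 * Real.pi * q →
      φ = ε * (β / 2) * Real.pi → k - φ = Real.pi → 4 ≤ l → 0 < η → η ≤ 1 → ∀ w : EucSucc n,
      a / 2 ≤ ‖w‖ → ‖w‖ ≤ 2 * a → a - ‖w‖ = ε * (q / l) →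
      ‖(bigU β a w : ℂ) - smoothed n β a l η w -
        ((gibbsAmp n β a ‖w‖ * (ε * (l ^ (-β) * oscValue β k φ 0)) : ℝ) : ℂ)‖ ≤
        K * l ^ (-1 - β) := by
  have ha2 : 0 < a / 2 := by positivity
  obtain ⟨C, hC, hsym⟩ := exists_isSymbol_prodAmp n hβ ha ha2
  obtain ⟨K₁, hK₁, hosc⟩ := isCutoff_stepCut.exists_norm_integral_le (p := -1 - β)
    (Or.inl (by linarith))
  obtain ⟨K₂, hK₂, hopp⟩ := norm_integral_opposite_sub_main_le n hβ ha
  have hmb := ballMass_pos n hβ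
  set κ := ballMass n β * a ^ (2 * (β + (n : ℝ) / 2) + 1) with hκ
  have hκ0 : 0 < κ := by positivity
  refine ⟨κ * (2 * (K₁ * (C * (a / 2) ^ (-((n : ℝ) / 2))) * a⁻¹)) + K₂, by positivity,
    fun ε q φ k l η hε hq hk hφ hkφ hl hη hη1 w hw1 hw2 hw => ?_⟩
  have hlp : 0 < l := by linarith
  have hω0 : 0 < ‖w‖ := by linarith
  have hw0 : w ≠ 0 := norm_pos_iff.1 hω0
  have hk0 : 0 < k := by rw [hk]; positivity
  -- Off the sphere `bigU` is continuous, as pointwise inversion requires.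
  have hwa : ‖w‖ ≠ a := by
    intro h
    rw [h, sub_self] at hw
    have : 0 < q / l := by positivity
    rcases hε with h | h <;> rw [h] at hw <;> linarith
  have hlim := (tendsto_highFrequency (l := l) hβ ha hη (continuousAt_bigU β hwa)).sub
    ((Complex.continuous_ofReal.tendsto _).comp
      (((tendsto_integral_oscWeight_scaled hβ hk0 hkφ hlp).const_mul ε).const_mul
        (gibbsAmp n β a ‖w‖)))
  refine le_of_tendsto hlim.norm ?_
  filter_upwards [Ioi_mem_atTop 0] with c (hc : 0 < c)
  have hc' : 0 < c⁻¹ := inv_pos.2 hc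
  have o1 : |(1 : ℝ)| = 1 := abs_one
  have o2 : |(-1 : ℝ)| = 1 := by simp
  set F : ℝ → ℝ → ℝ → ℝ → ℂ := fun θ σ τ t => ephase (θ * t) *
    (stepCut (η⁻¹ * (t - l)) * prodAmp n β a c⁻¹ σ τ ‖w‖ t) with hF
  have hsplit : ∀ t ∈ Set.Ioi (0 : ℝ), stepCut (η⁻¹ * (t - l)) *
      (Complex.exp (-(((c⁻¹ : ℝ) : ℂ) * (t : ℂ) ^ 2)) * radialFT n β a t * sphereWave w t) =
      (κ : ℂ) * (F (a + ‖w‖) 1 1 t + F (a - ‖w‖) 1 (-1) t + F (-a + ‖w‖) (-1) 1 t +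
        F (-a - ‖w‖) (-1) (-1) t) := by
    intro t ht
    rw [gaussian_mul_radialFT_mul_sphereWave hβ ha hw0 ht]
    simp only [hF]; ring
  have hFint : ∀ θ σ τ : ℝ, |σ| = 1 → |τ| = 1 → Integrable (F θ σ τ) := fun θ σ τ hσ hτ =>
    (integrable_stepCut_mul_prodAmp hβ ha hc' hσ hτ hω0 hl hη hη1).bdd_mul (c := 1)
      (continuous_ephase.comp (by fun_prop)).aestronglyMeasurable
      (Eventually.of_forall fun x => (norm_ephase _).le)
  have hi : ∀ θ σ τ : ℝ, |σ| = 1 → |τ| = 1 → IntegrableOn (F θ σ τ) (Set.Ioi 0) :=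
    fun θ σ τ hσ hτ => (hFint θ σ τ hσ hτ).integrableOn
  -- The same-sign frequencies $\pm(a+\|w\|)$ stay away from zero, so a single integration by parts
  -- suffices, and with $j=1$ the powers of $\eta$ cancel.
  have hFb : ∀ θ σ τ : ℝ, |σ| = 1 → |τ| = 1 → a ≤ |θ| →
      ‖∫ t in Set.Ioi (0 : ℝ), F θ σ τ t‖ ≤
        K₁ * (C * (a / 2) ^ (-((n : ℝ) / 2))) * a⁻¹ * l ^ (-1 - β) := by
    intro θ σ τ hσ hτ hθ
    have hθ0 : 0 < |θ| := by linarith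
    have hFzero : ∀ t ∉ Set.Ioi (0 : ℝ), F θ σ τ t = 0 := by
      intro t ht
      have ht' : t ≤ 0 := not_lt.1 ht
      simp only [hF]
      rw [stepCut_eq_zero (mul_nonpos_of_nonneg_of_nonpos (by positivity) (by linarith))]; ring
    rw [setIntegral_eq_integral_of_forall_compl_eq_zero hFzero]
    have h1 := hosc _ _ (hsym c⁻¹ σ τ hc'.le hσ hτ ‖w‖ hw1) l η hl hη hη1
      (integrable_stepCut_mul_prodAmp hβ ha hc' hσ hτ hω0 hl hη hη1) 1 le_rfl (by norm_num) θ
      (abs_pos.1 hθ0)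
    rw [pow_one, pow_one, mul_inv_cancel₀ hη.ne', mul_one] at h1
    have m1 : ‖w‖ ^ (-((n : ℝ) / 2)) ≤ (a / 2) ^ (-((n : ℝ) / 2)) :=
      Real.rpow_le_rpow_of_nonpos ha2 hw1 (by linarith [(n.cast_nonneg : (0 : ℝ) ≤ n)])
    calc _ ≤ _ := h1
      _ ≤ K₁ * (C * (a / 2) ^ (-((n : ℝ) / 2))) * l ^ (-1 - β) * a⁻¹ := by gcongr
      _ = _ := by ring
  have h2 := hopp ε q φ k l η ‖w‖ c⁻¹ hε hk hφ hl hη hη1 hc' hw1 hw2 hw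
  rw [setIntegral_congr_fun measurableSet_Ioi hsplit, integral_const_mul,
    integral_add_four (hi _ _ _ o1 o1) (hi _ _ _ o1 o2) (hi _ _ _ o2 o1) (hi _ _ _ o2 o2)]
  have b1 := hFb (a + ‖w‖) 1 1 o1 o1 (by rw [abs_of_pos (by linarith)]; linarith)
  have b4 := hFb (-a - ‖w‖) (-1) (-1) o2 o2 (by rw [abs_of_neg (by linarith)]; linarith)
  simp only [Function.comp_apply]
  set X := ∫ t in Set.Ioi (0 : ℝ), F (a - ‖w‖) 1 (-1) t
  set Y := ∫ t in Set.Ioi (0 : ℝ), F (-a + ‖w‖) (-1) 1 t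
  set M := ((gibbsAmp n β a ‖w‖ * (ε * ∫ t in Set.Ioi l, oscWeight β c⁻¹ t *
          Real.sin (k * (l⁻¹ * t) - φ)) : ℝ) : ℂ)
  set A := ∫ t in Set.Ioi (0 : ℝ), F (a + ‖w‖) 1 1 t
  set B := ∫ t in Set.Ioi (0 : ℝ), F (-a - ‖w‖) (-1) (-1) t
  change ‖(κ : ℂ) * (X + Y) - M‖ ≤ _ at h2
  have hdec : (κ : ℂ) * (A + X + Y + B) - M = (κ : ℂ) * (A + B) + ((κ : ℂ) * (X + Y) - M) := by ring
  have h3 : ‖(κ : ℂ) * (A + B)‖ ≤ κ * (2 * (K₁ * (C * (a / 2) ^ (-((n : ℝ) / 2))) * a⁻¹ *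
      l ^ (-1 - β))) := by
    rw [norm_mul, Complex.norm_real, Real.norm_of_nonneg hκ0.le]
    gcongr
    exact (norm_add_le _ _).trans (by linarith)
  rw [hdec]
  refine (norm_add_le _ _).trans ((add_le_add h3 h2).trans (le_of_eq ?_))
  ring

/-! ### From smooth to sharp truncation on the torus -/

theorem measurableSet_torus (d : ℕ) : MeasurableSet (torus d) := by
  have : torus d = ⋂ i, {x : EuclideanSpace ℝ (Fin d) | x i ∈ Set.Ioc (-(1 / 2 : ℝ)) (1 / 2)} := by
    ext x; simp [torus]
  rw [this]
  exact MeasurableSet.iInter fun i => measurableSet_Ioc.preimage (by fun_prop)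

/-- A nonzero integer shift pushes some coordinate to modulus at least $1/2>a$, so only the
unshifted term of the periodization survives. -/
theorem smallU_eq_bigU {d : ℕ} (β : ℝ) {a : ℝ} (ha : a < 1 / 2) {x : EuclideanSpace ℝ (Fin d)}
    (hx : x ∈ torus d) : smallU β a x = bigU β a x := by
  rw [smallU, tsum_eq_single 0, latticePoint_zero, add_zero]
  intro k hk
  obtain ⟨i, hi⟩ := Function.ne_iff.1 hk
  have h1 : 1 / 2 ≤ ‖(x + latticePoint k) i‖ := by
    obtain ⟨h2, h3⟩ := hx i
    rw [PiLp.add_apply, latticePoint_apply, Real.norm_eq_abs]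
    rcases lt_or_gt_of_ne hi with h | h
    · have : (k i : ℝ) ≤ -1 := by
        have h' : k i ≤ -1 := by simp only [Pi.zero_apply] at h; omega
        exact_mod_cast h'
      exact le_trans (by linarith) (neg_le_abs _)
    · have : (1 : ℝ) ≤ k i := by
        have h' : 1 ≤ k i := by simp only [Pi.zero_apply] at h; omega
        exact_mod_cast h'
      exact le_trans (by linarith) (le_abs_self _)
  have h2 := PiLp.norm_apply_le (x + latticePoint k) i
  rw [bigU, if_neg (by linarith)]

/-- Since $a<1/2$ the ball of radius $a$ lies inside the fundamental cube, and the integral over the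
cube is the one over the whole space. -/
theorem torusCoeff_smallU {n : ℕ} {β a : ℝ} (hβ : -1 < β) (ha0 : 0 < a) (ha : a < 1 / 2)
    (m : Fin (n + 1) → ℤ) :
    torusCoeff (smallU β a) m = radialFT n β a ‖latticePoint m‖ := by
  rw [← fourier_bigU_eq_radialFT hβ ha0, Real.fourier_eq', torusCoeff,
    setIntegral_congr_fun (measurableSet_torus _) (g := fun x : EucSucc n =>
      (bigU β a x : ℂ) * character (-m) x) (fun x hx => by simp only [smallU_eq_bigU β ha hx]),
    setIntegral_eq_integral_of_forall_compl_eq_zero]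
  · congr 1; funext x
    rw [character, smul_eq_mul, mul_comm]
    congr 2
    rw [PiLp.inner_apply]
    simp only [RCLike.inner_apply, latticePoint_apply, Pi.neg_apply]
    push_cast
    simp only [neg_mul, mul_neg, Finset.sum_neg_distrib, Finset.mul_sum, Finset.sum_mul]
    congr 1
    refine Finset.sum_congr rfl fun i _ => ?_
    simp
    ring
  · intro x hx
    have : ¬ ‖x‖ < a := by
      intro h
      refine hx fun i => ?_
      have h1 := (PiLp.norm_apply_le x i).trans_lt h
      rw [Real.norm_eq_abs, abs_lt] at h1
      constructor <;> linarith [h1.1, h1.2]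
    rw [bigU, if_neg this]
    simp

/-- Sharp and smooth cutoffs of the Fourier series differ by the terms in a thin shell. -/
theorem exists_norm_sphericalSum_sub_le {n : ℕ} (hn : n ≤ 3) {β a : ℝ} (hβ : -1 < β) (ha0 : 0 < a)
    (ha : a < 1 / 2) :
    ∃ K : ℝ, 0 < K ∧ ∀ l η : ℝ, 4 ≤ l → 0 < η → η ≤ 1 → ∀ x : EucSucc n,
      ‖sphericalSum l (smallU β a) x - ∑ m ∈ (finite_lattice_ball (n + 1) (l + η)).toFinset,
        smoothedFT n β a l η (latticePoint m) * character m x‖ ≤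
        K * (l ^ n * η + l ^ ((n : ℝ) / 2) * η ^ (-(8 / 5) : ℝ)) *
          l ^ (-(β + (n : ℝ) / 2) - 1) := by
  obtain ⟨K₁, hK₁, hcard⟩ := exists_card_shell_le hn
  obtain ⟨C, hC, hrad⟩ := exists_norm_radialFT_le n hβ ha0
  refine ⟨K₁ * C, by positivity, fun l η hl hη hη1 x => ?_⟩
  have hlp : 0 < l := by linarith
  set T := (finite_lattice_ball (n + 1) (l + η)).toFinset with hT
  set f : (Fin (n + 1) → ℤ) → ℂ := fun m => smoothedFT n β a l η (latticePoint m) * character m x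
  have hmemT : ∀ m, m ∈ T ↔ ‖latticePoint m‖ < l + η := fun m => by
    rw [hT, Set.Finite.mem_toFinset]; rfl
  have hball : (finite_lattice_ball (n + 1) l).toFinset = T.filter fun m => ‖latticePoint m‖ < l := by
    ext m
    rw [Finset.mem_filter, hmemT, Set.Finite.mem_toFinset]
    change ‖latticePoint m‖ < l ↔ _
    constructor
    · intro h; exact ⟨by linarith, h⟩
    · exact fun h => h.2
  have h1 : sphericalSum l (smallU β a) x = ∑ m ∈ T.filter fun m => ‖latticePoint m‖ < l, f m := by
    rw [sphericalSum, hball]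
    refine Finset.sum_congr rfl fun m hm => ?_
    have hml := (Finset.mem_filter.1 hm).2
    simp only [f]
    rw [torusCoeff_smallU hβ ha0 ha, smoothedFT, stepCut_eq_zero, sub_zero, one_mul]
    exact mul_nonpos_of_nonneg_of_nonpos (by positivity) (by linarith)
  have h2 := Finset.sum_filter_add_sum_filter_not T (fun m => ‖latticePoint m‖ < l) f
  rw [h1, ← h2, sub_add_cancel_left, norm_neg]
  set s := T.filter fun m => ¬ ‖latticePoint m‖ < l with hs
  have hcs := hcard l η hl hη hη1 s fun m hm => by
    obtain ⟨u, v⟩ := Finset.mem_filter.1 hm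
    exact ⟨not_lt.1 v, ((hmemT m).1 u).le⟩
  -- Inside the radius $l$ the smooth multiplier is 1, so the two sums differ only on the shell,
  -- where each term has the size of $\hat U$ at radius $l$.
  have hterm : ∀ m ∈ s, ‖f m‖ ≤ C * l ^ (-(β + (n : ℝ) / 2) - 1) := by
    intro m hm
    obtain ⟨u, v⟩ := Finset.mem_filter.1 hm
    have v' : l ≤ ‖latticePoint m‖ := not_lt.1 v
    simp only [f]
    rw [norm_mul, norm_character, mul_one, smoothedFT, norm_mul]
    calc _ ≤ 1 * (C * ‖latticePoint m‖ ^ (-(β + (n : ℝ) / 2) - 1)) := by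
          gcongr
          · exact norm_one_sub_stepCut_le _
          · exact hrad _ (by linarith)
      _ = C * ‖latticePoint m‖ ^ (-(β + (n : ℝ) / 2) - 1) := one_mul _
      _ ≤ _ := by
          refine mul_le_mul_of_nonneg_left (Real.rpow_le_rpow_of_nonpos hlp v' ?_) hC.le
          linarith [neg_one_lt_add_half hβ n]
  calc _ ≤ ∑ m ∈ s, ‖f m‖ := norm_sum_le _ _
    _ ≤ s.card • (C * l ^ (-(β + (n : ℝ) / 2) - 1)) := Finset.sum_le_card_nsmul _ _ _ hterm
    _ = s.card * (C * l ^ (-(β + (n : ℝ) / 2) - 1)) := nsmul_eq_mul _ _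
    _ ≤ K₁ * (l ^ n * η + l ^ ((n : ℝ) / 2) * η ^ (-(8 / 5) : ℝ)) *
        (C * l ^ (-(β + (n : ℝ) / 2) - 1)) := by gcongr
    _ = _ := by ring

/-- The error of the spherical partial sums near the sphere `|x| = a`. -/
theorem exists_norm_sphericalSum_sub_main_le {n : ℕ} (hn : n ≤ 3) {β a : ℝ} (hβ : -1 < β)
    (ha0 : 0 < a) (ha : a < 1 / 2) :
    ∃ K : ℝ, 0 < K ∧ ∀ ε q φ k l : ℝ, (ε = 1 ∨ ε = -1) → 0 < q → k = 2 * Real.pi * q →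
      φ = ε * (β / 2) * Real.pi → k - φ = Real.pi → 4 ≤ l → ∀ x : EucSucc n, x ∈ torus (n + 1) →
      a / 2 ≤ ‖x‖ → ‖x‖ ≤ 2 * a → ‖x‖ ≤ 1 / 2 → a - ‖x‖ = ε * (q / l) →
      ‖sphericalSum l (smallU β a) x - (smallU β a x : ℂ) +
        ((gibbsAmp n β a ‖x‖ * (ε * (l ^ (-β) * oscValue β k φ 0)) : ℝ) : ℂ)‖ ≤
        K * l ^ (-β) * l ^ (-(1 / 25) : ℝ) := by
  obtain ⟨K₁, hK₁, h₁⟩ := exists_norm_sphericalSum_sub_le hn hβ ha0 ha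
  obtain ⟨K₂, hK₂, h₂⟩ := exists_norm_bigU_sub_smoothed_le n hβ ha0 ha
  obtain ⟨S, hS, h₃⟩ := exists_norm_lattice_sum_sub_integral_le hn
  obtain ⟨K₄, hK₄, h₄⟩ := exists_norm_bigU_sub_smoothed_sub_main_le n hβ ha0
  refine ⟨2 * K₁ + S * K₂ + K₄, by positivity,
    fun ε q φ k l hε hq hk hφ hkφ hl x hxt hx1 hx2 hx3 hx => ?_⟩
  have hlp : 0 < l := by linarith
  have hl1 : 1 ≤ l := by linarith
  -- For $n=3$ the shell volume term asks $l^{1/2}\eta\to0$, and the Poisson terms ask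
  -- $l^{-1}\eta^{-8/5}\to0$; the exponent $3/5$ lies between $1/2$ and $5/8$. The second condition
  -- leaves exactly $l^{-1/25}$.
  set η := l ^ (-(3 / 5) : ℝ) with hη
  have hη0 : 0 < η := by positivity
  have hη1 : η ≤ 1 := Real.rpow_le_one_of_one_le_of_nonpos hl1 (by norm_num)
  have hη8 : η ^ (-(8 / 5) : ℝ) = l ^ (24 / 25 : ℝ) := by
    rw [hη, ← Real.rpow_mul hlp.le]; norm_num
  have b1 := h₁ l η hl hη0 hη1 x
  have b3 := h₃ (smoothedFT n β a l η) (continuous_smoothedFT hβ ha0 l η)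
    (integrable_smoothedFT hβ ha0 hη0) (K₂ * l ^ (-1 - β)) η (by positivity) hη0
    (fun w hw j hj1 hj3 => h₂ w hw l η hl hη0 hη1 j hj1 hj3) x hx3
    (finite_lattice_ball (n + 1) (l + η)).toFinset (fun m hm => by
      refine smoothedFT_eq_zero hη0 (not_lt.1 fun h => hm ?_)
      rw [Set.Finite.mem_toFinset]; exact h)
  have b4 := h₄ ε q φ k l η hε hq hk hφ hkφ hl hη0 hη1 x hx1 hx2 hx
  rw [smallU_eq_bigU β ha hxt]
  change ‖_ - smoothed n β a l η x‖ ≤ _ at b3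
  set A := sphericalSum l (smallU β a) x
  set B := ∑ m ∈ (finite_lattice_ball (n + 1) (l + η)).toFinset,
        smoothedFT n β a l η (latticePoint m) * character m x
  set M := ((gibbsAmp n β a ‖x‖ * (ε * (l ^ (-β) * oscValue β k φ 0)) : ℝ) : ℂ)
  -- Sharp minus smooth sum, the nonzero Poisson translates, and the high-frequency remainder at $x$
  -- itself.
  have hdec : A - (bigU β a x : ℂ) + M = (A - B) + (B - smoothed n β a l η x) -
      ((bigU β a x : ℂ) - smoothed n β a l η x - M) := by ring
  rw [hdec]
  refine (norm_sub_le _ _).trans ((add_le_add ((norm_add_le _ _).trans (add_le_add b1 b3)) b4).trans ?_)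
  set D := l ^ (-β) * l ^ (-(1 / 25) : ℝ) with hD
  have hn' : (n : ℝ) ≤ 3 := by exact_mod_cast hn
  have hDe : D = l ^ (-β - 1 / 25) := by rw [hD, ← Real.rpow_add hlp]; congr 1
  have c1 : l ^ n * η * l ^ (-(β + (n : ℝ) / 2) - 1) ≤ D := by
    rw [hDe, hη, ← Real.rpow_natCast, ← Real.rpow_add hlp, ← Real.rpow_add hlp]
    exact Real.rpow_le_rpow_of_exponent_le hl1 (by linarith)
  have c2 : l ^ ((n : ℝ) / 2) * η ^ (-(8 / 5) : ℝ) * l ^ (-(β + (n : ℝ) / 2) - 1) ≤ D := by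
    rw [hDe, hη8, ← Real.rpow_add hlp, ← Real.rpow_add hlp]
    exact Real.rpow_le_rpow_of_exponent_le hl1 (by linarith)
  have c3 : l ^ (-1 - β) * η ^ (-(8 / 5) : ℝ) ≤ D := by
    rw [hDe, hη8, ← Real.rpow_add hlp]
    exact Real.rpow_le_rpow_of_exponent_le hl1 (by linarith)
  have c4 : l ^ (-1 - β) ≤ D := by
    rw [hDe]
    exact Real.rpow_le_rpow_of_exponent_le hl1 (by linarith)
  calc _ = K₁ * (l ^ n * η * l ^ (-(β + (n : ℝ) / 2) - 1) +
        l ^ ((n : ℝ) / 2) * η ^ (-(8 / 5) : ℝ) * l ^ (-(β + (n : ℝ) / 2) - 1)) +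
        S * K₂ * (l ^ (-1 - β) * η ^ (-(8 / 5) : ℝ)) + K₄ * l ^ (-1 - β) := by ring
    _ ≤ K₁ * (D + D) + S * K₂ * D + K₄ * D := by gcongr
    _ = _ := by rw [hD]; ring

/-! ### The Gibbs constant and the conclusion -/

theorem neg_one_lt_of_threshold_lt {n : ℕ} (hn : n ≤ 3) {β : ℝ} (h : threshold (n + 1) < β) :
    -1 < β := by
  refine lt_of_le_of_lt ?_ h
  rw [threshold]
  interval_cases n <;> norm_num

/-- Because $2+\varepsilon\beta=4q$, the powers of $2q$ in the constant and in the value of the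
improper integral cancel, leaving the limit of `gibbsAmp` as $\omega\to a$. -/
theorem gibbsConst_eq {ε β a q : ℝ} (hq : 0 < q) (h4 : 2 + ε * β = 4 * q) (J : ℝ) :
    gibbsConst ε β a ((2 * Real.pi * q) ^ (-β) * J) =
      -(Real.Gamma (β + 1) * Real.pi ^ (-1 - β) * a ^ β * (ε * J)) := by
  have hπ := Real.pi_pos
  have e1 : (2 + ε * β) ^ β = 2 ^ β * (2 * q) ^ β := by
    rw [h4, ← Real.mul_rpow two_pos.le (by positivity)]; congr 1; ring
  have e2 : (2 * Real.pi * q) ^ (-β) = Real.pi ^ (-β) * ((2 * q) ^ β)⁻¹ := by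
    rw [show 2 * Real.pi * q = Real.pi * (2 * q) by ring,
      Real.mul_rpow hπ.le (by positivity), Real.rpow_neg (show 0 ≤ 2 * q by positivity)]
  have e3 : Real.pi ^ (-1 - β) = Real.pi ^ (-β) / Real.pi := by
    rw [show -1 - β = -β - 1 by ring, Real.rpow_sub_one hπ.ne']
  have h5 : (2 * q) ^ β ≠ 0 := by positivity
  have h6 : (2 : ℝ) ^ β ≠ 0 := by positivity
  rw [gibbsConst, e1, e2, e3]
  field_simp

theorem tendsto_gibbsAmp (n : ℕ) {β a : ℝ} (ha : 0 < a) {u : ℝ → ℝ}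
    (hu : Tendsto u atTop (𝓝 a)) :
    Tendsto (fun l => gibbsAmp n β a (u l)) atTop
      (𝓝 (Real.Gamma (β + 1) * Real.pi ^ (-1 - β) * a ^ β)) := by
  have h1 : Tendsto (fun l => a / u l) atTop (𝓝 1) := by
    have := (tendsto_const_nhds (x := a)).div hu ha.ne'
    rwa [div_self ha.ne'] at this
  have h2 : Tendsto (fun l => (a / u l) ^ ((n : ℝ) / 2)) atTop (𝓝 1) := by
    have := h1.rpow_const (p := (n : ℝ) / 2) (Or.inl one_ne_zero)
    rwa [Real.one_rpow] at this
  have := h2.const_mul (Real.Gamma (β + 1) * Real.pi ^ (-1 - β) * a ^ β)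
  rwa [mul_one] at this

end SphericalFourier
end

open SphericalFourier in
theorem theorem4 (d : ℕ) (hd1 : 1 ≤ d) (hd4 : d ≤ 4) (β a : ℝ)
    (hβ : threshold d < β) (hβ0 : β ≤ 0) (ha0 : 0 < a) (ha : a < 1 / 2)
    (ε : ℝ) (hε : ε = 1 ∨ ε = -1) :
    ∃ I : ℝ, HasImproperIntegral (gibbsIntegrand ε β) Real.pi I ∧
      0 < ε * gibbsConst ε β a I ∧
      ∀ x₀ ∈ sphereSet d a, ∀ x : ℝ → EuclideanSpace ℝ (Fin d),
        (∀ᶠ l in atTop, x l ∈ torus d) →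
        Tendsto x atTop (𝓝 x₀) →
        (∀ᶠ l in atTop, ‖x l‖ = a - ε * ((2 + ε * β) / (4 * l))) →
        Tendsto (fun l : ℝ =>
            (sphericalSum l (smallU β a) (x l) - (smallU β a (x l) : ℂ)) / ((l ^ (-β) : ℝ) : ℂ))
          atTop (𝓝 ((gibbsConst ε β a I : ℝ) : ℂ)) := by
  obtain ⟨n, rfl⟩ : ∃ n, d = n + 1 := ⟨d - 1, by omega⟩
  have hn : n ≤ 3 := by omega
  have hβ1 : -1 < β := neg_one_lt_of_threshold_lt hn hβ
  have hε2 : ε * ε = 1 := by rcases hε with h | h <;> rw [h] <;> norm_num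
  -- The signed distance to the sphere is $\varepsilon q/l$, so $2\pi q$ is the frequency after
  -- rescaling radii by $l$.
  obtain ⟨q, hq⟩ : ∃ q, q = (2 + ε * β) / 4 := ⟨_, rfl⟩
  have hq4 : 2 + ε * β = 4 * q := by rw [hq]; ring
  have hq0 : 0 < q := by rcases hε with h | h <;> rw [hq, h] <;> linarith
  have hk0 : 0 < 2 * Real.pi * q := by positivity
  have hkφ : 2 * Real.pi * q - ε * (β / 2) * Real.pi = Real.pi := by rw [hq]; ring
  have hJ := oscValue_zero_neg (φ := ε * (β / 2) * Real.pi) hβ1 hk0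
  set J := oscValue β (2 * Real.pi * q) (ε * (β / 2) * Real.pi) 0 with hJd
  set G := Real.Gamma (β + 1) * Real.pi ^ (-1 - β) * a ^ β with hG
  have hG0 : 0 < G := by
    have := Real.Gamma_pos_of_pos (show 0 < β + 1 by linarith)
    have := Real.pi_pos
    positivity
  refine ⟨(2 * Real.pi * q) ^ (-β) * J, hasImproperIntegral_gibbsIntegrand hβ1 hk0 hkφ, ?_, ?_⟩
  -- The factor $\varepsilon^2=1$ leaves $-GJ$, positive because $J<0$.
  · rw [gibbsConst_eq hq0 hq4, ← hG]
    have : ε * -(G * (ε * J)) = (ε * ε) * (G * -J) := by ring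
    rw [this, hε2, one_mul]
    exact mul_pos hG0 (by linarith)
  · intro x₀ _ x hxt _ hxn
    rw [gibbsConst_eq hq0 hq4, ← hG]
    obtain ⟨K, hK, hmain⟩ := exists_norm_sphericalSum_sub_main_le hn hβ1 ha0 ha
    have hxa : Tendsto (fun l => ‖x l‖) atTop (𝓝 a) := by
      have h1 : Tendsto (fun l : ℝ => a - ε * (q * l⁻¹)) atTop (𝓝 (a - ε * (q * 0))) :=
        ((tendsto_inv_atTop_zero.const_mul q).const_mul ε).const_sub a
      rw [mul_zero, mul_zero, sub_zero] at h1
      refine h1.congr' ?_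
      filter_upwards [hxn] with l hl
      rw [hl, hq4, mul_div_mul_left _ _ (by norm_num : (4 : ℝ) ≠ 0), div_eq_mul_inv]
    have hamp := (tendsto_gibbsAmp n (β := β) ha0 hxa).mul_const (ε * J)
    have hamp' := ((Complex.continuous_ofReal.tendsto _).comp hamp.neg)
    have herr : Tendsto (fun l : ℝ => (sphericalSum l (smallU β a) (x l) - (smallU β a (x l) : ℂ)) /
        ((l ^ (-β) : ℝ) : ℂ) - ((-(gibbsAmp n β a ‖x l‖ * (ε * J)) : ℝ) : ℂ)) atTop (𝓝 0) := by
      -- After division by $l^{-\beta}$ the error bound is $Kl^{-1/25}$; the amplitude converges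
      -- because $\|x_l\|\to a$.
      have hz : Tendsto (fun l : ℝ => K * l ^ (-(1 / 25) : ℝ)) atTop (𝓝 0) := by
        simpa using (tendsto_rpow_neg_atTop (show (0 : ℝ) < 1 / 25 by norm_num)).const_mul K
      refine squeeze_zero_norm' ?_ hz
      filter_upwards [hxn, hxt, eventually_ge_atTop 4,
        hxa.eventually_const_le (show a / 2 < a by linarith),
        hxa.eventually_le_const (show a < 2 * a by linarith), hxa.eventually_le_const ha]
        with l hl1 hl2 hl3 hl4 hl5 hl6
      have hlp : 0 < l := by linarith
      have h1 : a - ‖x l‖ = ε * (q / l) := by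
        rw [hl1, hq4, mul_div_mul_left _ _ (by norm_num : (4 : ℝ) ≠ 0)]; ring
      have h2 := hmain ε q _ _ l hε hq0 rfl rfl hkφ hl3 (x l) hl2 hl4 hl5 hl6 h1
      have hL : 0 < l ^ (-β) := by positivity
      have hL' : ((l ^ (-β) : ℝ) : ℂ) ≠ 0 := by exact_mod_cast hL.ne'
      rw [← hJd] at h2
      have h3 : (sphericalSum l (smallU β a) (x l) - (smallU β a (x l) : ℂ)) /
          ((l ^ (-β) : ℝ) : ℂ) - ((-(gibbsAmp n β a ‖x l‖ * (ε * J)) : ℝ) : ℂ) =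
          (sphericalSum l (smallU β a) (x l) - (smallU β a (x l) : ℂ) +
            ((gibbsAmp n β a ‖x l‖ * (ε * (l ^ (-β) * J)) : ℝ) : ℂ)) / ((l ^ (-β) : ℝ) : ℂ) := by
        rw [add_div, Complex.ofReal_neg, sub_neg_eq_add,
          show gibbsAmp n β a ‖x l‖ * (ε * (l ^ (-β) * J)) =
            gibbsAmp n β a ‖x l‖ * (ε * J) * l ^ (-β) by ring,
          Complex.ofReal_mul (gibbsAmp n β a ‖x l‖ * (ε * J)), mul_div_cancel_right₀ _ hL']
      rw [h3, norm_div, Complex.norm_real, Real.norm_of_nonneg hL.le, div_le_iff₀ hL]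
      exact h2.trans (le_of_eq (by ring))
    have hsum := herr.add hamp'
    rw [zero_add] at hsum
    refine hsum.congr fun l => ?_
    simp only [Function.comp_apply, sub_add_cancel]
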